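/- Let $n\ge 2$ and let $p=p(\rho,S)$ be an arbitrary smooth equation of state. Consider the radial Euler equations $$U_t+UU_r+\tfrac1\rho(p_SS_r+p_\rho\rho_r)=0,\qquad \rho_t+(U\rho)_r+\tfrac{n-1}{r}U\rho=0,\qquad S_t+US_r=0 .$$ A differential function is a smooth function of $t$, $r$, $U,\rho,S$ and finitely many of their $r$-derivatives ($r>0$, $\rho>0$); $D_r$ is the total $r$-derivative and $D_t$ the total $t$-derivative with all $t$-derivatives of $U,\rho,S$ eliminated by the equations. A differential function $\Phi^t$ is a conserved density if $D_t\Phi^t+D_r\Phi^r+\frac{n-1}{r}\Phi^r=0$ for some differential function $\Phi^r$; the moving flux is $\Psi=\Phi^r-U\Phi^t$, and $\Phi^t$ is the density of an integral invariant if $\Phi^r$ can be chosen with $\Psi=0$. A trivial density is one of the form $D_r\Theta+\frac{n-1}{r}\Theta$ with a differential function $\Theta$, and a kinematic density is a smooth function $k(r,U,\rho,S)$. Let $$\Phi^t=U_r^2\,\phi_2+U_r\,\phi_1+\phi_0,\qquad \phi_i=\phi_i(r,U,\rho,S,\rho_r,S_r),$$ be a conserved density, with $\phi_0,\phi_1,\phi_2$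 smooth on an open set. "Near a jet" means on a neighbourhood of it in the space of jets $(t,r,U,\rho,S,U_r,\rho_r,S_r,\dots)$ over that set. Then: 1. If the dependence on $U_r$ is essential, i.e. on no non-empty open set of jets does $\Phi^t$ differ by a trivial density from a function of $(r,U,\rho,S,\rho_r,S_r)$, then near every jet $\Phi^t$ is, modulo a trivial density, the density of an integral invariant. 2. Near every jet around whose $(\rho,S)$ one has $p_\rho\equiv0$, $\Phi^t$ is, modulo a trivial density, the density of an integral invariant. 3. Near every jet with $p_\rho\ne0$, $\Phi^t$ is, modulo a kinematic conserved density and a trivial density, the density of an integral invariant. In all three cases $\Theta$ can be chosen without explicit dependence on $t$ near every jet with $U\ne0$. -/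

import Mathlib

open scoped Topology ContDiff

namespace RadialFlow

noncomputable section

/-- The space of `r`-jets of radial flows: the time `t`, the radius `r`, and the values of
`∂_r^i (U, ρ, S)` for all `i`. Its topology is the product topology, so that a neighbourhood
of a jet restricts only finitely many coordinates. -/
abbrev Jet : Type := ℝ × ℝ × (ℕ → Fin 3 → ℝ)

/-- The radius. -/
def rad (z : Jet) : ℝ := z.2.1

/-- The `i`-th radial derivative of the radial velocity `U`. -/
def velD (i : ℕ) (z : Jet) : ℝ := z.2.2 i 0

/-- The `i`-th radial derivative of the density `ρ`. -/
def rhoD (i : ℕ) (z : Jet) : ℝ := z.2.2 i 1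

/-- The `i`-th radial derivative of the entropy `S`. -/
def entD (i : ℕ) (z : Jet) : ℝ := z.2.2 i 2

/-- Forget all radial derivatives of order greater than `K`. -/
def trunc (K : ℕ) (z : Jet) : ℝ × ℝ × (Fin (K + 1) → Fin 3 → ℝ) :=
  (z.1, z.2.1, fun i => z.2.2 i)

/-- `F` is a smooth function of `t`, `r`, the fluid variables and finitely many of their radial
derivatives, near every jet in `O`. -/
def IsLocalOn (F : Jet → ℝ) (O : Set Jet) : Prop :=
  ∀ z ∈ O, ∃ (K : ℕ) (g : ℝ × ℝ × (Fin (K + 1) → Fin 3 → ℝ) → ℝ),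
    ContDiffAt ℝ ∞ g (trunc K z) ∧ ∀ᶠ y in 𝓝 z, F y = g (trunc K y)

/-- `F` has no explicit dependence on `t` on `O`. -/
def IsTimeFreeOn (F : Jet → ℝ) (O : Set Jet) : Prop :=
  ∀ z ∈ O, ∀ s : ℝ, (s, z.2) ∈ O → F (s, z.2) = F z

/-- The total radial derivative `D_r`: by the chain rule, the derivative in the direction
`∂_r + ∑ u_{i+1} ∂_{u_i}`. -/
def Dr (F : Jet → ℝ) (z : Jet) : ℝ :=
  lineDeriv ℝ F z ((0, 1, fun i => z.2.2 (i + 1)) : Jet)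

/-- The radial divergence `D_r F + (n - 1) / r * F`. -/
def radDiv (n : ℕ) (F : Jet → ℝ) (z : Jet) : ℝ :=
  Dr F z + ((n : ℝ) - 1) / rad z * F z

/-- `∂p/∂ρ` for an equation of state `p (ρ, S)`. -/
def pRho (p : ℝ × ℝ → ℝ) (x : ℝ × ℝ) : ℝ := deriv (fun a => p (a, x.2)) x.1

/-- `∂p/∂S` for an equation of state `p (ρ, S)`. -/
def pEnt (p : ℝ × ℝ → ℝ) (x : ℝ × ℝ) : ℝ := deriv (fun b => p (x.1, b)) x.2

/-- The thermodynamic state `(ρ, S)` of a jet. -/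
def state (z : Jet) : ℝ × ℝ := (rhoD 0 z, entD 0 z)

/-- The expressions for `U_t`, `ρ_t`, `S_t` given by the radial Euler equations
`U_t + U U_r + (p_S S_r + p_ρ ρ_r) / ρ = 0`, `ρ_t + (U ρ)_r + (n - 1) / r * U ρ = 0`,
`S_t + U S_r = 0`. -/
def eulerRHS (n : ℕ) (p : ℝ × ℝ → ℝ) : Fin 3 → Jet → ℝ :=
  ![fun z => -(velD 0 z * velD 1 z
      + (pEnt p (state z) * entD 1 z + pRho p (state z) * rhoD 1 z) / rhoD 0 z),
    fun z => -((velD 1 z * rhoD 0 z + velD 0 z * rhoD 1 z)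
      + ((n : ℝ) - 1) / rad z * (velD 0 z * rhoD 0 z)),
    fun z => -(velD 0 z * entD 1 z)]

/-- The total time derivative `D_t F` on solutions, all `t`-derivatives of the fluid variables
being eliminated by the radial Euler equations: `∂_r^i u_t` becomes `D_r^i` of the right-hand
side. -/
def Dt (n : ℕ) (p : ℝ × ℝ → ℝ) (F : Jet → ℝ) (z : Jet) : ℝ :=
  lineDeriv ℝ F z ((1, 0, fun i j => (Dr^[i] (eulerRHS n p j)) z) : Jet)

/-- The local radial conservation law `D_t Φt + D_r Φr + (n - 1) / r * Φr = 0` on solutions. -/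
def IsConsLawOn (n : ℕ) (p : ℝ × ℝ → ℝ) (Φt Φr : Jet → ℝ) (O : Set Jet) : Prop :=
  IsLocalOn Φt O ∧ IsLocalOn Φr O ∧ ∀ z ∈ O, Dt n p Φt z + radDiv n Φr z = 0

/-- The moving flux `Ψ = Φr - U Φt`. -/
def movingFlux (Φt Φr : Jet → ℝ) (z : Jet) : ℝ := Φr z - velD 0 z * Φt z

/-- `Φ` is a conserved density. -/
def IsConservedOn (n : ℕ) (p : ℝ × ℝ → ℝ) (Φ : Jet → ℝ) (O : Set Jet) : Prop :=
  ∃ Φr : Jet → ℝ, IsConsLawOn n p Φ Φr O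

/-- `Φ` is the density of an integral invariant: it is conserved with zero moving flux. -/
def IsIntegralInvariantOn (n : ℕ) (p : ℝ × ℝ → ℝ) (Φ : Jet → ℝ) (O : Set Jet) : Prop :=
  ∃ Φr : Jet → ℝ, IsConsLawOn n p Φ Φr O ∧ ∀ z ∈ O, movingFlux Φ Φr z = 0

/-- Near the jet `z`, the density `Φ` is equivalent to the density of an integral invariant:
the two differ by a trivial density `D_r Θ + (n - 1) / r * Θ`. Where `U ≠ 0`, no explicit
time dependence is needed in `Θ`. -/
def EquivIntegralInvariantAt (n : ℕ) (p : ℝ × ℝ → ℝ) (Φ : Jet → ℝ) (z : Jet) : Prop :=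
  ∃ O : Set Jet, IsOpen O ∧ z ∈ O ∧ ∃ Θ : Jet → ℝ, IsLocalOn Θ O ∧
    (velD 0 z ≠ 0 → IsTimeFreeOn Θ O) ∧
    IsIntegralInvariantOn n p (fun y => Φ y - radDiv n Θ y) O

/-- The density `k (r, U, ρ, S)`, free of derivatives of the fluid variables. -/
def kinematic (k : ℝ × ℝ × ℝ × ℝ → ℝ) (z : Jet) : ℝ :=
  k (rad z, velD 0 z, rhoD 0 z, entD 0 z)

/-- Near the jet `z`, subtracting a kinematic conserved density from `Φ` leaves a density which
is equivalent to the density of an integral invariant. -/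
def EquivIntegralInvariantModKinematicAt (n : ℕ) (p : ℝ × ℝ → ℝ) (Φ : Jet → ℝ) (z : Jet) :
    Prop :=
  ∃ (k : ℝ × ℝ × ℝ × ℝ → ℝ) (O : Set Jet), IsOpen O ∧ z ∈ O ∧
    IsConservedOn n p (kinematic k) O ∧
    EquivIntegralInvariantAt n p (fun y => Φ y - kinematic k y) z

/-- The arguments `(r, U, ρ, S, ρ_r, S_r)` of the coefficients of a first-order density that is
quadratic in `U_r`. -/
def coeffArgs (z : Jet) : ℝ × ℝ × ℝ × ℝ × ℝ × ℝ :=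
  (rad z, velD 0 z, rhoD 0 z, entD 0 z, rhoD 1 z, entD 1 z)

/-- The density `U_r² φ₂ + U_r φ₁ + φ₀`. -/
def quadDensity (φ₂ φ₁ φ₀ : ℝ × ℝ × ℝ × ℝ × ℝ × ℝ → ℝ) (z : Jet) : ℝ :=
  velD 1 z ^ 2 * φ₂ (coeffArgs z) + velD 1 z * φ₁ (coeffArgs z) + φ₀ (coeffArgs z)

/-- On `O`, all dependence of `Φ` on `U_r` can be removed by a trivial density: `Φ` is
equivalent to a density of the quadratic form with `φ₂ = φ₁ = 0`. -/
def IsReducibleOn (n : ℕ) (Φ : Jet → ℝ) (O : Set Jet) : Prop :=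
  ∃ (Θ : Jet → ℝ) (χ : ℝ × ℝ × ℝ × ℝ × ℝ × ℝ → ℝ), IsLocalOn Θ O ∧
    ∀ z ∈ O, Φ z = quadDensity 0 0 χ z + radDiv n Θ z

/-- The dependence of `Φ` on `U_r` is essential: on no non-empty open subset of `O` can it be
removed by a trivial density. -/
def IsEssentialOn (n : ℕ) (Φ : Jet → ℝ) (O : Set Jet) : Prop :=
  ∀ O' : Set Jet, IsOpen O' → O'.Nonempty → O' ⊆ O → ¬ IsReducibleOn n Φ O'

end

end RadialFlow

/-!
Write `N = n - 1` and let `v = 1 / (ρ r^N)` be the specific volume with respect to the Lagrangian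
mass coordinate `m`. The derivation `∂_m = v D_r` commutes with the material derivative
`d = D_t + U D_r` on solutions (`RadialFlow.IsRegular.matDeriv_Dm`),
  and for a density `Φ = ρ f` with
moving flux `r^{-N} q` the conservation law becomes `d f + ∂_m q = 0`. Trivial densities are those
with `f = ∂_m θ`, which have the flux `q = -d θ`, and `Φ` is the density of an integral invariant
when `d f = 0`.

*Determining equations.* The flux has first order, since `∂_m q = -d f` has order two
(`RadialFlow.lagrangian_conservation`). Hence `f` and `q` are functions of the seven coordinates
`x = r`, `S`, `v`, `U`, `s = ∂_m S`, `y = ∂_m v`, `w = ∂_m U`; the law is affine in the second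
derivatives and splits into four equations (`RadialFlow.exists_lagrangianSystem`). These are studied
in an algebra with commuting derivations (`DeterminingSystem`),
  where a particle has the acceleration
`κ y + g s + h` and `κ` is a unit if and only if `p_ρ` has no zero.

*Jets with `p_ρ ≠ 0`.* Repeated differentiation with respect to `y` and `w` shows that `f_ww`,
`f_wy` and `f_yy` vanish. If `κ_v` is a unit this is immediate from the third and fourth derivatives
(`DeterminingSystem.quadratic_eq_zero_of_isUnit`). If `κ_v = 0`, then `f_ww` and `f_wy` satisfy an
overdetermined wave system (`WaveSystem`), whose only solution is zero because the geometry is not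
planar: this is where `N ≠ 0` enters. These two cases occur on open sets with dense union, and
continuity gives the rest (`LagrangianSystem.quadratic_eq_zero`). Then `f_w` and `f_y` are the `U`
  and
`v` derivatives of one function of `(x, S, v, U)`, and a separation of variables leads to the normal
form `f = ∂_m θ + A (S, ∂_m S) + k (x, S, v, U)` (`LagrangianSystem.normal_form`). Since `S` and
`∂_m S` are advected by the fluid, so is `A`; the kinematic density `ρ k` is therefore conserved,
  and
`Φ - ρ k` is equivalent to the density `ρ A` of an integral invariant. Moreover `f - ∂_m θ` does not
depend on `U_r`, so the dependence on `U_r` is not essential near such a jet.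

*Jets around which `p_ρ` vanishes.* Now `κ = 0`, so that `q` does not depend on `y`. The remaining
coordinates, together with the time and with `∂_m s`, are mapped by `d` to functions of themselves:
on them `d` is a vector field, which does not vanish because of its component `∂_t`, or,
  without this
component, where `U ≠ 0`. The transport equation `d θ = -q` has a smooth local solution
(`exists_transport`, `RadialFlow.exists_matDeriv_eq`), and `d (f - ∂_m θ) = d f + ∂_m q = 0`.

If the dependence on `U_r` is essential, the first case cannot occur anywhere, and the second one
applies near every jet.
-/

set_option linter.unusedSectionVars false
set_option linter.unusedSimpArgs false

open Set Filter

/-- Smooth on some neighbourhood of the point. (A bare `ContDiffAt ℝ ∞ f x` would only give, for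
each finite order, a neighbourhood depending on the order.) -/
def SmoothNear {E F : Type*} [NormedAddCommGroup E] [NormedSpace ℝ E] [NormedAddCommGroup F]
    [NormedSpace ℝ F] (f : E → F) (x : E) : Prop :=
  ∀ᶠ y in 𝓝 x, ContDiffAt ℝ ∞ f y

/-! ### Smooth local inverses -/

section InverseFunction

variable {E F : Type*} [NormedAddCommGroup E] [NormedSpace ℝ E] [CompleteSpace E]
  [NormedAddCommGroup F] [NormedSpace ℝ F]

/-- The inverse function theorem, with a local inverse that is smooth on a whole neighbourhood:
near `x` the derivative of `f` stays invertible. -/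
theorem SmoothNear.exists_local_inverse {f : E → F} {x : E} (hf : SmoothNear f x)
    {f' : E ≃L[ℝ] F} (hf' : HasFDerivAt f (f' : E →L[ℝ] F) x) :
    ∃ g : F → E, g (f x) = x ∧ SmoothNear g (f x) ∧ (∀ᶠ y in 𝓝 (f x), f (g y) = y) ∧
      ∀ᶠ y in 𝓝 x, g (f y) = y := by
  have hx : ContDiffAt ℝ ∞ f x := hf.self_of_nhds
  have h1 : (∞ : WithTop ℕ∞) ≠ 0 := by simp
  set e := hx.toOpenPartialHomeomorph f hf' h1 with he
  have hef : ∀ y, e y = f y := fun y => rfl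
  have hxs : x ∈ e.source := hx.mem_toOpenPartialHomeomorph_source hf' h1
  have hxt : f x ∈ e.target := hx.image_mem_toOpenPartialHomeomorph_target hf' h1
  have hgx : e.symm (f x) = x := e.left_inv hxs
  refine ⟨e.symm, hgx, ?_, ?_, ?_⟩
  · have hc : ContinuousAt e.symm (f x) := e.continuousAt_symm hxt
    have hinv : ∀ᶠ y in 𝓝 x, fderiv ℝ f y ∈ range ((↑) : (E ≃L[ℝ] F) → E →L[ℝ] F) := by
      have h2 : ContinuousAt (fderiv ℝ f) x := (hx.fderiv_right (m := 0) (by simp)).continuousAt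
      apply h2.eventually
      rw [hf'.fderiv]
      exact f'.nhds
    have h3 : ∀ᶠ y in 𝓝 x, ContDiffAt ℝ ∞ f y ∧
        fderiv ℝ f y ∈ range ((↑) : (E ≃L[ℝ] F) → E →L[ℝ] F) := hf.and hinv
    have h4 := hc.eventually (by rw [hgx]; exact h3)
    filter_upwards [h4, e.open_target.mem_nhds hxt] with y hy hyt
    obtain ⟨hy1, ⟨L, hL⟩⟩ := hy
    refine e.contDiffAt_symm (f₀' := L) hyt ?_ hy1
    rw [hL]
    exact (hy1.differentiableAt (by simp)).hasFDerivAt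
  · filter_upwards [e.open_target.mem_nhds hxt] with y hy using e.right_inv hy
  · filter_upwards [e.open_source.mem_nhds hxs] with y hy using e.left_inv hy

end InverseFunction

/-! ### Flows of smooth vector fields -/

section Superposition

variable {K : Type*} [TopologicalSpace K] [CompactSpace K]

/-- The superposition operator `γ ↦ X ∘ γ` on continuous functions on a compact space. -/
def superposition {E F : Type*} [TopologicalSpace E] [TopologicalSpace F] (X : C(E, F)) :
    C(K, E) → C(K, F) := fun γ => X.comp γ

/-- The bilinear map applying a continuous family of operators to a continuous function. -/
noncomputable def applyFamily (K : Type*) [TopologicalSpace K] [CompactSpace K]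
    (E F : Type*) [NormedAddCommGroup E] [NormedSpace ℝ E]
    [NormedAddCommGroup F] [NormedSpace ℝ F] :
    C(K, E →L[ℝ] F) →L[ℝ] C(K, E) →L[ℝ] C(K, F) :=
  LinearMap.mkContinuous₂
    (LinearMap.mk₂ ℝ (fun (A : C(K, E →L[ℝ] F)) (h : C(K, E)) =>
        (⟨fun s => A s (h s), A.continuous.clm_apply h.continuous⟩ : C(K, F)))
      (fun _ _ _ => by ext; simp) (fun _ _ _ => by ext; simp)
      (fun _ _ _ => by ext; simp) (fun _ _ _ => by ext; simp)) 1 (fun A h => by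
        rw [one_mul, ContinuousMap.norm_le _ (by positivity)]
        intro s
        refine ((A s).le_opNorm _).trans ?_
        gcongr
        exacts [A.norm_coe_le_norm s, h.norm_coe_le_norm s])

/-- The superposition operator is differentiable, because `X'` is uniformly continuous near the
compact image of `γ`. -/
theorem hasFDerivAt_superposition {E F : Type*} [NormedAddCommGroup E] [NormedSpace ℝ E]
    [NormedAddCommGroup F] [NormedSpace ℝ F] {X : C(E, F)} {X' : C(E, E →L[ℝ] F)}
    (hX : ∀ x, HasFDerivAt X (X' x) x) (γ : C(K, E)) :
    HasFDerivAt (superposition (K := K) X) (applyFamily K E F (superposition X' γ)) γ := by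
  rw [hasFDerivAt_iff_isLittleO_nhds_zero, Asymptotics.isLittleO_iff]
  intro c hc
  have hcont : Continuous (superposition (K := K) X') := ContinuousMap.continuous_postcomp X'
  obtain ⟨δ, hδ, hball⟩ := Metric.continuousAt_iff (α := C(K, E)) (β := C(K,
    E →L[ℝ] F)).1 (hcont.continuousAt (x := γ)) c hc
  filter_upwards [Metric.ball_mem_nhds (0 : C(K, E)) hδ] with h hh
  rw [ContinuousMap.norm_le _ (by positivity)]
  intro s
  have hhs : ‖h s‖ < δ := (h.norm_coe_le_norm s).trans_lt (by simpa using hh)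
  have key := (convex_ball (γ s) δ).norm_image_sub_le_of_norm_hasFDerivWithin_le'
    (f := X) (f' := X') (φ := X' (γ s)) (C := c) (x := γ s) (y := γ s + h s)
    (fun x _ => (hX x).hasFDerivWithinAt) (fun x hx => ?_) (Metric.mem_ball_self hδ)
    (by simpa [Metric.mem_ball, dist_eq_norm] using hhs)
  · calc _ = ‖X (γ s + h s) - X (γ s) - X' (γ s) (γ s + h s - γ s)‖ := by
          simp [superposition, applyFamily]
      _ ≤ c * ‖γ s + h s - γ s‖ := key
      _ ≤ c * ‖h‖ := by
          rw [add_sub_cancel_left]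
          exact mul_le_mul_of_nonneg_left (h.norm_coe_le_norm s) hc.le
  · have h1 : dist (γ + ContinuousMap.const K (x - γ s)) γ < δ := by
      have h0 : ‖x - γ s‖ < δ := by simpa [Metric.mem_ball, dist_eq_norm] using hx
      rw [dist_eq_norm, add_sub_cancel_left]
      refine lt_of_le_of_lt ?_ h0
      rw [ContinuousMap.norm_le _ (norm_nonneg _)]
      intro t; simp
    have h2 := hball h1
    have h3 := (ContinuousMap.dist_apply_le_dist (f := superposition X' (γ + ContinuousMap.const K
      (x - γ s)))
      (g := superposition X' γ) s).trans h2.le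
    simpa [superposition, dist_eq_norm] using h3

/-- The derivative of a superposition operator is again built from one, so smoothness follows by
induction on the order. -/
theorem contDiff_superposition {E : Type} [NormedAddCommGroup E] [NormedSpace ℝ E] (m : ℕ) :
    ∀ {F : Type} [NormedAddCommGroup F] [NormedSpace ℝ F] (X : C(E, F)),
    ContDiff ℝ ∞ X → ContDiff ℝ m (superposition (K := K) X) := by
  induction m with
  | zero =>
    intro F _ _ X _
    exact contDiff_zero.2 (ContinuousMap.continuous_postcomp X)
  | succ m ih =>
    intro F _ _ X hX
    have hX' : ContDiff ℝ ∞ (fderiv ℝ X) := hX.fderiv_right (by simp)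
    have h2 := ih (⟨fderiv ℝ X, hX'.continuous⟩ : C(E, E →L[ℝ] F)) hX'
    refine contDiff_succ_iff_hasFDerivAt.2 ⟨_, (applyFamily K E F).contDiff.comp h2, fun γ => ?_⟩
    exact hasFDerivAt_superposition (X' := (⟨fderiv ℝ X, hX'.continuous⟩ : C(E, E →L[ℝ] F)))
      (fun x => (hX.differentiable (by simp) x).hasFDerivAt) γ

theorem contDiff_infty_superposition {E F : Type} [NormedAddCommGroup E] [NormedSpace ℝ E]
    [NormedAddCommGroup F] [NormedSpace ℝ F] (X : C(E, F)) (hX : ContDiff ℝ ∞ X) :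
    ContDiff ℝ ∞ (superposition (K := K) X) :=
  contDiff_infty.2 fun m => contDiff_superposition m X hX

end Superposition

section Flow

variable {E : Type} [NormedAddCommGroup E] [NormedSpace ℝ E] [CompleteSpace E]

local notation "I₁" => Icc (-1 : ℝ) 1

/-- The primitive vanishing at `0` of a continuous function on `[-1, 1]`. -/
noncomputable def primitive (E : Type) [NormedAddCommGroup E] [NormedSpace ℝ E]
    [CompleteSpace E] : C(I₁, E) →L[ℝ] C(I₁, E) :=
  LinearMap.mkContinuous
    { toFun := fun γ => ⟨fun s => ∫ r in (0 : ℝ)..s, IccExtend (by norm_num) γ r,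
        (intervalIntegral.continuous_primitive
          (fun a b => (γ.continuous.Icc_extend' (h := by norm_num)).intervalIntegrable a b)
          0).comp continuous_subtype_val⟩
      map_add' := fun γ δ => by
        ext s
        exact intervalIntegral.integral_add
          ((γ.continuous.Icc_extend' (h := by norm_num)).intervalIntegrable _ _)
          ((δ.continuous.Icc_extend' (h := by norm_num)).intervalIntegrable _ _)
      map_smul' := fun c γ => by
        ext s
        exact intervalIntegral.integral_smul c _ } 1 (fun γ => by
      rw [one_mul, ContinuousMap.norm_le _ (norm_nonneg _)]
      intro s
      have h := intervalIntegral.norm_integral_le_of_norm_le_const (a := 0) (b := (s : ℝ))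
        (C := ‖γ‖) (f := IccExtend (by norm_num) γ) (fun r _ => γ.norm_coe_le_norm _)
      refine h.trans ?_
      have hs : |(s : ℝ) - 0| ≤ 1 := by rw [sub_zero, abs_le]; exact s.2
      nlinarith [norm_nonneg γ])

/-- The map whose zeros in the last component are the solutions `γ` of `γ' = σ X(γ)`,
`γ 0 = η` on `[-1, 1]`. Scaling time by `σ` makes the derivative at `σ = 0` trivial. -/
noncomputable def flowEquation (X : C(E, E)) (q : (ℝ × E) × C(I₁, E)) : (ℝ × E) × C(I₁, E) :=
  (q.1, q.2 - ContinuousMap.const I₁ q.1.2 - q.1.1 • primitive E (superposition X q.2))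

/-- Constant functions, as a continuous linear map. -/
noncomputable def constL (E : Type) [NormedAddCommGroup E] [NormedSpace ℝ E] : E →L[ℝ] C(I₁, E) :=
  LinearMap.mkContinuous
    { toFun := fun x => ContinuousMap.const I₁ x
      map_add' := fun _ _ => by ext; simp
      map_smul' := fun _ _ => by ext; simp } 1 (fun x => by
      rw [one_mul, ContinuousMap.norm_le _ (norm_nonneg _)]; intro s; simp)

theorem contDiff_flowEquation (X : C(E, E)) (hX : ContDiff ℝ ∞ X) :
    ContDiff ℝ ∞ (flowEquation X) := by
  refine contDiff_fst.prodMk ((contDiff_snd.sub ((constL E).contDiff.comp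
    (contDiff_snd.comp contDiff_fst))).sub ((contDiff_fst.comp contDiff_fst).smul
    ((primitive E).contDiff.comp ((contDiff_infty_superposition X hX).comp contDiff_snd))))

/-- At `σ = 0` and a constant curve the derivative of the flow equation is triangular, hence
invertible. -/
theorem exists_hasFDerivAt_flowEquation (X : C(E, E)) (hX : ContDiff ℝ ∞ X) (x : E) :
    ∃ L : ((ℝ × E) × C(I₁, E)) ≃L[ℝ] ((ℝ × E) × C(I₁, E)),
      HasFDerivAt (flowEquation X) (L : ((ℝ × E) × C(I₁, E)) →L[ℝ] ((ℝ × E) × C(I₁, E)))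
        ((0, x), ContinuousMap.const I₁ x) := by
  set c : C(I₁, E) := ContinuousMap.const I₁ x
  set v : C(I₁, E) := primitive E (superposition X c)
  let T : (ℝ × E) →L[ℝ] C(I₁, E) := (constL E).comp (ContinuousLinearMap.snd ℝ ℝ E) +
    (ContinuousLinearMap.fst ℝ ℝ E).smulRight v
  let A : ((ℝ × E) × C(I₁, E)) →L[ℝ] ((ℝ × E) × C(I₁, E)) :=
    (ContinuousLinearMap.fst ℝ _ _).prod
      (ContinuousLinearMap.snd ℝ _ _ - T.comp (ContinuousLinearMap.fst ℝ _ _))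
  let B : ((ℝ × E) × C(I₁, E)) →L[ℝ] ((ℝ × E) × C(I₁, E)) :=
    (ContinuousLinearMap.fst ℝ _ _).prod
      (ContinuousLinearMap.snd ℝ _ _ + T.comp (ContinuousLinearMap.fst ℝ _ _))
  refine ⟨ContinuousLinearEquiv.equivOfInverse A B (fun q => by simp [A, B])
    (fun q => by simp [A, B]), ?_⟩
  have hN : HasFDerivAt (fun q : (ℝ × E) × C(I₁, E) => primitive E (superposition X q.2))
      ((primitive E).comp ((fderiv ℝ (superposition (K := I₁) X) c).comp
        (ContinuousLinearMap.snd ℝ (ℝ × E) C(I₁, E)))) ((0, x), c) := by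
    refine (primitive E).hasFDerivAt.comp _ (HasFDerivAt.comp (g := superposition (K := I₁) X)
      (f := Prod.snd) _ ?_ hasFDerivAt_snd)
    exact ((contDiff_infty_superposition X hX).differentiable (by simp) c).hasFDerivAt
  have h1 : HasFDerivAt (fun q : (ℝ × E) × C(I₁, E) => q.1.1)
      ((ContinuousLinearMap.fst ℝ ℝ E).comp (ContinuousLinearMap.fst ℝ _ _)) ((0, x), c) :=
    ((ContinuousLinearMap.fst ℝ ℝ E).comp
      (ContinuousLinearMap.fst ℝ (ℝ × E) C(I₁, E))).hasFDerivAt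
  have h2 : HasFDerivAt (fun q : (ℝ × E) × C(I₁, E) => ContinuousMap.const I₁ q.1.2)
      ((constL E).comp ((ContinuousLinearMap.snd ℝ ℝ E).comp (ContinuousLinearMap.fst ℝ _ _)))
      ((0, x), c) :=
    ((constL E).comp ((ContinuousLinearMap.snd ℝ ℝ E).comp
      (ContinuousLinearMap.fst ℝ (ℝ × E) C(I₁, E)))).hasFDerivAt
  have h3 := (hasFDerivAt_fst (𝕜 := ℝ) (p := (((0 : ℝ), x), c))).prodMk
    ((hasFDerivAt_snd.sub h2).sub (h1.smul hN))
  refine h3.congr_fderiv ?_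
  ext q <;> simp [A, T, v]

/-- The last component of `flowEquation` vanishes at the solutions of the integral equation of the
flow. -/
theorem flowEquation_snd_eq_zero_iff (X : C(E, E)) (σ : ℝ) (η : E) (γ : C(I₁, E)) :
    (flowEquation X ((σ, η), γ)).2 = 0 ↔
      ∀ s : I₁, γ s = η + σ • ∫ r in (0 : ℝ)..s, X (IccExtend (by norm_num) γ r) := by
  have h : ∀ s : I₁, primitive E (superposition X γ) s =
      ∫ r in (0 : ℝ)..s, X (IccExtend (by norm_num) γ r) := fun s => rfl
  rw [ContinuousMap.ext_iff]
  refine forall_congr' fun s => ?_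
  simp only [flowEquation, ContinuousMap.sub_apply, ContinuousMap.const_apply,
    ContinuousMap.smul_apply, h, ContinuousMap.zero_apply]
  rw [sub_eq_zero, sub_eq_iff_eq_add, add_comm]

/-- Smooth dependence of the local flow on time and initial value. -/
theorem exists_smooth_flow (X : E → E) (hX : ContDiff ℝ ∞ X) (x : E) :
    ∃ F : ℝ × E → E, SmoothNear F (0, x) ∧ (∀ᶠ η in 𝓝 x, F (0, η) = η) ∧
      ∀ᶠ q in 𝓝 ((0 : ℝ), x), HasDerivAt (fun σ => F (σ, q.2)) (X (F q)) q.1 := by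
  set Xc : C(E, E) := ⟨X, hX.continuous⟩ with hXc
  set c : C(I₁, E) := ContinuousMap.const I₁ x with hc
  obtain ⟨L, hL⟩ := exists_hasFDerivAt_flowEquation Xc hX x
  have hsm : SmoothNear (flowEquation Xc) ((0, x), c) :=
    Eventually.of_forall fun q => (contDiff_flowEquation Xc hX).contDiffAt
  obtain ⟨g, hg0, hgs, hgr, hgl⟩ := hsm.exists_local_inverse hL
  have hbase : flowEquation Xc ((0, x), c) = ((0, x), 0) := by
    simp [flowEquation, hc]
  rw [hbase] at hg0 hgs hgr
  let ι : ℝ × E → (ℝ × E) × C(I₁, E) := fun q => (q, 0)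
  have hι : ContDiff ℝ ∞ ι := contDiff_id.prodMk contDiff_const
  let Γ : ℝ × E → C(I₁, E) := fun q => (g (ι q)).2
  have hιt : Tendsto ι (𝓝 (0, x)) (𝓝 ((0, x), 0)) := hι.continuous.tendsto _
  have hΓs : SmoothNear Γ (0, x) := by
    filter_upwards [hιt.eventually hgs] with q hq
    exact (contDiff_snd.contDiffAt.comp q (hq.comp q hι.contDiffAt))
  have hΓ0 : Γ (0, x) = c := by
    change (g ((0, x), 0)).2 = c
    rw [hg0]
  have hΓe : ∀ᶠ q in 𝓝 ((0 : ℝ), x), flowEquation Xc (q, Γ q) = (q, 0) := by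
    filter_upwards [hιt.eventually hgr] with q hq
    have h1 : (g (ι q)).1 = q := congrArg Prod.fst hq
    have h2 : (q, Γ q) = g (ι q) := Prod.ext h1.symm rfl
    rw [h2, hq]
  have hΓc : Tendsto Γ (𝓝 (0, x)) (𝓝 c) := by
    have := hΓs.self_of_nhds.continuousAt
    rwa [ContinuousAt, hΓ0] at this
  -- local uniqueness of solutions of the integral equation
  have huniq : ∀ᶠ q in 𝓝 (((0 : ℝ), x), c), (flowEquation Xc q).2 = 0 → q.2 = Γ q.1 := by
    filter_upwards [hgl] with q hq h0
    have h1 : flowEquation Xc q = ι q.1 := Prod.ext rfl h0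
    rw [h1] at hq
    change q.2 = (g (ι q.1)).2
    rw [hq]
  obtain ⟨ε, hε, hεu⟩ := Metric.eventually_nhds_iff_ball.1 huniq
  have hδ : ∀ᶠ q in 𝓝 ((0 : ℝ), x), Γ q ∈ Metric.ball c ε ∧ flowEquation Xc (q, Γ q) = (q, 0) :=
    (hΓc.eventually (Metric.ball_mem_nhds c hε)).and hΓe
  obtain ⟨δ, hδ0, hδb⟩ := Metric.eventually_nhds_iff_ball.1 hδ
  let e1 : I₁ := ⟨1, by norm_num⟩
  have hone : ContDiff ℝ ∞ (fun γ : C(I₁, E) => γ e1) :=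
    (ContinuousMap.evalCLM ℝ e1 : C(I₁, E) →L[ℝ] E).contDiff
  -- reparametrising the solution with scale `τ` gives all solutions with smaller scale
  set τ : ℝ := min δ ε / 2 with hτ
  have hτ0 : 0 < τ := by positivity
  have hτδ : τ < δ := by
    have := min_le_left δ ε
    rw [hτ]; linarith
  have hτε : τ < ε := by
    have := min_le_right δ ε
    rw [hτ]; linarith
  have key : ∀ σ : ℝ, |σ| ≤ τ → ∀ η ∈ Metric.ball x (min δ ε),
      Γ (σ, η) e1 = η + τ • ∫ r in (0 : ℝ)..(σ / τ), X (IccExtend (by norm_num) (Γ (τ, η)) r) := by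
    intro σ hσ η hη
    have hηδ : dist η x < δ := lt_of_lt_of_le hη (min_le_left _ _)
    have hηε : dist η x < ε := lt_of_lt_of_le hη (min_le_right _ _)
    have hmem : (τ, η) ∈ Metric.ball ((0 : ℝ), x) δ := by
      rw [Metric.mem_ball, Prod.dist_eq, max_lt_iff]
      refine ⟨?_, hηδ⟩
      rw [Real.dist_eq, sub_zero, abs_of_pos hτ0]; exact hτδ
    obtain ⟨hb1, hb2⟩ := hδb _ hmem
    have hsol := (flowEquation_snd_eq_zero_iff Xc τ η (Γ (τ, η))).1 (congrArg Prod.snd hb2)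
    have habs : |σ / τ| ≤ 1 := by rw [abs_div, abs_of_pos hτ0, div_le_one hτ0]; exact hσ
    let ρ : C(I₁, I₁) := ⟨fun s => ⟨σ / τ * s, abs_le.1 (by
        rw [abs_mul]
        have := abs_le.2 s.2
        have := abs_nonneg (s : ℝ)
        nlinarith [abs_nonneg (σ / τ)])⟩, by fun_prop⟩
    have hγ : (flowEquation Xc ((σ, η), (Γ (τ, η)).comp ρ)).2 = 0 := by
      rw [flowEquation_snd_eq_zero_iff]
      intro s
      change Γ (τ, η) (ρ s) = _
      rw [hsol (ρ s)]
      have h1 : ∀ r ∈ uIcc (0 : ℝ) s,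
          Xc (IccExtend (by norm_num) ((Γ (τ, η)).comp ρ) r) =
            Xc (IccExtend (by norm_num) (Γ (τ, η)) (σ / τ * r)) := by
        intro r hr
        have hr1 : r ∈ I₁ := by
          have h0 : (0 : ℝ) ∈ I₁ := by norm_num
          exact (uIcc_subset_Icc h0 s.2) hr
        have hr2 : IccExtend (by norm_num) (Γ (τ, η)) (σ / τ * r) = Γ (τ, η) (ρ ⟨r, hr1⟩) :=
          IccExtend_of_mem _ _ (ρ ⟨r, hr1⟩).2
        rw [IccExtend_of_mem _ _ hr1, hr2]
        rfl
      have h2 : (∫ r in (0 : ℝ)..s, Xc (IccExtend (by norm_num) ((Γ (τ, η)).comp ρ) r)) =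
          ∫ r in (0 : ℝ)..s, Xc (IccExtend (by norm_num) (Γ (τ, η)) (σ / τ * r)) :=
        intervalIntegral.integral_congr h1
      rw [h2]
      have h3 := intervalIntegral.smul_integral_comp_mul_left (a := 0) (b := (s : ℝ))
        (fun r => Xc (IccExtend (by norm_num) (Γ (τ, η)) r)) (σ / τ)
      rw [mul_zero] at h3
      change _ + τ • (∫ r in (0 : ℝ)..(σ / τ * s), _) = _
      rw [← h3, smul_smul, mul_div_cancel₀ _ hτ0.ne']
    have hball : ((σ, η), (Γ (τ, η)).comp ρ) ∈ Metric.ball (((0 : ℝ), x), c) ε := by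
      rw [Metric.mem_ball, Prod.dist_eq, Prod.dist_eq, max_lt_iff, max_lt_iff]
      refine ⟨⟨?_, hηε⟩, ?_⟩
      · rw [Real.dist_eq, sub_zero]; exact hσ.trans_lt hτε
      · refine lt_of_le_of_lt ?_ (Metric.mem_ball.1 hb1)
        rw [ContinuousMap.dist_le dist_nonneg]
        intro s
        exact ContinuousMap.dist_apply_le_dist (f := Γ (τ, η)) (g := c) (ρ s)
    have heq : (Γ (τ, η)).comp ρ = Γ (σ, η) := hεu _ hball hγ
    rw [← heq]
    change Γ (τ, η) (ρ e1) = _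
    rw [hsol (ρ e1)]
    have h4 : ((ρ e1 : I₁) : ℝ) = σ / τ := mul_one _
    rw [h4]
    rfl
  refine ⟨fun q => Γ q e1, ?_, ?_, ?_⟩
  · filter_upwards [hΓs] with q hq using hone.contDiffAt.comp q hq
  · filter_upwards [Metric.ball_mem_nhds x (lt_min hδ0 hε)] with η hη
    rw [key 0 (by simpa using hτ0.le) η hη]
    simp
  · have hb : ∀ᶠ q in 𝓝 ((0 : ℝ), x), q ∈ Metric.ball (0 : ℝ) τ ×ˢ Metric.ball x (min δ ε) :=
      prod_mem_nhds (Metric.ball_mem_nhds _ hτ0) (Metric.ball_mem_nhds x (lt_min hδ0 hε))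
    filter_upwards [hb] with q hq
    obtain ⟨σ, η⟩ := q
    obtain ⟨hσ, hη⟩ := hq
    have hσ' : |σ| < τ := by simpa [Real.dist_eq] using hσ
    have hηδ : dist η x < δ := lt_of_lt_of_le hη (min_le_left _ _)
    have hmem : (τ, η) ∈ Metric.ball ((0 : ℝ), x) δ := by
      rw [Metric.mem_ball, Prod.dist_eq, max_lt_iff]
      refine ⟨?_, hηδ⟩
      rw [Real.dist_eq, sub_zero, abs_of_pos hτ0]; exact hτδ
    have hsol := (flowEquation_snd_eq_zero_iff Xc τ η (Γ (τ, η))).1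
      (congrArg Prod.snd (hδb _ hmem).2)
    have habs : |σ / τ| ≤ 1 := by
      rw [abs_div, abs_of_pos hτ0, div_le_one hτ0]; exact hσ'.le
    have hval : Γ (σ, η) e1 = IccExtend (by norm_num) (Γ (τ, η)) (σ / τ) := by
      rw [key σ hσ'.le η hη, IccExtend_of_mem _ _ (abs_le.1 habs), hsol]
      rfl
    have hcont : Continuous (fun r => X (IccExtend (by norm_num) (Γ (τ, η)) r)) :=
      hX.continuous.comp ((Γ (τ, η)).continuous.Icc_extend' (h := by norm_num))
    have hd : HasDerivAt (fun u => ∫ r in (0 : ℝ)..u, X (IccExtend (by norm_num) (Γ (τ, η)) r))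
        (X (IccExtend (by norm_num) (Γ (τ, η)) (σ / τ))) (σ / τ) :=
      intervalIntegral.integral_hasDerivAt_right (hcont.intervalIntegrable _ _)
        (hcont.stronglyMeasurableAtFilter _ _) hcont.continuousAt
    have hd2 := (((hd.scomp σ ((hasDerivAt_id σ).div_const τ)).const_smul τ).const_add η)
    have hd3 : HasDerivAt (fun σ => η + τ • ∫ r in (0 : ℝ)..(σ / τ),
        X (IccExtend (by norm_num) (Γ (τ, η)) r)) (X (Γ (σ, η) e1)) σ := by
      rw [hval]
      refine hd2.congr_deriv ?_
      rw [smul_smul, mul_one_div_cancel hτ0.ne', one_smul]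
    refine hd3.congr_of_eventuallyEq ?_
    filter_upwards [Metric.isOpen_ball.mem_nhds hσ] with σ'' h''
    exact key σ'' (by simpa [Real.dist_eq] using (le_of_lt h'' : dist σ'' 0 ≤ τ)) η hη

end Flow

/-! ### The transport equation -/

section Transport

variable {E : Type} [NormedAddCommGroup E] [NormedSpace ℝ E] [FiniteDimensional ℝ E]

/-- A function which is smooth near a point agrees near it with a globally smooth one. -/
theorem SmoothNear.exists_contDiff_eventuallyEq {F : Type*} [NormedAddCommGroup F]
    [NormedSpace ℝ F] {f : E → F} {x : E} (hf : SmoothNear f x) :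
    ∃ g : E → F, ContDiff ℝ ∞ g ∧ g =ᶠ[𝓝 x] f := by
  obtain ⟨r, hr, hball⟩ := Metric.eventually_nhds_iff_ball.1 hf
  let b : ContDiffBump x := ⟨r / 4, r / 2, by positivity, by linarith⟩
  refine ⟨fun y => b y • f y, ?_, ?_⟩
  · rw [contDiff_iff_contDiffAt]
    intro y
    by_cases hy : dist y x < r
    · exact b.contDiff.contDiffAt.smul (hball y hy)
    · have : (fun y => b y • f y) =ᶠ[𝓝 y] fun _ => 0 := by
        have h1 : ∀ᶠ w in 𝓝 y, r / 2 < dist w x :=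
          (continuous_id.dist continuous_const).continuousAt.eventually
            (lt_mem_nhds (by simp only [id]; linarith))
        filter_upwards [h1] with w hw
        rw [b.zero_of_le_dist hw.le, zero_smul]
      exact contDiffAt_const.congr_of_eventuallyEq this
  · filter_upwards [b.eventuallyEq_one] with y hy
    rw [hy]; simp

/-- The transport equation `∂_X θ = ψ` has a smooth solution near every point where the vector
field `X` does not vanish: straighten the field by its flow, started on a transversal hyperplane,
and integrate `ψ` along the flow lines. -/
theorem exists_transport {X : E → E} {ψ : E → ℝ} {x : E} (hX : SmoothNear X x)
    (hψ : SmoothNear ψ x) (h0 : X x ≠ 0) :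
    ∃ θ : E → ℝ, SmoothNear θ x ∧ ∀ᶠ y in 𝓝 x, fderiv ℝ θ y (X y) = ψ y := by
  have : CompleteSpace E := FiniteDimensional.complete ℝ E
  obtain ⟨X₁, hX₁, hXX⟩ := hX.exists_contDiff_eventuallyEq
  obtain ⟨ψ₁, hψ₁, hψψ⟩ := hψ.exists_contDiff_eventuallyEq
  obtain ⟨ℓ, hℓ⟩ : ∃ ℓ : E →L[ℝ] ℝ, ℓ (X x) = 1 := SeparatingDual.exists_eq_one h0
  have hX0 : X₁ x = X x := hXX.self_of_nhds
  -- the flow of the augmented field also integrates `ψ`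
  obtain ⟨F, hFs, hF0, hFd⟩ := exists_smooth_flow (E := E × ℝ)
    (fun q => (X₁ q.1, ψ₁ q.1)) ((hX₁.comp contDiff_fst).prodMk (hψ₁.comp contDiff_fst)) (x, 0)
  let κ : E → ℝ × (E × ℝ) := fun y => (ℓ (y - x), (y - ℓ (y - x) • X x, 0))
  have hκ : ContDiff ℝ ∞ κ := by
    have h1 : ContDiff ℝ ∞ fun y : E => ℓ (y - x) := ℓ.contDiff.comp
      (contDiff_id.sub contDiff_const)
    exact h1.prodMk ((contDiff_id.sub (h1.smul contDiff_const)).prodMk contDiff_const)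
  have hκx : κ x = (0, (x, 0)) := by simp [κ]
  have hκt : Tendsto κ (𝓝 x) (𝓝 (0, (x, 0))) := by
    rw [← hκx]; exact hκ.continuous.tendsto x
  let G : E → E := fun y => (F (κ y)).1
  let I : E → ℝ := fun y => (F (κ y)).2
  have hFκ : SmoothNear (fun y => F (κ y)) x := by
    filter_upwards [hκt.eventually hFs] with y hy using hy.comp y hκ.contDiffAt
  have hG : SmoothNear G x := by
    filter_upwards [hFκ] with y hy using contDiff_fst.contDiffAt.comp y hy
  have hI : SmoothNear I x := by
    filter_upwards [hFκ] with y hy using contDiff_snd.contDiffAt.comp y hy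
  have hline : ∀ᶠ y in 𝓝 x, HasDerivAt (fun s : ℝ => F (κ (y + s • X x)))
      (X₁ (G y), ψ₁ (G y)) 0 := by
    filter_upwards [hκt.eventually hFd] with y hy
    have h1 : ∀ s : ℝ, κ (y + s • X x) = (ℓ (y - x) + s, (κ y).2) := by
      intro s
      have h2 : ℓ (y + s • X x - x) = ℓ (y - x) + s := by
        rw [add_sub_right_comm, map_add, map_smul, hℓ]; simp
      simp only [κ, h2, add_smul]
      congr 2
      abel
    simp only [h1]
    have h3 : HasDerivAt (fun s : ℝ => ℓ (y - x) + s) 1 0 := (hasDerivAt_id 0).const_add _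
    have h4 : HasDerivAt (fun σ => F (σ, (κ y).2)) (X₁ (F (κ y)).1, ψ₁ (F (κ y)).1)
      (ℓ (y - x) + 0) := by rw [add_zero]; exact hy
    exact (HasDerivAt.scomp (0 : ℝ) h4 h3).congr_deriv (one_smul _ _)
  have hlin : ∀ y : E, HasDerivAt (fun s : ℝ => y + s • X x) (X x) 0 := fun y => by
    simpa using ((hasDerivAt_id (0 : ℝ)).smul_const (X x)).const_add y
  have hGX : ∀ᶠ y in 𝓝 x, fderiv ℝ G y (X x) = X₁ (G y) := by
    filter_upwards [hG, hline] with y hy hd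
    have h1 : HasFDerivAt G (fderiv ℝ G y) (y + (0 : ℝ) • X x) := by
      rw [zero_smul, add_zero]; exact (hy.differentiableAt (by simp)).hasFDerivAt
    have h2 : HasDerivAt (fun s : ℝ => G (y + s • X x)) (X₁ (G y)) 0 :=
      hd.hasFDerivAt.fst.hasDerivAt.congr_deriv (by simp)
    have h3 := h1.comp_hasDerivAt (0 : ℝ) (hlin y)
    exact h3.unique h2
  have hIX : ∀ᶠ y in 𝓝 x, fderiv ℝ I y (X x) = ψ₁ (G y) := by
    filter_upwards [hI, hline] with y hy hd
    have h1 : HasFDerivAt I (fderiv ℝ I y) (y + (0 : ℝ) • X x) := by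
      rw [zero_smul, add_zero]; exact (hy.differentiableAt (by simp)).hasFDerivAt
    have h2 : HasDerivAt (fun s : ℝ => I (y + s • X x)) (ψ₁ (G y)) 0 :=
      hd.hasFDerivAt.snd.hasDerivAt.congr_deriv (by simp)
    have h3 := h1.comp_hasDerivAt (0 : ℝ) (hlin y)
    exact h3.unique h2
  have hGx : G x = x := by
    change (F (κ x)).1 = x
    rw [hκx, hF0.self_of_nhds]
  have hGker : ∀ᶠ y in 𝓝 x, ℓ (y - x) = 0 → G y = y := by
    have h1 : Tendsto (fun y : E => (κ y).2) (𝓝 x) (𝓝 (x, 0)) :=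
      (continuous_snd.tendsto _).comp hκt
    filter_upwards [h1.eventually hF0] with y hy hℓy
    have h2 : κ y = (0, (κ y).2) := Prod.ext hℓy rfl
    change (F (κ y)).1 = y
    rw [h2, hy]
    simp [κ, hℓy]
  have hGd : HasFDerivAt G ((ContinuousLinearEquiv.refl ℝ E : E ≃L[ℝ] E) : E →L[ℝ] E) x := by
    have h1 := (hG.self_of_nhds.differentiableAt (by simp)).hasFDerivAt
    refine h1.congr_fderiv ?_
    ext v
    have hv1 : fderiv ℝ G x (X x) = X x := by rw [hGX.self_of_nhds, hGx, hX0]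
    have hv2 : ∀ u : E, ℓ u = 0 → fderiv ℝ G x u = u := by
      intro u hu
      have h3 : HasDerivAt (fun s : ℝ => x + s • u) u 0 := by
        simpa using ((hasDerivAt_id (0 : ℝ)).smul_const u).const_add x
      have h2 : HasFDerivAt G (fderiv ℝ G x) (x + (0 : ℝ) • u) := by
        rw [zero_smul, add_zero]; exact h1
      refine (h2.comp_hasDerivAt (0 : ℝ) h3).unique (h3.congr_of_eventuallyEq ?_)
      have h4 : Tendsto (fun s : ℝ => x + s • u) (𝓝 0) (𝓝 x) := by
        have := h3.continuousAt.tendsto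
        simpa using this
      filter_upwards [h4.eventually hGker] with s hs
      exact hs (by simp [hu])
    have h5 : v = ℓ v • X x + (v - ℓ v • X x) := by abel
    have h6 : ℓ (v - ℓ v • X x) = 0 := by rw [map_sub, map_smul, hℓ]; simp
    conv_lhs => rw [h5, map_add, map_smul, hv1, hv2 _ h6]
    simp
  obtain ⟨g, hg0, hgs, hgr, -⟩ := hG.exists_local_inverse hGd
  rw [hGx] at hg0 hgs hgr
  have hgt : Tendsto g (𝓝 x) (𝓝 x) := by
    have := hgs.self_of_nhds.continuousAt
    rwa [ContinuousAt, hg0] at this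
  refine ⟨fun y => I (g y), ?_, ?_⟩
  · filter_upwards [hgs, hgt.eventually hI] with y hy hIy using hIy.comp y hy
  · have hinv : ∀ᶠ y in 𝓝 x, fderiv ℝ G y ∈ range ((↑) : (E ≃L[ℝ] E) → E →L[ℝ] E) := by
      have h2 : ContinuousAt (fderiv ℝ G) x :=
        (hG.self_of_nhds.fderiv_right (m := 0) (by simp)).continuousAt
      apply h2.eventually
      rw [hGd.fderiv]
      exact (ContinuousLinearEquiv.refl ℝ E).nhds
    filter_upwards [hgs, hgr.eventually_nhds, hgt.eventually (hI.and (hIX.and (hGX.and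
      (hG.and hinv)))),
      hXX, hψψ] with y hy hry hgy hXy hψy
    obtain ⟨hIy, hIXy, hGXy, hGy, L, hL⟩ := hgy
    have hGgy : G (g y) = y := hry.self_of_nhds
    have hgd := (hy.differentiableAt (by simp)).hasFDerivAt
    have hGd' := (hGy.differentiableAt (by simp)).hasFDerivAt
    have h1 : (fderiv ℝ G (g y)).comp (fderiv ℝ g y) = ContinuousLinearMap.id ℝ E :=
      (hGd'.comp y hgd).unique ((hasFDerivAt_id y).congr_of_eventuallyEq hry)
    have h2 : fderiv ℝ g y (X y) = X x := by
      have h3 : fderiv ℝ G (g y) (fderiv ℝ g y (X y)) = fderiv ℝ G (g y) (X x) := by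
        rw [hGXy, hGgy, hXy]
        exact congrArg (fun A : E →L[ℝ] E => A (X y)) h1
      rw [← hL] at h3
      exact L.injective h3
    have h4 := ((hIy.differentiableAt (by simp)).hasFDerivAt.comp y hgd).fderiv
    change fderiv ℝ (I ∘ g) y (X y) = ψ y
    rw [h4, ContinuousLinearMap.comp_apply, h2, hIXy, hGgy, hψy]

end Transport

/-! ### The determining equations of a conserved density -/

/-- The conservation law `d f + ∂_m ψ = 0` in Lagrangian mass coordinates, split by powers of the
second derivatives, over a commutative algebra `R` with commuting derivations `D i` dual to the
elements `X i`. The indices stand for the coordinates `0 = x`, `1 = S`, `2 = v = ∂_m x`, `3 = U`,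
`4 = s = ∂_m S`, `5 = y = ∂_m v`, `6 = w = ∂_m U`; the acceleration of a fluid particle is `κ y +
g s + h`, with `κ`, `g`, `h` functions of `(x, S, v)`, and `N` is the dimension minus one. The
fields `ey`, `ew`, `es` are the coefficients of `∂_m y`, `∂_m w`, `∂_m s`, and `er` is the
remainder. The acceleration comes from a pressure that depends on `x` and `v` through `x ^ N v`:
this is recorded by `gκ`, `κx` and `xh`. -/
structure DeterminingSystem {R : Type*} [CommRing R] [Algebra ℝ R] (D : Fin 7 → Derivation ℝ R R)
    (X : Fin 7 → R) (κ g h f ψ : R) (N : ℕ) : Prop where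
  comm : ∀ i j, j < i → ∀ a, D i (D j a) = D j (D i a)
  dX : ∀ i, D i (X i) = 1
  dX0 : ∀ i j, i ≠ j → D i (X j) = 0
  dκ : ∀ i, 2 < i → D i κ = 0
  dg : ∀ i, 2 < i → D i g = 0
  dh : ∀ i, 2 < i → D i h = 0
  gκ : D 2 g = D 1 κ
  κx : X 0 * D 0 κ = 2 * N * κ + N * X 2 * D 2 κ
  xh : X 0 * h = N * X 2 ^ 2 * κ
  fw : D 6 (D 6 (D 6 f)) = 0
  ey : D 5 ψ = - (κ * D 6 f)
  ew : D 6 ψ = - D 5 f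
  es : D 4 ψ = - (g * D 6 f)
  er : X 3 * D 0 f + (κ * X 5 + g * X 4 + h) * D 3 f + X 6 * D 2 f
    + D 6 f * (X 2 * (D 0 κ * X 5 + D 0 g * X 4 + D 0 h) + X 5 * (D 2 κ * X 5 + D 2 g * X 4 + D 2 h)
      + X 4 * (D 1 κ * X 5 + D 1 g * X 4 + D 1 h))
    + X 2 * D 0 ψ + X 6 * D 3 ψ + X 5 * D 2 ψ + X 4 * D 1 ψ = 0

namespace DeterminingSystem
variable {R : Type*} [CommRing R] [Algebra ℝ R] {D : Fin 7 → Derivation ℝ R R}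
    {X : Fin 7 → R} {κ g h f ψ : R} {N : ℕ}

/-- Compatibility of `ey` and `ew`: the mixed derivative `D 5 (D 6 ψ)` computed twice. -/
theorem fyy (H : DeterminingSystem D X κ g h f ψ N) : D 5 (D 5 f) = κ * D 6 (D 6 f) := by
  have h2 := congrArg (D 6) H.ey
  rw [H.comm 6 5 (by decide), H.ew] at h2
  simp [H.dκ 6 (by decide)] at h2
  exact h2

theorem fyyw (H : DeterminingSystem D X κ g h f ψ N) : D 5 (D 5 (D 6 f)) = 0 := by
  have h1 := congrArg (D 6) H.fyy
  simpa [H.comm 6 5 (by decide), H.dκ 6 (by decide), H.fw] using h1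

theorem fyyww (H : DeterminingSystem D X κ g h f ψ N) : D 5 (D 5 (D 6 (D 6 f))) = 0 := by
  have h1 := congrArg (D 6) H.fyyw
  simpa [H.comm 6 5 (by decide)] using h1

/-- Compatibility of `ey` and `es`. -/
theorem a_s (H : DeterminingSystem D X κ g h f ψ N) : κ * D 4 (D 6 f) = g * D 5 (D 6 f) := by
  have h1 := congrArg (D 4) H.ey
  have h2 := congrArg (D 5) H.es
  rw [H.comm 5 4 (by decide), h1] at h2
  simp (disch := decide) only [map_neg, Derivation.leibniz, smul_eq_mul, H.dκ, H.dg] at h2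
  linear_combination -h2

/-- Compatibility of `ew` and `es`. -/
theorem q_s (H : DeterminingSystem D X κ g h f ψ N) : D 4 (D 5 f) = g * D 6 (D 6 f) := by
  have h1 := congrArg (D 4) H.ew
  have h2 := congrArg (D 6) H.es
  rw [H.comm 6 4 (by decide), h1] at h2
  simp (disch := decide) only [map_neg, Derivation.leibniz, smul_eq_mul, H.dκ, H.dg] at h2
  linear_combination -h2

/-- Non-zero natural numbers are invertible in a real algebra. -/
theorem cancel {R : Type*} [CommRing R] [Algebra ℝ R] {a : R} (k : ℕ) (hk : k ≠ 0)
    (h : (k : R) * a = 0) : a = 0 := by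
  have h1 : a = (k : ℝ)⁻¹ • ((k : R) * a) := by
    rw [Algebra.smul_def, ← mul_assoc, ← map_natCast (algebraMap ℝ R), ← map_mul,
      inv_mul_cancel₀ (by exact_mod_cast hk), map_one, one_mul]
  rw [h1, h, smul_zero]

theorem D_ofNat (E : Derivation ℝ R R) (n : ℕ) [n.AtLeastTwo] : E (ofNat(n) : R) = 0 :=
  E.map_natCast n

/-- The equation `er` differentiated with respect to `w`. The lemmas `ww`, `wy`, `d5`, `yy`,
`www`, `wwy`, `wyy` below are its further derivatives with respect to the letters in their names,
reduced by the relations found before; a name `c_U`, `c_v`, `c_κ` refers to `c = D 5 (D 6 (D 6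
f))`, the only third derivative of `f` in `(y, w)` left by `fw` and `fyyw`, apart from the
multiple `f_yyy = κ c`. -/
theorem d6 (H : DeterminingSystem D X κ g h f ψ N) :
    X 3 * D 0 (D 6 f) + (κ * X 5 + g * X 4 + h) * D 3 (D 6 f)
    + X 6 * D 2 (D 6 f) + D 2 f
    + D 6 (D 6 f) * (X 2 * (D 0 κ * X 5 + D 0 g * X 4 + D 0 h)
      + X 5 * (D 2 κ * X 5 + D 1 κ * X 4 + D 2 h)
      + X 4 * (D 1 κ * X 5 + D 1 g * X 4 + D 1 h))
    - X 2 * D 0 (D 5 f) - X 6 * D 3 (D 5 f) - X 5 * D 2 (D 5 f) - X 4 * D 1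
      (D 5 f) + D 3 ψ = 0 := by
  have e1 := congrArg (D 6) H.er
  simp (disch := decide) only [map_add, map_neg, map_zero, Derivation.leibniz, smul_eq_mul,
    H.comm, H.dX, H.dX0, H.dκ, H.dg, H.dh, H.gκ, H.ew] at e1
  linear_combination e1

theorem ww (H : DeterminingSystem D X κ g h f ψ N) : X 3 * D 0 (D 6 (D 6 f))
    + (κ * X 5 + g * X 4 + h) * D 3 (D 6 (D 6 f))
    + X 6 * D 2 (D 6 (D 6 f)) + 2 * D 2 (D 6 f) - X 2 * D 0 (D 5 (D 6 f)) - X 6 * D 3 (D 5 (D 6 f))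
    - X 5 * D 2 (D 5 (D 6 f)) - X 4 * D 1 (D 5 (D 6 f)) - 2 * D 3 (D 5 f) = 0 := by
  have e1 := congrArg (D 6) H.d6
  simp (disch := decide) only [map_add, map_sub, map_neg, map_zero, Derivation.leibniz, smul_eq_mul,
    H.comm, H.dX, H.dX0, H.dκ, H.dg, H.dh, H.gκ, H.ew, H.fw] at e1
  linear_combination e1

theorem wy (H : DeterminingSystem D X κ g h f ψ N) : X 3 * D 0 (D 5 (D 6 f))
    + (κ * X 5 + g * X 4 + h) * D 3 (D 5 (D 6 f)) + X 6 * D 2 (D 5 (D 6 f))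
    + D 5 (D 6 (D 6 f)) * (X 2 * (D 0 κ * X 5 + D 0 g * X 4 + D 0 h)
      + X 5 * (D 2 κ * X 5 + D 1 κ * X 4 + D 2 h)
      + X 4 * (D 1 κ * X 5 + D 1 g * X 4 + D 1 h))
    + D 6 (D 6 f) * (X 2 * D 0 κ + 2 * X 5 * D 2 κ + 2 * X 4 * D 1 κ + D 2 h)
    - X 2 * D 0 (κ * D 6 (D 6 f)) - X 6 * κ * D 3 (D 6 (D 6 f)) - X 5 * D 2 (κ * D 6 (D 6 f))
    - X 4 * D 1 (κ * D 6 (D 6 f)) = 0 := by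
  have e1 := congrArg (D 5) H.d6
  simp (disch := decide) only [map_add, map_sub, map_neg, map_zero, Derivation.leibniz, smul_eq_mul,
    H.comm, H.dX, H.dX0, H.dκ, H.dg, H.dh, H.gκ, H.ey, H.fyy] at e1 ⊢
  linear_combination e1

/-- The equation `er` differentiated with respect to `y`. -/
theorem d5 (H : DeterminingSystem D X κ g h f ψ N) : X 3 * D 0 (D 5 f) + κ * D 3 f
    + (κ * X 5 + g * X 4 + h) * D 3 (D 5 f) + X 6 * D 2 (D 5 f)
    + D 5 (D 6 f) * (X 2 * (D 0 κ * X 5 + D 0 g * X 4 + D 0 h)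
      + X 5 * (D 2 κ * X 5 + D 1 κ * X 4 + D 2 h)
      + X 4 * (D 1 κ * X 5 + D 1 g * X 4 + D 1 h))
    + D 6 f * (X 2 * D 0 κ + 2 * X 5 * D 2 κ + 2 * X 4 * D 1 κ + D 2 h)
    - X 2 * D 0 (κ * D 6 f) - X 6 * κ * D 3 (D 6 f) - X 5 * D 2 (κ * D 6 f) + D 2 ψ
    - X 4 * D 1 (κ * D 6 f) = 0 := by
  have e1 := congrArg (D 5) H.er
  simp (disch := decide) only [map_add, map_sub, map_neg, map_zero, Derivation.leibniz, smul_eq_mul,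
    H.comm, H.dX, H.dX0, H.dκ, H.dg, H.dh, H.gκ, H.ey, H.fyy] at e1 ⊢
  linear_combination e1

theorem yy (H : DeterminingSystem D X κ g h f ψ N) :
    X 3 * D 0 (κ * D 6 (D 6 f)) + 2 * κ * D 3 (D 5 f)
    + (κ * X 5 + g * X 4 + h) * κ * D 3 (D 6 (D 6 f)) + X 6 * D 2 (κ * D 6 (D 6 f))
    + 2 * D 5 (D 6 f) * (X 2 * D 0 κ + 2 * X 5 * D 2 κ + 2 * X 4 * D 1 κ + D 2 h)
    + 2 * D 6 f * D 2 κ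
    - X 2 * D 0 (κ * D 5 (D 6 f)) - X 6 * κ * D 3 (D 5 (D 6 f)) - X 5 * D 2 (κ * D 5 (D 6 f))
    - 2 * D 2 (κ * D 6 f) - X 4 * D 1 (κ * D 5 (D 6 f)) = 0 := by
  have e1 := congrArg (D 5) H.d5
  simp (disch := decide) only [map_add, map_sub, map_neg, map_zero, Derivation.leibniz, smul_eq_mul,
    H.comm, H.dX, H.dX0, H.dκ, H.dg, H.dh, H.gκ, H.ey, H.fyy, H.fyyw,
      Derivation.map_one_eq_zero] at e1 ⊢
  have h2 : D 5 2 = 0 := by simpa using (D 5).map_natCast 2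
  simp only [h2] at e1
  linear_combination e1

theorem www (H : DeterminingSystem D X κ g h f ψ N) :
    3 * D 2 (D 6 (D 6 f)) - X 2 * D 0 (D 5 (D 6 (D 6 f)))
    - 3 * D 3 (D 5 (D 6 f)) - X 6 * D 3 (D 5 (D 6 (D 6 f))) - X 5 * D 2 (D 5 (D 6 (D 6 f)))
    - X 4 * D 1 (D 5 (D 6 (D 6 f))) = 0 := by
  have e1 := congrArg (D 6) H.ww
  simp (disch := decide) only [map_add, map_sub, map_neg, map_zero, Derivation.leibniz, smul_eq_mul,
    H.comm, H.dX, H.dX0, H.dκ, H.dg, H.dh, H.gκ, H.fw, D_ofNat] at e1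
  linear_combination e1

theorem c_U (H : DeterminingSystem D X κ g h f ψ N) : D 3 (D 5 (D 6 (D 6 f))) = 0 := by
  have e1 := congrArg (D 6) H.www
  simp (disch := decide) only [map_add, map_sub, map_neg, map_zero, Derivation.leibniz, smul_eq_mul,
    H.comm, H.dX, H.dX0, H.fw, D_ofNat] at e1
  exact cancel 4 (by decide) (by push_cast; linear_combination -e1)

theorem c_v (H : DeterminingSystem D X κ g h f ψ N) : D 2 (D 5 (D 6 (D 6 f))) = 0 := by
  have e1 := congrArg (D 5) H.www
  simp (disch := decide) only [map_add, map_sub, map_neg, map_zero, Derivation.leibniz, smul_eq_mul,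
    H.comm, H.dX, H.dX0, H.fw, D_ofNat, H.fyyw, H.fyyww] at e1
  exact cancel 2 (by decide) (by push_cast; linear_combination e1)

theorem wwy (H : DeterminingSystem D X κ g h f ψ N) :
    X 3 * D 0 (D 5 (D 6 (D 6 f))) - κ * D 3 (D 6 (D 6 f)) + D 2 (D 5 (D 6 f)) = 0 := by
  have e1 := congrArg (D 5) H.ww
  simp (disch := decide) only [map_add, map_sub, map_neg, map_zero, Derivation.leibniz, smul_eq_mul,
    H.comm, H.dX, H.dX0, H.fw, H.dκ, H.dg, H.dh, D_ofNat, H.fyyw, H.fyyww, H.fyy, H.c_U,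
      H.c_v] at e1
  linear_combination e1

theorem wyy (H : DeterminingSystem D X κ g h f ψ N) : κ * D 3 (D 5 (D 6 f))
    + 2 * D 5 (D 6 (D 6 f)) * (X 2 * D 0 κ + 2 * X 5 * D 2 κ + 2 * X 4 * D 1 κ + D 2 h)
    + 2 * D 6 (D 6 f) * D 2 κ
    - X 2 * D 0 (κ * D 5 (D 6 (D 6 f))) - D 2 (κ * D 6 (D 6 f))
    - X 5 * D 2 κ * D 5 (D 6 (D 6 f)) - X 4 * D 1 (κ * D 5 (D 6 (D 6 f))) = 0 := by
  have e1 := congrArg (D 5) H.wy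
  simp (disch := decide) only [map_add, map_sub, map_neg, map_zero, Derivation.leibniz, smul_eq_mul,
    H.comm, H.dX, H.dX0, H.fw, H.dκ, H.dg, H.dh, D_ofNat, H.fyyw, H.fyyww, H.fyy, H.c_U,
      H.c_v] at e1 ⊢
  linear_combination e1

theorem c_κ (H : DeterminingSystem D X κ g h f ψ N) : D 5 (D 6 (D 6 f)) * D 2 κ = 0 := by
  have e1 := congrArg (D 5) H.wyy
  simp (disch := decide) only [map_add, map_sub, map_neg, map_zero, Derivation.leibniz, smul_eq_mul,
    H.comm, H.dX, H.dX0, H.fw, H.dκ, H.dg, H.dh, D_ofNat, H.fyyw, H.fyyww, H.fyy, H.c_U,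
      H.c_v] at e1
  exact cancel 4 (by decide) (by push_cast; linear_combination e1)

theorem yyy (H : DeterminingSystem D X κ g h f ψ N) : X 3 * (4 * κ * D 0 (D 5 (D 6 (D 6 f)))
      + D 0 κ * D 5 (D 6 (D 6 f))) + 3 * D 5 (D 6 f) * D 2 κ = 0 := by
  have e1 := congrArg (D 5) H.yy
  simp (disch := decide) only [map_add, map_sub, map_neg, map_zero, Derivation.leibniz, smul_eq_mul,
    H.comm, H.dX, H.dX0, H.fw, H.dκ, H.dg, H.dh, D_ofNat, H.fyyw, H.fyyww, H.fyy, H.c_U,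
      H.c_v] at e1
  linear_combination e1 + 3 * κ * H.wwy - X 6 * H.c_κ

/-- The combination of `wyy` and `www` from which the derivatives of `D 6 (D 6 f)` and `D 5 (D 6
f)` with respect to `v` and `U` cancel. -/
theorem c_rel (H : DeterminingSystem D X κ g h f ψ N) :
    6 * D 5 (D 6 (D 6 f)) * (X 2 * D 0 κ + 2 * X 4 * D 1 κ + D 2 h) + 3 * D 6 (D 6 f) * D 2 κ
    - 4 * κ * (X 2 * D 0 (D 5 (D 6 (D 6 f))) + X 4 * D 1 (D 5 (D 6 (D 6 f))))
    - 3 * D 5 (D 6 (D 6 f)) * (X 2 * D 0 κ + X 4 * D 1 κ) = 0 := by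
  have e1 := H.wyy
  have e2 := H.www
  simp (disch := decide) only [Derivation.leibniz, smul_eq_mul, H.c_U, H.c_v] at e1 e2
  linear_combination 3 * e1 + κ * e2 - 9 * X 5 * H.c_κ

/-- If `κ` depends on `v`, that is, on the density, the second derivatives of `f` in `(y, w)`
vanish. -/
theorem quadratic_eq_zero_of_isUnit (H : DeterminingSystem D X κ g h f ψ N) (hκ : IsUnit (D 2 κ)) :
    D 6 (D 6 f) = 0 ∧ D 5 (D 6 f) = 0 := by
  have hc : D 5 (D 6 (D 6 f)) = 0 := (hκ.mul_left_eq_zero).1 H.c_κ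
  have h1 := H.yyy
  have h2 := H.c_rel
  simp only [hc, map_zero] at h1 h2
  refine ⟨(hκ.mul_left_eq_zero).1 (cancel 3 (by decide) ?_),
    (hκ.mul_left_eq_zero).1 (cancel 3 (by decide) ?_)⟩
  · push_cast; linear_combination h2
  · push_cast; linear_combination h1

/-- If `κ` does not depend on `v`, then `κ` is homogeneous of degree `2 N` in `x`, and comparing
the derivatives of `yyy` and `c_rel` leaves a multiple of `N κ c`. -/
theorem cubic_eq_zero (H : DeterminingSystem D X κ g h f ψ N) (hN : N ≠ 0) (hκu : IsUnit κ)
    (hx : IsUnit (X 0))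
    (hκ : D 2 κ = 0) : D 5 (D 6 (D 6 f)) = 0 := by
  have hκx : X 0 * D 0 κ = 2 * N * κ := by rw [H.κx, hκ]; ring
  have hh : D 2 h = D 0 κ * X 2 := by
    refine hx.mul_left_cancel ?_
    have e1 := congrArg (D 2) H.xh
    simp (disch := decide) only [map_add, map_sub, map_neg, map_zero, Derivation.leibniz,
      Derivation.leibniz_pow, smul_eq_mul, H.comm, H.dX, H.dX0, hκ, Derivation.map_natCast,
        nsmul_eq_mul] at e1
    push_cast at e1
    linear_combination e1 - X 2 * hκx
  have h1 := congrArg (D 3) H.yyy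
  have h2 := H.c_rel
  rw [hh] at h2
  replace h2 := congrArg (D 2) h2
  simp (disch := decide) only [map_add, map_sub, map_neg, map_zero, Derivation.leibniz,
      smul_eq_mul, H.comm, H.dX, H.dX0, H.dκ, hκ, H.c_U, H.c_v, D_ofNat] at h1 h2
  refine hκu.mul_right_eq_zero.1 (cancel (20 * N) (by positivity) ?_)
  push_cast
  linear_combination X 0 * h2 + X 0 * h1 - 10 * D 5 (D 6 (D 6 f)) * hκx

end DeterminingSystem

/-- The overdetermined wave-type equations of the coefficients `a = f_ww` and `b = f_wy` when `κ`
does not depend on `v`: `b_U = a_v`, `b_v = κ a_U`, and the two equations `e₁`, `e₂` left of the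
conservation law. -/
structure WaveSystem {R : Type*} [CommRing R] [Algebra ℝ R] (D : Fin 7 → Derivation ℝ R R)
    (X : Fin 7 → R) (κ a b : R) (N : ℕ) : Prop where
  comm : ∀ i j, j < i → ∀ a, D i (D j a) = D j (D i a)
  dX : ∀ i, D i (X i) = 1
  dX0 : ∀ i j, i ≠ j → D i (X j) = 0
  dκ : ∀ i, 1 < i → D i κ = 0
  κx : X 0 * D 0 κ = 2 * N * κ
  bU : D 3 b = D 2 a
  bv : D 2 b = κ * D 3 a
  e₁ : X 0 * X 3 * D 0 b - X 0 * X 2 * κ * D 0 a + N * κ * (X 2 ^ 2 * D 2 a + 2 * X 2 * a) = 0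
  e₂ : X 0 * (X 3 * D 0 a - X 2 * D 0 b) + N * (X 3 * a + X 2 ^ 2 * D 2 b + 3 * X 2 * b) = 0

namespace WaveSystem
open DeterminingSystem (cancel D_ofNat)
variable {R : Type*} [CommRing R] [Algebra ℝ R] {D : Fin 7 → Derivation ℝ R R}
    {X : Fin 7 → R} {κ a b : R} {N : ℕ}

/-- Eliminating `b` gives the wave equation for `a`. -/
theorem avv (H : WaveSystem D X κ a b N) : D 2 (D 2 a) = κ * D 3 (D 3 a) := by
  have h1 := congrArg (D 2) H.bU
  have h2 := congrArg (D 3) H.bv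
  rw [H.comm 3 2 (by decide), h1] at h2
  simpa (disch := decide) [H.dκ] using h2

theorem avvU (H : WaveSystem D X κ a b N) : D 2 (D 2 (D 3 a)) = κ * D 3 (D 3 (D 3 a)) := by
  have h1 := congrArg (D 3) H.avv
  simpa (disch := decide) [H.dκ, H.comm 3 2] using h1

/-- The combination `(∂_v² + κ ∂_U²) e₂ - 2 ∂_v ∂_U e₁` is a multiple of `a_U`, and `(∂_v² + κ
∂_U²) e₁ - 2 κ ∂_v ∂_U e₂` one of `b_U`: by the wave equation all terms of higher order cancel. -/
theorem aU (H : WaveSystem D X κ a b N) (hN : N ≠ 0) (hκ : IsUnit κ) : D 3 a = 0 ∧ D 3 b = 0 := by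
  have p22 := congrArg (fun t => D 2 (D 2 t)) H.e₁
  have p23 := congrArg (fun t => D 2 (D 3 t)) H.e₁
  have p33 := congrArg (fun t => D 3 (D 3 t)) H.e₁
  have q22 := congrArg (fun t => D 2 (D 2 t)) H.e₂
  have q23 := congrArg (fun t => D 2 (D 3 t)) H.e₂
  have q33 := congrArg (fun t => D 3 (D 3 t)) H.e₂
  simp (disch := decide) only [map_add, map_sub, map_neg, map_zero, Derivation.leibniz,
      Derivation.leibniz_pow, smul_eq_mul, H.comm, H.dX, H.dX0, H.dκ, D_ofNat, H.bU, H.bv, H.avv,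
        H.avvU, Derivation.map_natCast, nsmul_eq_mul,
        Derivation.map_one_eq_zero] at p22 p23 p33 q22 q23 q33
  push_cast at *
  refine ⟨hκ.mul_right_eq_zero.1 (cancel (2 * N) (by positivity) ?_),
    hκ.mul_right_eq_zero.1 (cancel (2 * N) (by positivity) ?_)⟩
  · push_cast
    linear_combination -(q22 + κ * q33 - 2 * p23) -
      (4 * D 3 a + X 3 * D 3 (D 3 a) + X 2 * D 2 (D 3 a)) * H.κx
  · push_cast
    rw [H.bU]
    linear_combination -(p22 + κ * p33 - 2 * κ * q23) +
      (κ * X 2 * D 3 (D 3 a) + X 3 * D 2 (D 3 a)) * H.κx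

theorem eq_zero (H : WaveSystem D X κ a b N) (hN : N ≠ 0) (hκ : IsUnit κ) :
    a = 0 ∧ b = 0 := by
  obtain ⟨haU, hbU⟩ := H.aU hN hκ
  have hav : D 2 a = 0 := by rw [← H.bU, hbU]
  have hbv : D 2 b = 0 := by rw [H.bv, haU, mul_zero]
  have p2 := congrArg (D 2) H.e₁
  have q2 := congrArg (D 2) H.e₂
  have q3 := congrArg (D 3) H.e₂
  simp (disch := decide) only [map_add, map_sub, map_neg, map_zero, Derivation.leibniz,
      Derivation.leibniz_pow, smul_eq_mul, H.comm, H.dX, H.dX0, H.dκ, D_ofNat, haU, hbU, hav, hbv,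
      Derivation.map_natCast, nsmul_eq_mul] at p2 q2 q3
  have ha : a = 0 := by
    refine hκ.mul_right_eq_zero.1 (cancel (3 * N) (by positivity) ?_)
    push_cast
    linear_combination p2 + κ * q3
  refine ⟨ha, cancel (3 * N) (by positivity) ?_⟩
  have p3 := congrArg (D 3) H.e₁
  simp (disch := decide) only [map_add, map_sub, map_neg, map_zero, Derivation.leibniz,
      Derivation.leibniz_pow, smul_eq_mul, H.comm, H.dX, H.dX0, H.dκ, D_ofNat, haU, hbU, hav, hbv,
      Derivation.map_natCast, nsmul_eq_mul] at p3
  push_cast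
  linear_combination q2 + p3

end WaveSystem

namespace DeterminingSystem
variable {R : Type*} [CommRing R] [Algebra ℝ R] {D : Fin 7 → Derivation ℝ R R}
    {X : Fin 7 → R} {κ g h f ψ : R} {N : ℕ}

/-- If `κ` does not depend on `v`, the second derivatives of `f` in `(y, w)` vanish as well,
provided the geometry is not planar. -/
theorem quadratic_eq_zero_of_eq_zero (H : DeterminingSystem D X κ g h f ψ N) (hN : N ≠ 0)
    (hκu : IsUnit κ)
    (hx : IsUnit (X 0)) (hκ : D 2 κ = 0) : D 6 (D 6 f) = 0 ∧ D 5 (D 6 f) = 0 := by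
  have hc := H.cubic_eq_zero hN hκu hx hκ
  have hκx : X 0 * D 0 κ = 2 * N * κ := by rw [H.κx, hκ]; ring
  have hh : D 2 h = D 0 κ * X 2 := by
    refine hx.mul_left_cancel ?_
    have e1 := congrArg (D 2) H.xh
    simp (disch := decide) only [map_add, map_sub, map_neg, map_zero, Derivation.leibniz,
      Derivation.leibniz_pow, smul_eq_mul, H.comm, H.dX, H.dX0, hκ, Derivation.map_natCast,
        nsmul_eq_mul] at e1
    push_cast at e1
    linear_combination e1 - X 2 * hκx
  have hbU : D 3 (D 5 (D 6 f)) = D 2 (D 6 (D 6 f)) := by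
    have e1 := H.www
    simp only [hc, map_zero] at e1
    exact sub_eq_zero.1 (cancel 3 (by decide) (by push_cast; linear_combination -e1))
  have hbv : D 2 (D 5 (D 6 f)) = κ * D 3 (D 6 (D 6 f)) := by
    have e1 := H.wwy
    simp only [hc, map_zero] at e1
    linear_combination e1
  -- Neither coefficient depends on `s`, so the part of each remaining equation that is free of `s`
  -- vanishes by itself.
  have has : D 4 (D 6 (D 6 f)) = 0 := by
    have e1 := congrArg (D 6) H.a_s
    simp (disch := decide) only [Derivation.leibniz, smul_eq_mul, H.comm, H.dκ, H.dg, hc] at e1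
    exact hκu.mul_right_eq_zero.1 (by linear_combination e1)
  have hbs : D 4 (D 5 (D 6 f)) = 0 := by
    have e1 := congrArg (D 5) H.a_s
    simp (disch := decide) only [Derivation.leibniz, smul_eq_mul, H.comm, H.dκ, H.dg, H.fyyw] at e1
    exact hκu.mul_right_eq_zero.1 (by linear_combination e1)
  have e3 := H.wy
  simp (disch := decide) only [Derivation.leibniz, smul_eq_mul, hc, hκ, hh, hbU, hbv] at e3
  have e3s := congrArg (D 4) e3
  simp (disch := decide) only [map_add, map_sub, map_zero, Derivation.leibniz, smul_eq_mul, hc, hκ,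
    H.comm, H.dX, H.dX0,
    H.dκ, H.dg, H.dh, has, hbs, D_ofNat, Derivation.map_one_eq_zero] at e3s
  have e4 := H.yy
  have e4' := H.ww
  simp (disch := decide) only [Derivation.leibniz, smul_eq_mul, hc, hκ, hh, hbU, hbv] at e4 e4'
  replace e4 : κ * (X 3 * D 0 (D 6 (D 6 f)) + (κ * X 5 + g * X 4 + h) * D 3 (D 6 (D 6 f))
    + X 6 * D 2 (D 6 (D 6 f)) - X 2 * D 0 (D 5 (D 6 f)) - X 6 * D 2 (D 6 (D 6 f))
    - X 5 * (κ * D 3 (D 6 (D 6 f))) - X 4 * D 1 (D 5 (D 6 f)))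
    + (X 3 * (D 0 κ * D 6 (D 6 f) + κ * D 0 (D 6 (D 6 f)))
    + (κ * X 5 + g * X 4 + h) * κ * D 3 (D 6 (D 6 f)) + X 6 * (κ * D 2 (D 6 (D 6 f)))
    + 2 * D 5 (D 6 f) * (2 * X 2 * D 0 κ + 2 * X 4 * D 1 κ)
    - X 2 * (D 0 κ * D 5 (D 6 f) + κ * D 0 (D 5 (D 6 f)))
    - X 6 * κ * D 2 (D 6 (D 6 f)) - X 5 * (κ * (κ * D 3 (D 6 (D 6 f))))
    - X 4 * (D 1 κ * D 5 (D 6 f) + κ * D 1 (D 5 (D 6 f)))) = 0 := by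
    linear_combination e4 + κ * e4'
  have e4s := congrArg (D 4) e4
  simp (disch := decide) only [map_add, map_sub, map_zero, Derivation.leibniz, smul_eq_mul, hc, hκ,
    H.comm, H.dX, H.dX0,
    H.dκ, H.dg, H.dh, has, hbs, D_ofNat, Derivation.map_one_eq_zero] at e4s
  refine WaveSystem.eq_zero (N := N) (κ := κ) (X := X) (D := D) ⟨H.comm, H.dX, H.dX0, ?_, hκx, hbU,
    hbv, ?_, ?_⟩
    hN hκu
  · intro i hi
    rcases (show i = 2 ∨ 2 < i by revert i; decide) with rfl | h3
    · exact hκ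
    · exact H.dκ i h3
  · linear_combination X 0 * e3 - X 0 * X 4 * e3s - X 2 * D 6 (D 6 f) * hκx - D 2 (D 6
      (D 6 f)) * H.xh
  · refine hκu.mul_left_cancel ?_
    rw [mul_zero]
    refine cancel 2 (by decide) ?_
    push_cast
    rw [hbv]
    linear_combination X 0 * e4 - X 0 * X 4 * e4s - (X 3 * D 6 (D 6 f) + 3 * X 2 * D 5
      (D 6 f)) * hκx
      - 2 * κ * D 3 (D 6 (D 6 f)) * H.xh

/-- Once the second derivatives of `f` in `(y, w)` vanish, `D 6 f` and `D 5 f` are functions of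
`(x, S, v, U)` that form the `U` and `v` components of a gradient. -/
theorem linear_coeffs (H : DeterminingSystem D X κ g h f ψ N) (hκu : IsUnit κ) (ha : D 6
    (D 6 f) = 0)
    (hb : D 5 (D 6 f) = 0) : D 4 (D 6 f) = 0 ∧ D 4 (D 5 f) = 0 ∧ D 5 (D 5 f) = 0 ∧
      D 3 (D 5 f) = D 2 (D 6 f) := by
  refine ⟨hκu.mul_right_eq_zero.1 (by rw [H.a_s, hb, mul_zero]), by rw [H.q_s, ha, mul_zero],
    by rw [H.fyy, ha, mul_zero], ?_⟩
  have e1 := H.ww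
  simp only [ha, hb, map_zero] at e1
  exact sub_eq_zero.1 (cancel 2 (by decide) (by push_cast; linear_combination -e1))

/-- Subtracting the trivial density `∂_m T` from `f`, for a function `T` of `(x, S, v, U)`, adds the
material derivative of `T` to the flux. -/
theorem sub_trivial (H : DeterminingSystem D X κ g h f ψ N) {T : R}
    (hT : ∀ i, 3 < i → D i T = 0) :
    DeterminingSystem D X κ g h (f - (X 2 * D 0 T + X 4 * D 1 T + X 5 * D 2 T + X 6 * D 3 T))
      (ψ + (X 3 * D 0 T + X 6 * D 2 T + (κ * X 5 + g * X 4 + h) * D 3 T)) N := by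
  refine ⟨H.comm, H.dX, H.dX0, H.dκ, H.dg, H.dh, H.gκ, H.κx, H.xh, ?_, ?_, ?_, ?_, ?_⟩
  · simp (disch := decide) only [map_add, map_sub, map_zero, Derivation.leibniz, smul_eq_mul,
      H.comm, H.dX, H.dX0, H.fw, hT, Derivation.map_one_eq_zero]
    ring
  · simp (disch := decide) only [map_add, map_sub, map_zero, Derivation.leibniz, smul_eq_mul,
      H.comm, H.dX, H.dX0, H.ey, hT, H.dκ, H.dg, H.dh]
    ring
  · simp (disch := decide) only [map_add, map_sub, map_zero, Derivation.leibniz, smul_eq_mul,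
      H.comm, H.dX, H.dX0, H.ew, hT, H.dκ, H.dg, H.dh]
    ring
  · simp (disch := decide) only [map_add, map_sub, map_zero, Derivation.leibniz, smul_eq_mul,
      H.comm, H.dX, H.dX0, H.es, hT, H.dκ, H.dg, H.dh]
    ring
  · have e1 := H.er
    simp (disch := decide) only [map_add, map_sub, map_zero, Derivation.leibniz, smul_eq_mul,
      H.comm, H.dX, H.dX0, hT, H.dκ, H.dg, H.dh]
    linear_combination e1

/-- A density that does not depend on `y` and `w` has `D 4 f` a function of `(x, S, s)` alone, and
`D 4 (D 4 f)` a function of `(S, s)` alone. -/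
theorem separation (H : DeterminingSystem D X κ g h f ψ N) (hκu : IsUnit κ) (hp : D 6 f = 0)
    (hq : D 5 f = 0) :
    D 2 (D 4 f) = 0 ∧ D 3 (D 4 f) = 0 ∧ D 0 (D 4 (D 4 f)) = 0 := by
  have h1 : D 2 f + D 3 ψ = 0 := by
    have e1 := H.d6
    simp only [hp, hq, map_zero] at e1
    linear_combination e1
  have h2 : κ * D 3 f + D 2 ψ = 0 := by
    have e1 := H.d5
    simp only [hp, hq, map_zero, mul_zero] at e1
    linear_combination e1
  have hs : D 4 ψ = 0 := by rw [H.es, hp, mul_zero, neg_zero]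
  have h3 : D 2 (D 4 f) = 0 := by
    have e1 := congrArg (D 4) h1
    simp (disch := decide) only [map_add, map_zero, H.comm, hs] at e1
    linear_combination e1
  have h4 : D 3 (D 4 f) = 0 := by
    have e1 := congrArg (D 4) h2
    simp (disch := decide) only [map_add, map_zero, H.comm, hs, Derivation.leibniz, smul_eq_mul,
      H.dκ] at e1
    exact hκu.mul_right_eq_zero.1 (by linear_combination e1)
  refine ⟨h3, h4, ?_⟩
  have e1 := congrArg (fun t => D 3 (D 4 (D 4 t))) H.er
  have h5 : D 3 (D 4 (D 4 f)) = 0 := by rw [← H.comm 4 3 (by decide), h4, map_zero]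
  simp (disch := decide) only [map_add, map_zero, H.comm, hs, hp, hq, h3, h4, h5,
    Derivation.leibniz,
    smul_eq_mul, H.dκ, H.dX, H.dX0, H.dg, H.dh, Derivation.map_one_eq_zero] at e1
  linear_combination e1

end DeterminingSystem

/-! ### Partial derivatives and antiderivatives in coordinates -/

section PartialDerivatives

variable {ι : Type} [Fintype ι] [DecidableEq ι]

/-- The partial derivative with respect to the `i`-th coordinate. -/
noncomputable def pderivAt (i : ι) (F : (ι → ℝ) → ℝ) (ξ : ι → ℝ) : ℝ :=
  fderiv ℝ F ξ (Pi.single i 1)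

theorem fderiv_apply_eq_sum (F : (ι → ℝ) → ℝ) (ξ v : ι → ℝ) :
    fderiv ℝ F ξ v = ∑ i, v i * pderivAt i F ξ := by
  conv_lhs => rw [pi_eq_sum_univ' v]
  simp only [map_sum, map_smul, smul_eq_mul, pderivAt]

theorem Filter.EventuallyEq.pderivAt_eq {F G : (ι → ℝ) → ℝ} {ξ : ι → ℝ} (h : F =ᶠ[𝓝 ξ] G) (i : ι) :
    pderivAt i F ξ = pderivAt i G ξ := by
  rw [pderivAt, pderivAt, h.fderiv_eq]

theorem ContDiffAt.pderivAt {F : (ι → ℝ) → ℝ} {ξ : ι → ℝ} (h : ContDiffAt ℝ ∞ F ξ) (i : ι) :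
    ContDiffAt ℝ ∞ (pderivAt i F) ξ :=
  (h.fderiv_right (m := ∞) (by simp)).clm_apply contDiffAt_const

theorem SmoothNear.pderivAt {F : (ι → ℝ) → ℝ} {ξ : ι → ℝ} (h : SmoothNear F ξ) (i : ι) :
    SmoothNear (pderivAt i F) ξ := by
  filter_upwards [h] with y hy using hy.pderivAt i

theorem pderivAt_comm {F : (ι → ℝ) → ℝ} {ξ : ι → ℝ} (h : ContDiffAt ℝ ∞ F ξ) (i j : ι) :
    pderivAt i (pderivAt j F) ξ = pderivAt j (pderivAt i F) ξ := by
  have hd : DifferentiableAt ℝ (fderiv ℝ F) ξ :=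
    (h.fderiv_right (m := ∞) (by simp)).differentiableAt (by simp)
  have h1 : ∀ a b : ι, pderivAt a (pderivAt b F) ξ =
      fderiv ℝ (fderiv ℝ F) ξ (Pi.single a 1) (Pi.single b 1) := by
    intro a b
    have h2 : HasFDerivAt (pderivAt b F) _ ξ :=
      hd.hasFDerivAt.clm_apply (hasFDerivAt_const (𝕜 := ℝ) (Pi.single b (1 : ℝ) : ι → ℝ) ξ)
    rw [pderivAt, h2.fderiv]
    simp
  rw [h1, h1]
  exact (h.isSymmSndFDerivAt (by
    rw [minSmoothness_of_isRCLikeNormedField]; exact WithTop.coe_le_coe.2 le_top)) _ _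

theorem pderivAt_mul {F G : (ι → ℝ) → ℝ} {ξ : ι → ℝ} (hF : DifferentiableAt ℝ F ξ)
    (hG : DifferentiableAt ℝ G ξ) (i : ι) :
    pderivAt i (fun ξ => F ξ * G ξ) ξ = F ξ * pderivAt i G ξ + G ξ * pderivAt i F ξ := by
  have h := (hF.hasFDerivAt.mul hG.hasFDerivAt).fderiv
  rw [pderivAt]
  erw [h]
  simp [pderivAt]

theorem pderivAt_add {F G : (ι → ℝ) → ℝ} {ξ : ι → ℝ} (hF : DifferentiableAt ℝ F ξ)
    (hG : DifferentiableAt ℝ G ξ) (i : ι) :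
    pderivAt i (fun ξ => F ξ + G ξ) ξ = pderivAt i F ξ + pderivAt i G ξ := by
  have h := (hF.hasFDerivAt.add hG.hasFDerivAt).fderiv
  rw [pderivAt]
  erw [h]
  simp [pderivAt]

theorem pderivAt_sub {F G : (ι → ℝ) → ℝ} {ξ : ι → ℝ} (hF : DifferentiableAt ℝ F ξ)
    (hG : DifferentiableAt ℝ G ξ) (i : ι) :
    pderivAt i (fun ξ => F ξ - G ξ) ξ = pderivAt i F ξ - pderivAt i G ξ := by
  have h := (hF.hasFDerivAt.sub hG.hasFDerivAt).fderiv
  rw [pderivAt]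
  erw [h]
  simp [pderivAt]

theorem pderivAt_coord (i j : ι) (ξ : ι → ℝ) :
    pderivAt i (fun ξ => ξ j) ξ = if i = j then 1 else 0 := by
  have h : HasFDerivAt (fun ξ : ι → ℝ => ξ j) (ContinuousLinearMap.proj (R := ℝ) j) ξ :=
    hasFDerivAt_apply j ξ
  rw [pderivAt, h.fderiv]
  simp [Pi.single_apply, eq_comm]

/-- Replace the coordinates in `I` by those of `ξ₀`. -/
def freezeCoords (I : Finset ι) (ξ₀ ξ : ι → ℝ) : ι → ℝ := fun i => if i ∈ I then ξ₀ i else ξ i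

theorem hasFDerivAt_freezeCoords (I : Finset ι) (ξ₀ ξ : ι → ℝ) :
    HasFDerivAt (freezeCoords I ξ₀) (ContinuousLinearMap.pi fun i =>
      if i ∈ I then 0 else ContinuousLinearMap.proj (R := ℝ) (φ := fun _ : ι => ℝ) i) ξ := by
  rw [hasFDerivAt_pi]
  intro i
  by_cases hi : i ∈ I
  · simpa [freezeCoords, hi] using hasFDerivAt_const (ξ₀ i) ξ
  · simpa [freezeCoords, hi] using hasFDerivAt_apply (𝕜 := ℝ) i ξ

theorem contDiff_freezeCoords (I : Finset ι) (ξ₀ : ι → ℝ) :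
    ContDiff ℝ ∞ (freezeCoords I ξ₀) := by
  rw [contDiff_pi]
  intro i
  by_cases hi : i ∈ I
  · simpa [freezeCoords, hi] using contDiff_const
  · simpa [freezeCoords, hi] using contDiff_apply ℝ ℝ i

theorem freezeCoords_self (I : Finset ι) (ξ₀ : ι → ℝ) : freezeCoords I ξ₀ ξ₀ = ξ₀ := by
  ext i; simp [freezeCoords]

theorem tendsto_freezeCoords (I : Finset ι) (ξ₀ : ι → ℝ) :
    Tendsto (freezeCoords I ξ₀) (𝓝 ξ₀) (𝓝 ξ₀) := by
  have := (contDiff_freezeCoords I ξ₀).continuous.tendsto ξ₀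
  rwa [freezeCoords_self] at this

theorem pderivAt_comp_freezeCoords {F : (ι → ℝ) → ℝ} {I : Finset ι} {ξ₀ ξ : ι → ℝ}
    (hF : DifferentiableAt ℝ F (freezeCoords I ξ₀ ξ)) (i : ι) :
    pderivAt i (fun ξ => F (freezeCoords I ξ₀ ξ)) ξ =
      if i ∈ I then 0 else pderivAt i F (freezeCoords I ξ₀ ξ) := by
  have h := (hF.hasFDerivAt.comp ξ (hasFDerivAt_freezeCoords I ξ₀ ξ)).fderiv
  rw [pderivAt]
  erw [h]
  rw [ContinuousLinearMap.comp_apply]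
  split_ifs with hi
  · convert map_zero (fderiv ℝ F (freezeCoords I ξ₀ ξ))
    ext j
    by_cases hj : j ∈ I
    · simp [hj]
    · have : j ≠ i := fun h => hj (h ▸ hi)
      simp [hj, this]
  · rw [pderivAt]
    congr 1
    ext j
    by_cases hj : j ∈ I
    · have : j ≠ i := fun h => hi (h ▸ hj)
      simp [hj, this]
    · simp [hj]

/-- A function whose partial derivatives with respect to the coordinates in `I` vanish does not
change when these coordinates are frozen. -/
theorem eventually_comp_freezeCoords_eq {F : (ι → ℝ) → ℝ} {ξ₀ : ι → ℝ} (hF : SmoothNear F ξ₀)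
    {I : Finset ι} (h : ∀ᶠ ξ in 𝓝 ξ₀, ∀ i ∈ I, pderivAt i F ξ = 0) :
    ∀ᶠ ξ in 𝓝 ξ₀, F (freezeCoords I ξ₀ ξ) = F ξ := by
  obtain ⟨r, hr, hball⟩ := Metric.eventually_nhds_iff_ball.1 (hF.and h)
  filter_upwards [Metric.ball_mem_nhds ξ₀ hr,
    (tendsto_freezeCoords I ξ₀).eventually (Metric.ball_mem_nhds ξ₀ hr)] with ξ h1 h2
  set η := freezeCoords I ξ₀ ξ with hη
  have hseg : ∀ s ∈ Icc (0 : ℝ) 1, η + s • (ξ - η) ∈ Metric.ball ξ₀ r := fun s hs =>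
    (convex_ball ξ₀ r).add_smul_sub_mem h2 h1 hs
  have hd : ∀ s ∈ Icc (0 : ℝ) 1, HasDerivAt (fun s : ℝ => F (η + s • (ξ - η))) 0 s := by
    intro s hs
    obtain ⟨hs1, hs2⟩ := hball _ (hseg s hs)
    have h3 : HasDerivAt (fun s : ℝ => η + s • (ξ - η)) (ξ - η) s := by
      simpa using ((hasDerivAt_id s).smul_const (ξ - η)).const_add η
    refine ((hs1.differentiableAt (by simp)).hasFDerivAt.comp_hasDerivAt s h3).congr_deriv ?_
    rw [fderiv_apply_eq_sum]
    refine Finset.sum_eq_zero fun i _ => ?_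
    by_cases hi : i ∈ I
    · rw [hs2 i hi, mul_zero]
    · simp [hη, freezeCoords, hi]
  have h4 := constant_of_has_deriv_right_zero (f := fun s : ℝ => F (η + s • (ξ - η))) (a := 0)
    (b := 1) (fun s hs => (hd s hs).continuousAt.continuousWithinAt)
    (fun s hs => (hd s (Ico_subset_Icc_self hs)).hasDerivWithinAt) 1 (by simp)
  simpa using h4.symm

/-- A local antiderivative with respect to the `j`-th coordinate which depends on no coordinate
on which the given function does not depend. -/
theorem exists_antiderivative {q : (ι → ℝ) → ℝ} {ξ₀ : ι → ℝ} (hq : SmoothNear q ξ₀) (j : ι)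
    {I : Finset ι} (hj : j ∉ I) (h : ∀ᶠ ξ in 𝓝 ξ₀, ∀ i ∈ I, pderivAt i q ξ = 0) :
    ∃ H : (ι → ℝ) → ℝ, SmoothNear H ξ₀ ∧ (∀ᶠ ξ in 𝓝 ξ₀, pderivAt j H ξ = q ξ) ∧
      ∀ᶠ ξ in 𝓝 ξ₀, ∀ i ∈ I, pderivAt i H ξ = 0 := by
  obtain ⟨θ, hθ, hθq⟩ := exists_transport (X := fun _ => Pi.single j (1 : ℝ)) (x := ξ₀)
    (Eventually.of_forall fun _ => contDiffAt_const) hq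
    (by intro h0; simpa using congrFun h0 j)
  have ht := tendsto_freezeCoords I ξ₀
  refine ⟨fun ξ => θ (freezeCoords I ξ₀ ξ), ?_, ?_, ?_⟩
  · filter_upwards [ht.eventually hθ] with ξ hξ
    exact hξ.comp ξ (contDiff_freezeCoords I ξ₀).contDiffAt
  · filter_upwards [ht.eventually hθ, ht.eventually hθq, eventually_comp_freezeCoords_eq hq h]
      with ξ h1 h2 h3
    rw [pderivAt_comp_freezeCoords (h1.differentiableAt (by simp)), if_neg hj, ← h3, ← h2]
    rfl
  · filter_upwards [ht.eventually hθ] with ξ h1 i hi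
    rw [pderivAt_comp_freezeCoords (h1.differentiableAt (by simp)), if_pos hi]

end PartialDerivatives

/-! ### The algebra of smooth functions on an open set -/

section SmoothFunctions

variable {ι : Type} [Fintype ι] [DecidableEq ι]

/-- The algebra of smooth functions on an open subset of a coordinate space. -/
def smoothFunctions (W : TopologicalSpace.Opens (ι → ℝ)) : Subalgebra ℝ (W → ℝ) where
  carrier := {F | ∃ G : (ι → ℝ) → ℝ, (∀ ξ ∈ W, ContDiffAt ℝ ∞ G ξ) ∧ ∀ ξ : W, F ξ = G ξ}
  mul_mem' := by
    rintro F F' ⟨G, hG, h⟩ ⟨G', hG', h'⟩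
    exact ⟨fun ξ => G ξ * G' ξ, fun ξ hξ => (hG ξ hξ).mul (hG' ξ hξ), fun ξ => by simp [h, h']⟩
  add_mem' := by
    rintro F F' ⟨G, hG, h⟩ ⟨G', hG', h'⟩
    exact ⟨fun ξ => G ξ + G' ξ, fun ξ hξ => (hG ξ hξ).add (hG' ξ hξ), fun ξ => by simp [h, h']⟩
  algebraMap_mem' r := ⟨fun _ => r, fun _ _ => contDiffAt_const, fun _ => rfl⟩

namespace smoothFunctions

variable {W : TopologicalSpace.Opens (ι → ℝ)}

/-- The restriction to `W` of a function which is smooth on `W`. -/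
def restrict (G : (ι → ℝ) → ℝ) (hG : ∀ ξ ∈ W, ContDiffAt ℝ ∞ G ξ) : smoothFunctions W :=
  ⟨fun ξ => G ξ, G, hG, fun _ => rfl⟩

/-- A smooth extension of `F` to all points; its values outside `W` are irrelevant. -/
noncomputable def extend (F : smoothFunctions W) : (ι → ℝ) → ℝ := F.2.choose

theorem contDiffAt_extend (F : smoothFunctions W) {ξ : ι → ℝ} (hξ : ξ ∈ W) :
    ContDiffAt ℝ ∞ (extend F) ξ := F.2.choose_spec.1 ξ hξ

theorem extend_apply (F : smoothFunctions W) (ξ : W) : extend F ξ = F.1 ξ :=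
  (F.2.choose_spec.2 ξ).symm

theorem differentiableAt_extend (F : smoothFunctions W) (ξ : W) :
    DifferentiableAt ℝ (extend F) ξ := (contDiffAt_extend F ξ.2).differentiableAt (by simp)

theorem eventuallyEq_of_forall {G G' : (ι → ℝ) → ℝ} (h : ∀ ξ : W, G ξ = G' ξ) (ξ : W) :
    G =ᶠ[𝓝 (ξ : ι → ℝ)] G' := by
  filter_upwards [W.isOpen.mem_nhds ξ.2] with η hη using h ⟨η, hη⟩

/-- Partial differentiation as a derivation of the algebra of smooth functions. -/
noncomputable def partialDeriv (W : TopologicalSpace.Opens (ι → ℝ)) (i : ι) :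
    Derivation ℝ (smoothFunctions W) (smoothFunctions W) :=
  Derivation.mk'
    { toFun := fun F => restrict (pderivAt i (extend F)) fun _ hξ =>
      (contDiffAt_extend F hξ).pderivAt i
      map_add' := fun F F' => by
        ext ξ
        have h := (eventuallyEq_of_forall (G := extend (F + F'))
          (G' := fun ξ => extend F ξ + extend F' ξ)
          (fun ξ => by simp only [extend_apply]; rfl) ξ).pderivAt_eq i
        exact h.trans (pderivAt_add (differentiableAt_extend F ξ) (differentiableAt_extend F' ξ) i)
      map_smul' := fun c F => by
        ext ξ
        have h := (eventuallyEq_of_forall (G := extend (c • F))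
          (G' := fun ξ => c * extend F ξ)
          (fun ξ => by simp only [extend_apply]; rfl) ξ).pderivAt_eq i
        refine h.trans ((pderivAt_mul (differentiableAt_const c)
          (differentiableAt_extend F ξ) i).trans ?_)
        simp [pderivAt, restrict] }
    (fun F F' => by
      ext ξ
      have h := (eventuallyEq_of_forall (G := extend (F * F'))
        (G' := fun ξ => extend F ξ * extend F' ξ)
        (fun ξ => by simp only [extend_apply]; rfl) ξ).pderivAt_eq i
      refine h.trans ((pderivAt_mul (differentiableAt_extend F ξ)
        (differentiableAt_extend F' ξ) i).trans ?_)
      simp only [extend_apply]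
      rfl)

theorem partialDeriv_restrict (i : ι) (G : (ι → ℝ) → ℝ) (hG : ∀ ξ ∈ W, ContDiffAt ℝ ∞ G ξ) :
    partialDeriv W i (restrict G hG) = restrict (pderivAt i G) fun ξ hξ =>
      (hG ξ hξ).pderivAt i := by
  ext ξ
  exact (eventuallyEq_of_forall (G := extend (restrict G hG)) (fun ξ =>
    extend_apply _ ξ) ξ).pderivAt_eq i

theorem partialDeriv_comm (i j : ι) (F : smoothFunctions W) :
    partialDeriv W i (partialDeriv W j F) = partialDeriv W j (partialDeriv W i F) := by
  have h : F = restrict (extend F) fun ξ hξ => contDiffAt_extend F hξ := by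
    ext ξ; exact (extend_apply F ξ).symm
  rw [h]
  simp only [partialDeriv_restrict]
  ext ξ
  exact pderivAt_comm (contDiffAt_extend F ξ.2) i j

theorem isUnit_restrict {G : (ι → ℝ) → ℝ} {hG : ∀ ξ ∈ W, ContDiffAt ℝ ∞ G ξ}
    (h0 : ∀ ξ ∈ W, G ξ ≠ 0) : IsUnit (restrict G hG) := by
  refine IsUnit.of_mul_eq_one (restrict (fun ξ => (G ξ)⁻¹) fun ξ hξ => (hG ξ hξ).inv (h0 ξ hξ)) ?_
  ext ξ
  exact mul_inv_cancel₀ (h0 ξ ξ.2)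

end smoothFunctions

end SmoothFunctions

/-! ### The determining equations for an equation of state -/

/-- The determining system for the acceleration `-Q ∂_m P`, where the pressure `P` is a function
of `(x, S, v)` that depends on `x` and `v` through `x^N v` only and `Q` stands for `x^N`. -/
theorem DeterminingSystem.of_pressure {R : Type*} [CommRing R] [Algebra ℝ R]
    {D : Fin 7 → Derivation ℝ R R} {X : Fin 7 → R} {P Q G f ψ : R} {N : ℕ}
    (comm : ∀ i j, ∀ a, D i (D j a) = D j (D i a)) (dX : ∀ i, D i (X i) = 1)
    (dX0 : ∀ i j, i ≠ j → D i (X j) = 0) (hP : ∀ i, 2 < i → D i P = 0)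
    (hPx : X 0 * D 0 P = N * X 2 * D 2 P) (hQx : X 0 * D 0 Q = N * Q)
    (hQ : ∀ i, i ≠ 0 → D i Q = 0)
    (hG : G = -(Q * (D 0 P * X 2 + D 1 P * X 4 + D 2 P * X 5)))
    (fw : D 6 (D 6 (D 6 f)) = 0) (ey : D 5 ψ = Q * D 2 P * D 6 f) (ew : D 6 ψ = - D 5 f)
    (es : D 4 ψ = Q * D 1 P * D 6 f)
    (er : X 3 * D 0 f + G * D 3 f + X 6 * D 2 f
      + D 6 f * (X 2 * D 0 G + X 5 * D 2 G + X 4 * D 1 G)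
      + X 2 * D 0 ψ + X 6 * D 3 ψ + X 5 * D 2 ψ + X 4 * D 1 ψ = 0) :
    DeterminingSystem D X (-(Q * D 2 P)) (-(Q * D 1 P)) (-(Q * D 0 P * X 2)) f ψ N := by
  have hP2 : ∀ i j, 2 < i → D i (D j P) = 0 := fun i j hi => by rw [comm, hP i hi, map_zero]
  have hQ2 : ∀ i : Fin 7, 2 < i → D i Q = 0 := fun i hi => hQ i (by rintro rfl; simp at hi)
  refine ⟨fun i j _ a => comm i j a, dX, dX0, ?_, ?_, ?_, ?_, ?_, ?_, fw, ?_, ew, ?_, ?_⟩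
  · intro i hi
    simp only [map_neg, Derivation.leibniz, smul_eq_mul, hP2 i _ hi, hQ2 i hi]
    ring
  · intro i hi
    simp only [map_neg, Derivation.leibniz, smul_eq_mul, hP2 i _ hi, hQ2 i hi]
    ring
  · intro i hi
    simp only [map_neg, Derivation.leibniz, smul_eq_mul, hP2 i _ hi, hQ2 i hi,
      dX0 i 2 (by rintro rfl; simp at hi)]
    ring
  · simp (disch := decide) only [map_neg, Derivation.leibniz, smul_eq_mul, hQ, comm 2 1]
    ring
  · have h1 := congrArg (D 2) hPx
    simp (disch := decide) only [Derivation.leibniz, smul_eq_mul, dX, dX0, comm 2 0,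
      Derivation.map_natCast] at h1
    simp (disch := decide) only [map_neg, Derivation.leibniz, smul_eq_mul, hQ]
    linear_combination -Q * h1 - D 2 P * hQx
  · linear_combination -Q * X 2 * hPx
  · linear_combination ey
  · linear_combination es
  · rw [hG] at er
    simp (disch := decide) only [map_neg, map_add, Derivation.leibniz, smul_eq_mul, hQ, dX, dX0]
      at er ⊢
    linear_combination er

/-- The acceleration `-x^N ∂_m p` of a fluid particle, in the Lagrangian coordinates
`(x, S, v, U, s, y, w)`, where `s = ∂_m S`, `v = ∂_m x` and `y = ∂_m v`. -/
noncomputable def accel (N : ℕ) (P : (Fin 7 → ℝ) → ℝ) (ξ : Fin 7 → ℝ) : ℝ :=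
  -(ξ 0 ^ N * (pderivAt 0 P ξ * ξ 2 + pderivAt 1 P ξ * ξ 4 + pderivAt 2 P ξ * ξ 5))

/-- The equations satisfied by a conserved density `f` and its flux `ψ` in Lagrangian mass
coordinates, `f` being quadratic in `w = ∂_m U`, for the pressure `P`. The coordinates are
`(x, S, v, U, s, y, w)` with `v = ∂_m x`, `s = ∂_m S`, `y = ∂_m v`, `w = ∂_m U`. The first three
equations for `ψ` come from the second derivatives of `v`, `U` and `S`, in which the conservation
law is linear. -/
structure LagrangianSystem (N : ℕ) (W : Set (Fin 7 → ℝ)) (P f ψ : (Fin 7 → ℝ) → ℝ) : Prop where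
  isOpen : IsOpen W
  x_ne : ∀ ξ ∈ W, ξ 0 ≠ 0
  smoothP : ∀ ξ ∈ W, ContDiffAt ℝ ∞ P ξ
  smoothf : ∀ ξ ∈ W, ContDiffAt ℝ ∞ f ξ
  smoothψ : ∀ ξ ∈ W, ContDiffAt ℝ ∞ ψ ξ
  hP : ∀ ξ ∈ W, ∀ i, 2 < i → pderivAt i P ξ = 0
  hPx : ∀ ξ ∈ W, ξ 0 * pderivAt 0 P ξ = N * ξ 2 * pderivAt 2 P ξ
  fw : ∀ ξ ∈ W, pderivAt 6 (pderivAt 6 (pderivAt 6 f)) ξ = 0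
  ey : ∀ ξ ∈ W, pderivAt 5 ψ ξ = ξ 0 ^ N * pderivAt 2 P ξ * pderivAt 6 f ξ
  ew : ∀ ξ ∈ W, pderivAt 6 ψ ξ = -pderivAt 5 f ξ
  es : ∀ ξ ∈ W, pderivAt 4 ψ ξ = ξ 0 ^ N * pderivAt 1 P ξ * pderivAt 6 f ξ
  er : ∀ ξ ∈ W, ξ 3 * pderivAt 0 f ξ + accel N P ξ * pderivAt 3 f ξ + ξ 6 * pderivAt 2 f ξ
    + pderivAt 6 f ξ * (ξ 2 * pderivAt 0 (accel N P) ξ + ξ 5 * pderivAt 2 (accel N P) ξ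
      + ξ 4 * pderivAt 1 (accel N P) ξ)
    + ξ 2 * pderivAt 0 ψ ξ + ξ 6 * pderivAt 3 ψ ξ + ξ 5 * pderivAt 2 ψ ξ
    + ξ 4 * pderivAt 1 ψ ξ = 0

theorem contDiffAt_coord {ι : Type} [Fintype ι] (i : ι) (ξ : ι → ℝ) :
    ContDiffAt ℝ ∞ (fun ξ : ι → ℝ => ξ i) ξ :=
  (contDiff_apply ℝ ℝ i).contDiffAt

theorem contDiffAt_accel {N : ℕ} {P : (Fin 7 → ℝ) → ℝ} {ξ : Fin 7 → ℝ}
    (hP : ContDiffAt ℝ ∞ P ξ) : ContDiffAt ℝ ∞ (accel N P) ξ :=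
  (((contDiffAt_coord 0 ξ).pow N).mul ((((hP.pderivAt 0).mul (contDiffAt_coord 2 ξ)).add
    ((hP.pderivAt 1).mul (contDiffAt_coord 4 ξ))).add
    ((hP.pderivAt 2).mul (contDiffAt_coord 5 ξ)))).neg

namespace LagrangianSystem

variable {N : ℕ} {W : Set (Fin 7 → ℝ)} {P f ψ : (Fin 7 → ℝ) → ℝ}

theorem mono (H : LagrangianSystem N W P f ψ) {W' : Set (Fin 7 → ℝ)} (h : W' ⊆ W)
    (hW' : IsOpen W') : LagrangianSystem N W' P f ψ :=
  ⟨hW', fun ξ hξ => H.x_ne ξ (h hξ), fun ξ hξ => H.smoothP ξ (h hξ), fun ξ hξ => H.smoothf ξ (h hξ),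
    fun ξ hξ => H.smoothψ ξ (h hξ), fun ξ hξ => H.hP ξ (h hξ), fun ξ hξ => H.hPx ξ (h hξ),
    fun ξ hξ => H.fw ξ (h hξ), fun ξ hξ => H.ey ξ (h hξ), fun ξ hξ => H.ew ξ (h hξ),
    fun ξ hξ => H.es ξ (h hξ), fun ξ hξ => H.er ξ (h hξ)⟩

/-- The coordinate functions, as elements of the algebra of smooth functions. -/
def coordFun (W : TopologicalSpace.Opens (Fin 7 → ℝ)) (i : Fin 7) : smoothFunctions W :=
  smoothFunctions.restrict (fun ξ => ξ i) fun ξ _ => contDiffAt_coord i ξ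

open smoothFunctions in
theorem determiningSystem {W : TopologicalSpace.Opens (Fin 7 → ℝ)}
    (H : LagrangianSystem N W P f ψ) :
    DeterminingSystem (partialDeriv W) (coordFun W)
      (-(coordFun W 0 ^ N * partialDeriv W 2 (restrict P H.smoothP)))
      (-(coordFun W 0 ^ N * partialDeriv W 1 (restrict P H.smoothP)))
      (-(coordFun W 0 ^ N * partialDeriv W 0 (restrict P H.smoothP) * coordFun W 2))
      (restrict f H.smoothf) (restrict ψ H.smoothψ) N := by
  have hX : ∀ i j, partialDeriv W i (coordFun W j) = if i = j then 1 else 0 := by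
    intro i j
    rw [coordFun, partialDeriv_restrict]
    ext ξ
    refine (pderivAt_coord i j _).trans ?_
    split_ifs <;> rfl
  have hX1 : ∀ i, partialDeriv W i (coordFun W i) = 1 := fun i => by simp [hX]
  have hX0 : ∀ i j, i ≠ j → partialDeriv W i (coordFun W j) = 0 := fun i j h => by simp [hX, h]
  refine DeterminingSystem.of_pressure
    (G := restrict (accel N P) fun ξ hξ => contDiffAt_accel (H.smoothP ξ hξ))
    (fun i j a => partialDeriv_comm i j a) hX1 hX0 ?_ ?_ ?_ ?_ ?_ ?_ ?_ ?_ ?_ ?_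
  · intro i hi
    rw [partialDeriv_restrict]
    exact Subtype.ext (funext fun ξ => H.hP ξ ξ.2 i hi)
  · rw [partialDeriv_restrict, partialDeriv_restrict]
    exact Subtype.ext (funext fun ξ => by simp; exact H.hPx ξ ξ.2)
  · rw [Derivation.leibniz_pow, hX1]
    rcases N with _ | m
    · simp
    · simp [pow_succ]; ring
  · intro i hi
    rw [Derivation.leibniz_pow, hX0 i 0 hi]
    simp
  · simp only [partialDeriv_restrict]
    rfl
  · simp only [partialDeriv_restrict]
    exact Subtype.ext (funext fun ξ => H.fw ξ ξ.2)
  · simp only [partialDeriv_restrict]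
    exact Subtype.ext (funext fun ξ => H.ey ξ ξ.2)
  · simp only [partialDeriv_restrict]
    exact Subtype.ext (funext fun ξ => H.ew ξ ξ.2)
  · simp only [partialDeriv_restrict]
    exact Subtype.ext (funext fun ξ => H.es ξ ξ.2)
  · simp only [partialDeriv_restrict]
    exact Subtype.ext (funext fun ξ => H.er ξ ξ.2)

open smoothFunctions in
/-- The algebraic lemmas apply on an open set on which `∂_v² p` either has no zero or vanishes. -/
theorem quadratic_eq_zero_of_opens {W : TopologicalSpace.Opens (Fin 7 → ℝ)}
    (H : LagrangianSystem N W P f ψ) (hN : N ≠ 0) (hPv : ∀ ξ ∈ W, pderivAt 2 P ξ ≠ 0)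
    (hc : (∀ ξ ∈ W, pderivAt 2 (pderivAt 2 P) ξ ≠ 0) ∨ ∀ ξ ∈ W, pderivAt 2 (pderivAt 2 P) ξ = 0) :
    ∀ ξ ∈ W, pderivAt 6 (pderivAt 6 f) ξ = 0 ∧ pderivAt 5 (pderivAt 6 f) ξ = 0 := by
  have hD := H.determiningSystem
  have hx : IsUnit (coordFun W 0) := isUnit_restrict H.x_ne
  have hκ : IsUnit (-(coordFun W 0 ^ N * partialDeriv W 2 (restrict P H.smoothP))) := by
    rw [partialDeriv_restrict]
    exact ((hx.pow N).mul (isUnit_restrict hPv)).neg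
  have hκv : partialDeriv W 2 (-(coordFun W 0 ^ N * partialDeriv W 2 (restrict P H.smoothP))) =
      -(coordFun W 0 ^ N * restrict (pderivAt 2 (pderivAt 2 P))
        fun ξ hξ => ((H.smoothP ξ hξ).pderivAt 2).pderivAt 2) := by
    rw [map_neg, Derivation.leibniz, Derivation.leibniz_pow, hD.dX0 2 0 (by decide),
      partialDeriv_restrict, partialDeriv_restrict]
    simp
  have key : partialDeriv W 6 (partialDeriv W 6 (restrict f H.smoothf)) = 0 ∧
      partialDeriv W 5 (partialDeriv W 6 (restrict f H.smoothf)) = 0 := by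
    rcases hc with hc | hc
    · refine hD.quadratic_eq_zero_of_isUnit ?_
      rw [hκv]
      exact ((hx.pow N).mul (isUnit_restrict hc)).neg
    · refine hD.quadratic_eq_zero_of_eq_zero hN hκ hx ?_
      rw [hκv]
      have h0 : restrict (pderivAt 2 (pderivAt 2 P))
        (fun ξ hξ => ((H.smoothP ξ hξ).pderivAt 2).pderivAt 2) = (0 : smoothFunctions W) :=
        Subtype.ext (funext fun ξ => hc ξ ξ.2)
      rw [h0, mul_zero, neg_zero]
  simp only [partialDeriv_restrict] at key
  exact fun ξ hξ => ⟨congrFun (congrArg Subtype.val key.1) ⟨ξ, hξ⟩,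
    congrFun (congrArg Subtype.val key.2) ⟨ξ, hξ⟩⟩

/-- The set where `∂_v² p` does not vanish and the interior of its complement form a dense set,
and on both of them the algebraic argument applies. -/
theorem quadratic_eq_zero (H : LagrangianSystem N W P f ψ) (hN : N ≠ 0)
    (hPv : ∀ ξ ∈ W, pderivAt 2 P ξ ≠ 0) {ξ : Fin 7 → ℝ} (hξ : ξ ∈ W) :
    pderivAt 6 (pderivAt 6 f) ξ = 0 ∧ pderivAt 5 (pderivAt 6 f) ξ = 0 := by
  by_contra hne
  have hopen : ∀ (V : Set (Fin 7 → ℝ)) (hV : IsOpen V), V ⊆ W →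
      ((∀ ξ ∈ V, pderivAt 2 (pderivAt 2 P) ξ ≠ 0) ∨ ∀ ξ ∈ V, pderivAt 2 (pderivAt 2 P) ξ = 0) →
      ∀ ξ ∈ V, pderivAt 6 (pderivAt 6 f) ξ = 0 ∧ pderivAt 5 (pderivAt 6 f) ξ = 0 :=
    fun V hV hVW hc => quadratic_eq_zero_of_opens (W := ⟨V, hV⟩) (H.mono hVW hV) hN
      (fun η hη => hPv η (hVW hη)) hc
  have hcont : ∀ i j, ∀ η ∈ W, ContinuousAt (pderivAt i (pderivAt j f)) η :=
    fun i j η hη => (((H.smoothf η hη).pderivAt j).pderivAt i).continuousAt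
  have hbad : ∀ᶠ η in 𝓝 ξ, η ∈ W ∧
      ¬(pderivAt 6 (pderivAt 6 f) η = 0 ∧ pderivAt 5 (pderivAt 6 f) η = 0) := by
    refine (H.isOpen.eventually_mem hξ).and ?_
    rw [not_and_or] at hne
    rcases hne with h | h
    · filter_upwards [(hcont 6 6 ξ hξ).eventually_ne h] with η hη h2 using hη h2.1
    · filter_upwards [(hcont 5 6 ξ hξ).eventually_ne h] with η hη h2 using hη h2.2
  obtain ⟨V, hVsub, hV, hξV⟩ := eventually_nhds_iff.1 hbad
  have hVW : V ⊆ W := fun η hη => (hVsub η hη).1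
  by_cases hz : ∀ η ∈ V, pderivAt 2 (pderivAt 2 P) η = 0
  · exact (hVsub ξ hξV).2 (hopen V hV hVW (Or.inr hz) ξ hξV)
  · push Not at hz
    obtain ⟨η, hηV, hη⟩ := hz
    have hcP : ContinuousAt (pderivAt 2 (pderivAt 2 P)) η :=
      (((H.smoothP η (hVW hηV)).pderivAt 2).pderivAt 2).continuousAt
    obtain ⟨V', hV'sub, hV', hηV'⟩ := eventually_nhds_iff.1
      ((hcP.eventually_ne hη).and (hV.eventually_mem hηV))
    exact (hVsub η hηV).2 (hopen V' hV' (fun ζ hζ => hVW (hV'sub ζ hζ).2)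
      (Or.inl fun ζ hζ => (hV'sub ζ hζ).1) η hηV')

end LagrangianSystem

/-! ### Normal form of a conserved density -/

/-- The derivative `∂_m T` along the flow variables, for `T` depending on `(x, S, v, U)` only. -/
noncomputable def massDeriv (T : (Fin 7 → ℝ) → ℝ) (ξ : Fin 7 → ℝ) : ℝ :=
  ξ 2 * pderivAt 0 T ξ + ξ 4 * pderivAt 1 T ξ + ξ 5 * pderivAt 2 T ξ + ξ 6 * pderivAt 3 T ξ

theorem SmoothNear.massDeriv {T : (Fin 7 → ℝ) → ℝ} {ξ : Fin 7 → ℝ} (h : SmoothNear T ξ) :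
    SmoothNear (massDeriv T) ξ := by
  filter_upwards [h] with ξ h
  exact ((((contDiffAt_coord 2 ξ).mul (h.pderivAt 0)).add
    ((contDiffAt_coord 4 ξ).mul (h.pderivAt 1))).add
    ((contDiffAt_coord 5 ξ).mul (h.pderivAt 2))).add ((contDiffAt_coord 6 ξ).mul (h.pderivAt 3))

theorem SmoothNear.sub {E : Type*} [NormedAddCommGroup E] [NormedSpace ℝ E] {F G : E → ℝ} {x : E}
    (hF : SmoothNear F x) (hG : SmoothNear G x) : SmoothNear (fun y => F y - G y) x := by
  filter_upwards [hF, hG] with y h1 h2 using h1.sub h2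

theorem SmoothNear.add {E : Type*} [NormedAddCommGroup E] [NormedSpace ℝ E] {F G : E → ℝ} {x : E}
    (hF : SmoothNear F x) (hG : SmoothNear G x) : SmoothNear (fun y => F y + G y) x := by
  filter_upwards [hF, hG] with y h1 h2 using h1.add h2

theorem SmoothNear.eventually_pderivAt_sub {ι : Type} [Fintype ι] [DecidableEq ι]
    {F G : (ι → ℝ) → ℝ} {x : ι → ℝ} (hF : SmoothNear F x) (hG : SmoothNear G x) :
    ∀ᶠ ξ in 𝓝 x, ∀ i,
      _root_.pderivAt i (fun y => F y - G y) ξ = _root_.pderivAt i F ξ - _root_.pderivAt i G ξ := by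
  filter_upwards [hF, hG] with ξ h1 h2 i
  exact pderivAt_sub (h1.differentiableAt (by simp)) (h2.differentiableAt (by simp)) i

theorem SmoothNear.eventually_pderivAt_add {ι : Type} [Fintype ι] [DecidableEq ι]
    {F G : (ι → ℝ) → ℝ} {x : ι → ℝ} (hF : SmoothNear F x) (hG : SmoothNear G x) :
    ∀ᶠ ξ in 𝓝 x, ∀ i,
      _root_.pderivAt i (fun y => F y + G y) ξ = _root_.pderivAt i F ξ + _root_.pderivAt i G ξ := by
  filter_upwards [hF, hG] with ξ h1 h2 i
  exact pderivAt_add (h1.differentiableAt (by simp)) (h2.differentiableAt (by simp)) i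

theorem eventually_pderivAt_eq {ι : Type} [Fintype ι] [DecidableEq ι] {F G : (ι → ℝ) → ℝ}
    {x : ι → ℝ} (h : ∀ᶠ ξ in 𝓝 x, F ξ = G ξ) (i : ι) :
    ∀ᶠ ξ in 𝓝 x, pderivAt i F ξ = pderivAt i G ξ := by
  filter_upwards [h.eventually_nhds] with ξ hξ using Filter.EventuallyEq.pderivAt_eq hξ i

namespace LagrangianSystem

variable {N : ℕ} {W : Set (Fin 7 → ℝ)} {P f ψ : (Fin 7 → ℝ) → ℝ}

/-- A potential `T (x, S, v, U)` with `∂_U T = ∂_w f` and `∂_v T = ∂_y f`,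
  so that all dependence of the
density on `w` and `y` is contained in the trivial density `∂_m T`. -/
theorem exists_potential (H : LagrangianSystem N W P f ψ) (hN : N ≠ 0)
    (hPv : ∀ ξ ∈ W, pderivAt 2 P ξ ≠ 0) {ξ₀ : Fin 7 → ℝ} (hξ₀ : ξ₀ ∈ W) :
    ∃ T : (Fin 7 → ℝ) → ℝ, SmoothNear T ξ₀ ∧ (∀ᶠ ξ in 𝓝 ξ₀, ∀ i, 3 < i → pderivAt i T ξ = 0) ∧
      (∀ᶠ ξ in 𝓝 ξ₀, pderivAt 3 T ξ = pderivAt 6 f ξ) ∧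
      ∀ᶠ ξ in 𝓝 ξ₀, pderivAt 2 T ξ = pderivAt 5 f ξ := by
  have hev := H.isOpen.eventually_mem hξ₀
  have hf : SmoothNear f ξ₀ := by filter_upwards [hev] with ξ h using H.smoothf ξ h
  have hlin : ∀ ξ ∈ W, pderivAt 4 (pderivAt 6 f) ξ = 0 ∧ pderivAt 4 (pderivAt 5 f) ξ = 0 ∧
      pderivAt 5 (pderivAt 5 f) ξ = 0 ∧ pderivAt 3 (pderivAt 5 f) ξ = pderivAt 2
        (pderivAt 6 f) ξ := by
    let Wo : TopologicalSpace.Opens (Fin 7 → ℝ) := ⟨W, H.isOpen⟩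
    have hD := determiningSystem (W := Wo) H
    have hκ : IsUnit (-(coordFun Wo 0 ^ N * smoothFunctions.partialDeriv Wo 2
        (smoothFunctions.restrict P H.smoothP))) := by
      rw [smoothFunctions.partialDeriv_restrict]
      exact (((smoothFunctions.isUnit_restrict H.x_ne).pow N).mul
        (smoothFunctions.isUnit_restrict hPv)).neg
    have h := hD.linear_coeffs hκ
      (by simp only [smoothFunctions.partialDeriv_restrict]
          exact Subtype.ext (funext fun ξ => (H.quadratic_eq_zero hN hPv ξ.2).1))
      (by simp only [smoothFunctions.partialDeriv_restrict]
          exact Subtype.ext (funext fun ξ => (H.quadratic_eq_zero hN hPv ξ.2).2))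
    simp only [smoothFunctions.partialDeriv_restrict] at h
    obtain ⟨h1, h2, h3, h4⟩ := h
    exact fun ξ hξ => ⟨congrFun (congrArg Subtype.val h1) ⟨ξ, hξ⟩,
      congrFun (congrArg Subtype.val h2) ⟨ξ, hξ⟩, congrFun (congrArg Subtype.val h3) ⟨ξ, hξ⟩,
      congrFun (congrArg Subtype.val h4) ⟨ξ, hξ⟩⟩
  obtain ⟨H₁, hs₁, hU₁, hI₁⟩ := exists_antiderivative (hf.pderivAt 6) 3
    (I := {4, 5, 6}) (by decide) (by
      filter_upwards [hev] with ξ hξ i hi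
      obtain ⟨h6, h5⟩ := H.quadratic_eq_zero hN hPv hξ
      fin_cases hi
      exacts [(hlin ξ hξ).1, h5, h6])
  have hq := (hf.pderivAt 5).sub (hs₁.pderivAt 2)
  obtain ⟨H₂, hs₂, hU₂, hI₂⟩ := exists_antiderivative hq 2 (I := {3, 4, 5, 6}) (by decide) (by
      filter_upwards [hev, (hf.pderivAt 5).eventually_pderivAt_sub (hs₁.pderivAt 2), hs₁,
        eventually_pderivAt_eq hU₁ 2, hI₁.eventually_nhds] with ξ hξ h1 h2 h3 h4 i hi
      rw [h1 i, pderivAt_comm h2]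
      obtain ⟨l1, l2, l3, l4⟩ := hlin ξ hξ
      have h5 : ∀ i ∈ ({4, 5, 6} : Finset (Fin 7)), pderivAt 2 (pderivAt i H₁) ξ = 0 := by
        intro i hi
        have h6 : pderivAt i H₁ =ᶠ[𝓝 ξ] fun _ => 0 := by
          filter_upwards [h4] with η hη using hη i hi
        rw [h6.pderivAt_eq]
        simp [pderivAt]
      have h56 : pderivAt 6 (pderivAt 5 f) ξ = 0 := by
        rw [pderivAt_comm (H.smoothf ξ hξ)]; exact (H.quadratic_eq_zero hN hPv hξ).2
      fin_cases hi
      · exact sub_eq_zero.2 (l4.trans h3.symm)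
      · exact sub_eq_zero.2 (l2.trans (h5 4 (by decide)).symm)
      · exact sub_eq_zero.2 (l3.trans (h5 5 (by decide)).symm)
      · exact sub_eq_zero.2 (h56.trans (h5 6 (by decide)).symm))
  refine ⟨fun ξ => H₁ ξ + H₂ ξ, hs₁.add hs₂, ?_, ?_, ?_⟩
  · filter_upwards [hs₁.eventually_pderivAt_add hs₂, hI₁, hI₂] with ξ h1 h2 h3 i hi
    rw [h1, h2 i (by revert i; decide), h3 i (by revert i; decide), add_zero]
  · filter_upwards [hs₁.eventually_pderivAt_add hs₂, hU₁, hI₂] with ξ h1 h2 h3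
    rw [h1, h2, h3 3 (by decide), add_zero]
  · filter_upwards [hs₁.eventually_pderivAt_add hs₂, hU₂] with ξ h1 h2
    rw [h1, h2]
    ring

/-- After subtraction of a trivial density the density depends neither on `y` nor on `w`, and its
dependence on `s` separates. -/
theorem exists_reduction (H : LagrangianSystem N W P f ψ) (hN : N ≠ 0)
    (hPv : ∀ ξ ∈ W, pderivAt 2 P ξ ≠ 0) {ξ₀ : Fin 7 → ℝ} (hξ₀ : ξ₀ ∈ W) :
    ∃ T : (Fin 7 → ℝ) → ℝ, SmoothNear T ξ₀ ∧ (∀ᶠ ξ in 𝓝 ξ₀, ∀ i, 3 < i → pderivAt i T ξ = 0) ∧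
      ∀ᶠ ξ in 𝓝 ξ₀, pderivAt 5 (fun η => f η - massDeriv T η) ξ = 0 ∧
        pderivAt 6 (fun η => f η - massDeriv T η) ξ = 0 ∧
        pderivAt 2 (pderivAt 4 (fun η => f η - massDeriv T η)) ξ = 0 ∧
        pderivAt 3 (pderivAt 4 (fun η => f η - massDeriv T η)) ξ = 0 ∧
        pderivAt 0 (pderivAt 4 (pderivAt 4 (fun η => f η - massDeriv T η))) ξ = 0 := by
  obtain ⟨T, hT, hTi, hT3, hT2⟩ := H.exists_potential hN hPv hξ₀
  refine ⟨T, hT, hTi, ?_⟩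
  obtain ⟨V, hVsub, hV, hξV⟩ := eventually_nhds_iff.1
    ((H.isOpen.eventually_mem hξ₀).and (hT.and (hTi.and (hT3.and hT2))))
  have hVW : V ⊆ W := fun η hη => (hVsub η hη).1
  have HV := H.mono hVW hV
  have hTs : ∀ ξ ∈ V, ContDiffAt ℝ ∞ T ξ := fun ξ hξ => (hVsub ξ hξ).2.1
  let Vo : TopologicalSpace.Opens (Fin 7 → ℝ) := ⟨V, hV⟩
  have hD := determiningSystem (W := Vo) HV
  have hκ : IsUnit (-(coordFun Vo 0 ^ N * smoothFunctions.partialDeriv Vo 2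
      (smoothFunctions.restrict P HV.smoothP))) := by
    rw [smoothFunctions.partialDeriv_restrict]
    exact (((smoothFunctions.isUnit_restrict HV.x_ne).pow N).mul
      (smoothFunctions.isUnit_restrict fun ξ hξ => hPv ξ (hVW hξ))).neg
  have hTR : ∀ i, 3 < i → smoothFunctions.partialDeriv Vo i
      (smoothFunctions.restrict T hTs) = 0 := by
    intro i hi
    rw [smoothFunctions.partialDeriv_restrict]
    exact Subtype.ext (funext fun ξ => (hVsub ξ ξ.2).2.2.1 i hi)
  have hT3R : smoothFunctions.partialDeriv Vo 3 (smoothFunctions.restrict T hTs) =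
      smoothFunctions.partialDeriv Vo 6 (smoothFunctions.restrict f HV.smoothf) := by
    simp only [smoothFunctions.partialDeriv_restrict]
    exact Subtype.ext (funext fun ξ => (hVsub ξ ξ.2).2.2.2.1)
  have hT2R : smoothFunctions.partialDeriv Vo 2 (smoothFunctions.restrict T hTs) =
      smoothFunctions.partialDeriv Vo 5 (smoothFunctions.restrict f HV.smoothf) := by
    simp only [smoothFunctions.partialDeriv_restrict]
    exact Subtype.ext (funext fun ξ => (hVsub ξ ξ.2).2.2.2.2)
  have hD' := hD.sub_trivial hTR
  have h6 : smoothFunctions.partialDeriv Vo 6 (smoothFunctions.restrict f HV.smoothf -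
      (coordFun Vo 2 * smoothFunctions.partialDeriv Vo 0 (smoothFunctions.restrict T hTs) +
        coordFun Vo 4 * smoothFunctions.partialDeriv Vo 1 (smoothFunctions.restrict T hTs) +
        coordFun Vo 5 * smoothFunctions.partialDeriv Vo 2 (smoothFunctions.restrict T hTs) +
        coordFun Vo 6 * smoothFunctions.partialDeriv Vo 3
          (smoothFunctions.restrict T hTs))) = 0 := by
    simp (disch := decide) only [map_add, map_sub, Derivation.leibniz, smul_eq_mul, hD.comm 6,
      hD.dX, hD.dX0, hTR, map_zero]
    rw [hT3R]; ring
  have h5 : smoothFunctions.partialDeriv Vo 5 (smoothFunctions.restrict f HV.smoothf -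
      (coordFun Vo 2 * smoothFunctions.partialDeriv Vo 0 (smoothFunctions.restrict T hTs) +
        coordFun Vo 4 * smoothFunctions.partialDeriv Vo 1 (smoothFunctions.restrict T hTs) +
        coordFun Vo 5 * smoothFunctions.partialDeriv Vo 2 (smoothFunctions.restrict T hTs) +
        coordFun Vo 6 * smoothFunctions.partialDeriv Vo 3
          (smoothFunctions.restrict T hTs))) = 0 := by
    simp (disch := decide) only [map_add, map_sub, Derivation.leibniz, smul_eq_mul, hD.comm 5,
      hD.dX, hD.dX0, hTR, map_zero]
    rw [hT2R]; ring
  obtain ⟨s1, s2, s3⟩ := hD'.separation hκ h6 h5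
  have hTN : ∀ ξ ∈ Vo, ContDiffAt ℝ ∞ (fun η => f η - massDeriv T η) ξ := fun ξ hξ =>
    (HV.smoothf ξ hξ).sub ((SmoothNear.massDeriv (by
      filter_upwards [hV.mem_nhds hξ] with η hη using hTs η hη)).self_of_nhds)
  have hEq : smoothFunctions.restrict f HV.smoothf -
      (coordFun Vo 2 * smoothFunctions.partialDeriv Vo 0 (smoothFunctions.restrict T hTs) +
        coordFun Vo 4 * smoothFunctions.partialDeriv Vo 1 (smoothFunctions.restrict T hTs) +
        coordFun Vo 5 * smoothFunctions.partialDeriv Vo 2 (smoothFunctions.restrict T hTs) +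
        coordFun Vo 6 * smoothFunctions.partialDeriv Vo 3 (smoothFunctions.restrict T hTs)) =
      smoothFunctions.restrict (fun η => f η - massDeriv T η) hTN := by
    simp only [smoothFunctions.partialDeriv_restrict]
    rfl
  rw [hEq] at h5 h6 s1 s2 s3
  simp only [smoothFunctions.partialDeriv_restrict] at h5 h6 s1 s2 s3
  filter_upwards [hV.mem_nhds hξV] with ξ hξ
  exact ⟨congrFun (congrArg Subtype.val h5) ⟨ξ, hξ⟩, congrFun (congrArg Subtype.val h6) ⟨ξ, hξ⟩,
    congrFun (congrArg Subtype.val s1) ⟨ξ, hξ⟩, congrFun (congrArg Subtype.val s2) ⟨ξ, hξ⟩,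
    congrFun (congrArg Subtype.val s3) ⟨ξ, hξ⟩⟩

/-- Where `p_ρ ≠ 0`, a conserved density is the sum of a trivial density `∂_m θ`, of a function
`A (S, ∂_m S)` and of a kinematic density. -/
theorem normal_form (H : LagrangianSystem N W P f ψ) (hN : N ≠ 0)
    {ξ₀ : Fin 7 → ℝ} (hξ₀ : ξ₀ ∈ W) (hP0 : pderivAt 2 P ξ₀ ≠ 0) :
    ∃ θ A k : (Fin 7 → ℝ) → ℝ, SmoothNear θ ξ₀ ∧ SmoothNear A ξ₀ ∧ SmoothNear k ξ₀ ∧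
      (∀ᶠ ξ in 𝓝 ξ₀, ∀ i, 3 < i → pderivAt i θ ξ = 0) ∧
      (∀ᶠ ξ in 𝓝 ξ₀, ∀ i, i ≠ 1 → i ≠ 4 → pderivAt i A ξ = 0) ∧
      (∀ᶠ ξ in 𝓝 ξ₀, ∀ i, 3 < i → pderivAt i k ξ = 0) ∧
      ∀ᶠ ξ in 𝓝 ξ₀, f ξ = massDeriv θ ξ + A ξ + k ξ := by
  obtain ⟨V, hVsub, hV, hξV⟩ := eventually_nhds_iff.1 ((H.isOpen.eventually_mem hξ₀).and
    (((H.smoothP ξ₀ hξ₀).pderivAt 2).continuousAt.eventually_ne hP0))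
  obtain ⟨T, hT, hTi, hred⟩ := (H.mono (fun ξ hξ => (hVsub ξ hξ).1) hV).exists_reduction hN
    (fun ξ hξ => (hVsub ξ hξ).2) hξV
  have hf : SmoothNear f ξ₀ := by
    filter_upwards [H.isOpen.mem_nhds hξ₀] with ξ h using H.smoothf ξ h
  set F : (Fin 7 → ℝ) → ℝ := fun η => f η - massDeriv T η with hFdef
  have hF : SmoothNear F ξ₀ := hf.sub hT.massDeriv
  -- `A` has the dependence of `F` on `(S, s)` and nothing else; what remains of `F` is affine in `s`,
  -- and its linear part is that of the trivial density `∂_m M`, for a potential `M (x, S)`.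
  let J : Finset (Fin 7) := {0, 2, 3, 5, 6}
  have ht := tendsto_freezeCoords J ξ₀
  set A : (Fin 7 → ℝ) → ℝ := fun ξ => F (freezeCoords J ξ₀ ξ) with hAdef
  have hA : SmoothNear A ξ₀ := by
    filter_upwards [ht.eventually hF] with ξ hξ
    exact hξ.comp ξ (contDiff_freezeCoords J ξ₀).contDiffAt
  have hAi : ∀ᶠ ξ in 𝓝 ξ₀, ∀ i, i ≠ 1 → i ≠ 4 → pderivAt i A ξ = 0 := by
    filter_upwards [ht.eventually hF] with ξ hξ i h1 h4
    rw [hAdef, pderivAt_comp_freezeCoords (hξ.differentiableAt (by simp)), if_pos]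
    revert i; decide
  have hA4 : ∀ᶠ ξ in 𝓝 ξ₀, pderivAt 4 A ξ = pderivAt 4 F (freezeCoords J ξ₀ ξ) := by
    filter_upwards [ht.eventually hF] with ξ hξ
    rw [hAdef, pderivAt_comp_freezeCoords (hξ.differentiableAt (by simp)), if_neg (by decide)]
  have hA44 : ∀ᶠ ξ in 𝓝 ξ₀,
      pderivAt 4 (pderivAt 4 A) ξ = pderivAt 4 (pderivAt 4 F) (freezeCoords J ξ₀ ξ) := by
    filter_upwards [eventually_pderivAt_eq hA4 4, ht.eventually hF] with ξ h1 hξ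
    rw [h1, pderivAt_comp_freezeCoords ((hξ.pderivAt 4).differentiableAt (by simp)),
      if_neg (by decide)]
  have hzero : ∀ {G : (Fin 7 → ℝ) → ℝ} (i : Fin 7), (∀ᶠ ξ in 𝓝 ξ₀, G ξ = 0) →
      ∀ᶠ ξ in 𝓝 ξ₀, pderivAt i G ξ = 0 := by
    intro G i h
    filter_upwards [eventually_pderivAt_eq (G := fun _ => 0) h i] with ξ hξ
    rw [hξ]; simp [pderivAt]
  have hcomm : ∀ {G : (Fin 7 → ℝ) → ℝ} (i j : Fin 7), SmoothNear G ξ₀ → ∀ᶠ ξ in 𝓝 ξ₀,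
      pderivAt i (pderivAt j G) ξ = pderivAt j (pderivAt i G) ξ := by
    intro G i j h
    filter_upwards [h] with ξ hξ using pderivAt_comm hξ i j
  -- `∂_s F` depends on `(x, S, s)` only
  have hF4 : ∀ i ∈ ({2, 3, 5, 6} : Finset (Fin 7)),
      ∀ᶠ ξ in 𝓝 ξ₀, pderivAt i (pderivAt 4 F) ξ = 0 := by
    intro i hi
    fin_cases hi
    · filter_upwards [hred] with ξ h using h.2.2.1
    · filter_upwards [hred] with ξ h using h.2.2.2.1
    · filter_upwards [hcomm 5 4 hF, hzero 4 (hred.mono fun ξ h => h.1)] with ξ h1 h2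
      exact h1.trans h2
    · filter_upwards [hcomm 6 4 hF, hzero 4 (hred.mono fun ξ h => h.2.1)] with ξ h1 h2
      exact h1.trans h2
  have hF44 : ∀ᶠ ξ in 𝓝 ξ₀, ∀ i ∈ J, pderivAt i (pderivAt 4 (pderivAt 4 F)) ξ = 0 := by
    rw [Finset.eventually_all]
    intro i hi
    by_cases h0 : i = 0
    · subst h0
      filter_upwards [hred] with ξ h using h.2.2.2.2
    · have hi' : i ∈ ({2, 3, 5, 6} : Finset (Fin 7)) := by revert i; decide
      filter_upwards [hcomm i 4 (hF.pderivAt 4), hzero 4 (hF4 i hi')] with ξ h1 h2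
      exact h1.trans h2
  have hFA := eventually_comp_freezeCoords_eq ((hF.pderivAt 4).pderivAt 4) hF44
  have hA₁ : SmoothNear (fun ξ => pderivAt 4 F ξ - pderivAt 4 A ξ) ξ₀ :=
    (hF.pderivAt 4).sub (hA.pderivAt 4)
  obtain ⟨M, hM, hM1, hMI⟩ := exists_antiderivative hA₁ 1 (I := {2, 3, 4, 5, 6}) (by decide) (by
    have h1 := (hF.pderivAt 4).eventually_pderivAt_sub (hA.pderivAt 4)
    rw [Finset.eventually_all]
    intro i hi
    by_cases h4 : i = 4
    · subst h4
      filter_upwards [h1, hA44, hFA] with ξ h1 h2 h3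
      rw [h1, h2, h3, sub_self]
    · have hi' : i ∈ ({2, 3, 5, 6} : Finset (Fin 7)) := by revert i; decide
      have hi1 : i ≠ 1 := by rintro rfl; simp at hi
      filter_upwards [h1, hF4 i hi', hcomm i 4 hA,
        hzero 4 (hAi.mono fun ξ h => h i hi1 h4)] with ξ h1 h2 h3 h5
      rw [h1, h2, h3, h5, sub_self])
  have hMm : SmoothNear (massDeriv M) ξ₀ := hM.massDeriv
  refine ⟨fun ξ => T ξ + M ξ, A, fun ξ => (F ξ - A ξ) - massDeriv M ξ, hT.add hM, hA,
    (hF.sub hA).sub hMm, ?_, hAi, ?_, ?_⟩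
  · filter_upwards [hT.eventually_pderivAt_add hM, hTi, hMI] with ξ h1 h2 h3 i hi
    rw [h1, h2 i hi, h3 i (by revert i; decide), add_zero]
  · have hMM : ∀ᶠ ξ in 𝓝 ξ₀, massDeriv M ξ =
        ξ 2 * pderivAt 0 M ξ + ξ 4 * (pderivAt 4 F ξ - pderivAt 4 A ξ) := by
      filter_upwards [hM1, hMI] with ξ h1 h2
      rw [massDeriv, h1, h2 2 (by decide), h2 3 (by decide)]
      ring
    have hMi : ∀ i, 3 < i → ∀ᶠ ξ in 𝓝 ξ₀, pderivAt i (pderivAt 0 M) ξ = 0 := by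
      intro i hi
      filter_upwards [hcomm i 0 hM, hzero 0 (hMI.mono fun ξ h => h i (by revert i; decide))]
        with ξ h1 h2 using h1.trans h2
    have hA₁i : ∀ i, 3 < i → ∀ᶠ ξ in 𝓝 ξ₀,
        pderivAt i (fun ξ => pderivAt 4 F ξ - pderivAt 4 A ξ) ξ = 0 := by
      intro i hi
      filter_upwards [eventually_pderivAt_eq hM1 i, hcomm i 1 hM,
        hzero 1 (hMI.mono fun ξ h => h i (by revert i; decide))] with ξ h1 h2 h3
      rw [← h1, h2, h3]
    have hMd : ∀ i, 3 < i → ∀ᶠ ξ in 𝓝 ξ₀, pderivAt i (massDeriv M) ξ =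
        (if i = 4 then 1 else 0) * (pderivAt 4 F ξ - pderivAt 4 A ξ) := by
      intro i hi
      filter_upwards [eventually_pderivAt_eq hMM i, hMi i hi, hA₁i i hi, hM, hA₁]
        with ξ h1 h2 h3 h4 h5
      have d1 : DifferentiableAt ℝ (fun ξ : Fin 7 → ℝ => ξ 2 * pderivAt 0 M ξ) ξ :=
        ((contDiffAt_coord 2 ξ).mul (h4.pderivAt 0)).differentiableAt (by simp)
      have d2 : DifferentiableAt ℝ
          (fun ξ : Fin 7 → ℝ => ξ 4 * (pderivAt 4 F ξ - pderivAt 4 A ξ)) ξ :=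
        ((contDiffAt_coord 4 ξ).mul h5).differentiableAt (by simp)
      rw [h1, pderivAt_add d1 d2,
        pderivAt_mul ((contDiffAt_coord 2 ξ).differentiableAt (by simp))
          ((h4.pderivAt 0).differentiableAt (by simp)),
        pderivAt_mul ((contDiffAt_coord 4 ξ).differentiableAt (by simp))
          (h5.differentiableAt (by simp)), h2, h3, pderivAt_coord, pderivAt_coord,
        if_neg (by rintro rfl; simp at hi)]
      ring
    have h34 : ∀ i : Fin 7, 3 < i → i = 4 ∨ i = 5 ∨ i = 6 := by decide
    have hk := (hF.sub hA).eventually_pderivAt_sub hMm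
    filter_upwards [hk, hF.eventually_pderivAt_sub hA, hMd 4 (by decide), hMd 5 (by decide),
      hMd 6 (by decide), hAi, hred] with ξ h1 h2 h4 h5 h6 h7 h8 i hi
    rcases h34 i hi with rfl | rfl | rfl
    · rw [h1, h2, h4, if_pos rfl]; ring
    · rw [h1, h2, h5, h7 5 (by decide) (by decide), h8.1, if_neg (by decide)]; ring
    · rw [h1, h2, h6, h7 6 (by decide) (by decide), h8.2.1, if_neg (by decide)]; ring
  · filter_upwards [hT.eventually_pderivAt_add hM] with ξ h1
    have h2 : massDeriv (fun ξ => T ξ + M ξ) ξ = massDeriv T ξ + massDeriv M ξ := by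
      simp only [massDeriv, h1]; ring
    rw [h2, hFdef]
    ring

end LagrangianSystem

/-! ### Differential functions and their directional derivatives -/

namespace RadialFlow

noncomputable section

section LocalFunctions

variable {H H' : Type*} [NormedAddCommGroup H] [NormedSpace ℝ H] [NormedAddCommGroup H']
  [NormedSpace ℝ H']

/-- `trunc` as a continuous linear map. -/
def truncL (K : ℕ) : Jet →L[ℝ] ℝ × ℝ × (Fin (K + 1) → Fin 3 → ℝ) :=
  (ContinuousLinearMap.fst ℝ ℝ _).prod (((ContinuousLinearMap.fst ℝ ℝ _).comp
    (ContinuousLinearMap.snd ℝ ℝ _)).prod (ContinuousLinearMap.pi fun i =>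
      (ContinuousLinearMap.proj (R := ℝ) (φ := fun _ : ℕ => Fin 3 → ℝ) (i : ℕ)).comp
        ((ContinuousLinearMap.snd ℝ ℝ _).comp (ContinuousLinearMap.snd ℝ ℝ _))))

theorem truncL_apply (K : ℕ) (z : Jet) : truncL K z = trunc K z := rfl

/-- Forgetting derivatives in two steps. -/
def restrictTrunc {K K' : ℕ} (h : K ≤ K') :
    (ℝ × ℝ × (Fin (K' + 1) → Fin 3 → ℝ)) →L[ℝ] ℝ × ℝ × (Fin (K + 1) → Fin 3 → ℝ) :=
  (ContinuousLinearMap.fst ℝ ℝ _).prod (((ContinuousLinearMap.fst ℝ ℝ _).comp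
    (ContinuousLinearMap.snd ℝ ℝ _)).prod (ContinuousLinearMap.pi fun i =>
      (ContinuousLinearMap.proj (R := ℝ) (φ := fun _ : Fin (K' + 1) => Fin 3 → ℝ)
        (Fin.castLE (by omega) i)).comp
        ((ContinuousLinearMap.snd ℝ ℝ _).comp (ContinuousLinearMap.snd ℝ ℝ _))))

/-- Near the jet `z`, the function `F` is a smooth function of finitely many coordinates. As in
`IsLocalOn`, smoothness is only required at `z` itself. -/
def SmoothJetAt (F : Jet → H) (z : Jet) : Prop :=
  ∃ (K : ℕ) (g : ℝ × ℝ × (Fin (K + 1) → Fin 3 → ℝ) → H),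
    ContDiffAt ℝ ∞ g (trunc K z) ∧ ∀ᶠ y in 𝓝 z, F y = g (trunc K y)

namespace SmoothJetAt

variable {F : Jet → H} {F' : Jet → H'} {z : Jet}

theorem congr {G : Jet → H} (hF : SmoothJetAt F z) (h : ∀ᶠ y in 𝓝 z, G y = F y) :
    SmoothJetAt G z := by
  obtain ⟨K, g, hg, hFg⟩ := hF
  exact ⟨K, g, hg, by filter_upwards [h, hFg] with y h1 h2 using h1.trans h2⟩

theorem exists_of_le {K : ℕ} {g : ℝ × ℝ × (Fin (K + 1) → Fin 3 → ℝ) → H}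
    (hg : ContDiffAt ℝ ∞ g (trunc K z)) {K' : ℕ} (h : K ≤ K') :
    ContDiffAt ℝ ∞ (fun η => g (restrictTrunc h η)) (trunc K' z) :=
  ContDiffAt.comp (trunc K' z) (g := g) (f := restrictTrunc h) hg
    (restrictTrunc h).contDiff.contDiffAt

theorem comp {h : H → H'} (hh : ContDiffAt ℝ ∞ h (F z)) (hF : SmoothJetAt F z) :
    SmoothJetAt (fun y => h (F y)) z := by
  obtain ⟨K, g, hg, hFg⟩ := hF
  refine ⟨K, fun η => h (g η), ?_, by filter_upwards [hFg] with y hy using congrArg h hy⟩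
  exact ContDiffAt.comp (trunc K z) (g := h) (f := g) (hFg.self_of_nhds ▸ hh) hg

theorem prodMk (hF : SmoothJetAt F z) (hF' : SmoothJetAt F' z) :
    SmoothJetAt (fun y => (F y, F' y)) z := by
  obtain ⟨K, g, hg, hFg⟩ := hF
  obtain ⟨K', g', hg', hFg'⟩ := hF'
  refine ⟨max K K', _, (exists_of_le hg (le_max_left K K')).prodMk
    (exists_of_le hg' (le_max_right K K')), ?_⟩
  filter_upwards [hFg, hFg'] with y h1 h2
  rw [h1, h2]; rfl

theorem pi {ι : Type*} [Fintype ι] {F : Jet → ι → H} (hF : ∀ i, SmoothJetAt (fun y => F y i) z) :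
    SmoothJetAt F z := by
  choose K g hg hFg using hF
  have hK : ∀ i, K i ≤ Finset.univ.sup K := fun i => Finset.le_sup (Finset.mem_univ i)
  refine ⟨Finset.univ.sup K, fun η i => g i (restrictTrunc (hK i) η),
    contDiffAt_pi.2 fun i => exists_of_le (hg i) (hK i), ?_⟩
  filter_upwards [eventually_all.2 hFg] with y hy
  exact funext fun i => hy i

theorem const (c : H) (z : Jet) : SmoothJetAt (fun _ => c) z :=
  ⟨0, fun _ => c, contDiffAt_const, Eventually.of_forall fun _ => rfl⟩

theorem trunc (K : ℕ) (z : Jet) : SmoothJetAt (fun y => trunc K y) z :=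
  ⟨K, id, contDiffAt_id, Eventually.of_forall fun _ => rfl⟩

theorem time (z : Jet) : SmoothJetAt (fun y => y.1) z :=
  SmoothJetAt.comp (F := fun y => RadialFlow.trunc 0 y) (h := fun η =>
    η.1) contDiffAt_fst (trunc 0 z)

theorem rad (z : Jet) : SmoothJetAt rad z :=
  (trunc 0 z).comp (h := fun η => η.2.1) (contDiff_fst.comp contDiff_snd).contDiffAt

theorem coord (i : ℕ) (j : Fin 3) (z : Jet) : SmoothJetAt (fun y => y.2.2 i j) z :=
  (trunc i z).comp (h := fun η => η.2.2 (Fin.last i) j)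
    (((contDiff_apply_apply ℝ ℝ (Fin.last i) j).comp contDiff_snd).comp contDiff_snd).contDiffAt

theorem velD (i : ℕ) (z : Jet) : SmoothJetAt (velD i) z := coord i 0 z

theorem rhoD (i : ℕ) (z : Jet) : SmoothJetAt (rhoD i) z := coord i 1 z

theorem entD (i : ℕ) (z : Jet) : SmoothJetAt (entD i) z := coord i 2 z

theorem state (z : Jet) : SmoothJetAt state z := (rhoD 0 z).prodMk (entD 0 z)

section Real

variable {F G : Jet → ℝ}

theorem add (hF : SmoothJetAt F z) (hG : SmoothJetAt G z) : SmoothJetAt (fun y => F y + G y) z :=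
  (hF.prodMk hG).comp (h := fun q => q.1 + q.2) (contDiff_fst.add contDiff_snd).contDiffAt

theorem sub (hF : SmoothJetAt F z) (hG : SmoothJetAt G z) : SmoothJetAt (fun y => F y - G y) z :=
  (hF.prodMk hG).comp (h := fun q => q.1 - q.2) (contDiff_fst.sub contDiff_snd).contDiffAt

theorem mul (hF : SmoothJetAt F z) (hG : SmoothJetAt G z) : SmoothJetAt (fun y => F y * G y) z :=
  (hF.prodMk hG).comp (h := fun q => q.1 * q.2) (contDiff_fst.mul contDiff_snd).contDiffAt

theorem neg (hF : SmoothJetAt F z) : SmoothJetAt (fun y => -F y) z :=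
  hF.comp (h := fun a => -a) contDiff_neg.contDiffAt

theorem pow (hF : SmoothJetAt F z) (m : ℕ) : SmoothJetAt (fun y => F y ^ m) z :=
  hF.comp (h := fun a => a ^ m) (contDiff_id.pow m).contDiffAt

theorem inv (hF : SmoothJetAt F z) (h0 : F z ≠ 0) : SmoothJetAt (fun y => (F y)⁻¹) z :=
  hF.comp (h := fun a => a⁻¹) (contDiffAt_inv ℝ h0)

theorem div (hF : SmoothJetAt F z) (hG : SmoothJetAt G z) (h0 : G z ≠ 0) :
    SmoothJetAt (fun y => F y / G y) z := by
  simpa only [div_eq_mul_inv] using hF.mul (hG.inv h0)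

end Real

/-- Near `z`, a differential function is differentiable in all directions, by the chain rule. -/
theorem eventually_hasLineDerivAt {K : ℕ} {g : ℝ × ℝ × (Fin (K + 1) → Fin 3 → ℝ) → H}
    (hg : ContDiffAt ℝ ∞ g (RadialFlow.trunc K z)) (hFg : ∀ᶠ y in 𝓝 z,
      F y = g (RadialFlow.trunc K y)) :
    ∀ᶠ y in 𝓝 z, ∀ v, HasLineDerivAt ℝ F (fderiv ℝ g (RadialFlow.trunc K y)
      (RadialFlow.trunc K v)) y v := by
  have h1 : ∀ᶠ η in 𝓝 (RadialFlow.trunc K z), DifferentiableAt ℝ g η := by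
    filter_upwards [(hg.of_le (m := 1) (by simp)).eventually (by simp)] with η hη
      using hη.differentiableAt (by simp)
  have hc : Tendsto (truncL K) (𝓝 z) (𝓝 (RadialFlow.trunc K z)) := (truncL K).continuous.tendsto z
  filter_upwards [hc.eventually h1, hFg.eventually_nhds] with y hy1 hy2 v
  have h2 : HasLineDerivAt ℝ (fun y => g (truncL K y)) (fderiv ℝ g (RadialFlow.trunc K y)
    (RadialFlow.trunc K v)) y v := by
    have h3 : HasDerivAt (fun s : ℝ => truncL K (y + s • v)) (truncL K v) 0 := by
      have : (fun s : ℝ => truncL K (y + s • v)) = fun s => truncL K y + s • truncL K v := by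
        funext s; simp
      rw [this]
      simpa using ((hasDerivAt_id (0 : ℝ)).smul_const (truncL K v)).const_add (truncL K y)
    have h4 : HasFDerivAt g (fderiv ℝ g (RadialFlow.trunc K y)) (truncL K (y + (0 : ℝ) • v)) := by
      simpa [truncL_apply] using hy1.hasFDerivAt
    exact h4.comp_hasDerivAt (0 : ℝ) h3
  have hline : Tendsto (fun s : ℝ => y + s • v) (𝓝 0) (𝓝 y) := by
    have : Continuous fun s : ℝ => y + s • v := by fun_prop
    simpa using this.tendsto 0
  have h5 : (fun s : ℝ => F (y + s • v)) =ᶠ[𝓝 0] fun s => g (truncL K (y + s • v)) :=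
    hline.eventually hy2
  exact HasDerivAt.congr_of_eventuallyEq h2 h5

/-- The derivative in the direction `v` is linear in `v`. -/
theorem exists_linearMap (hF : SmoothJetAt F z) :
    ∃ L : Jet →ₗ[ℝ] H, ∀ v, HasLineDerivAt ℝ F (L v) z v := by
  obtain ⟨K, g, hg, hFg⟩ := hF
  exact ⟨((fderiv ℝ g (RadialFlow.trunc K z)).comp (truncL K)).toLinearMap,
    (eventually_hasLineDerivAt hg hFg).self_of_nhds⟩

theorem hasLineDerivAt (hF : SmoothJetAt F z) (v : Jet) :
    HasLineDerivAt ℝ F (lineDeriv ℝ F z v) z v := by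
  obtain ⟨L, hL⟩ := hF.exists_linearMap
  rw [(hL v).lineDeriv]; exact hL v

theorem lineDeriv_add (hF : SmoothJetAt F z) (v w : Jet) :
    lineDeriv ℝ F z (v + w) = lineDeriv ℝ F z v + lineDeriv ℝ F z w := by
  obtain ⟨L, hL⟩ := hF.exists_linearMap
  rw [(hL _).lineDeriv, (hL _).lineDeriv, (hL _).lineDeriv, map_add]

theorem lineDeriv_comp {h : H → H'} (hh : DifferentiableAt ℝ h (F z)) (hF : SmoothJetAt F z)
    (v : Jet) : lineDeriv ℝ (fun y => h (F y)) z v = fderiv ℝ h (F z) (lineDeriv ℝ F z v) := by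
  refine HasLineDerivAt.lineDeriv ?_
  have h1 : HasFDerivAt h (fderiv ℝ h (F z)) (F (z + (0 : ℝ) • v)) := by
    simpa using hh.hasFDerivAt
  exact h1.comp_hasDerivAt (0 : ℝ) (hF.hasLineDerivAt v)

theorem lineDeriv_pi {ι : Type*} [Fintype ι] {F : Jet → ι → ℝ}
    (hF : ∀ i, SmoothJetAt (fun y => F y i) z) (v : Jet) :
    lineDeriv ℝ F z v = fun i => lineDeriv ℝ (fun y => F y i) z v :=
  HasLineDerivAt.lineDeriv (hasDerivAt_pi.2 fun i => (hF i).hasLineDerivAt v)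

theorem lineDeriv_prodMk (hF : SmoothJetAt F z) (hF' : SmoothJetAt F' z) (v : Jet) :
    lineDeriv ℝ (fun y => (F y, F' y)) z v = (lineDeriv ℝ F z v, lineDeriv ℝ F' z v) :=
  HasLineDerivAt.lineDeriv (HasDerivAt.prodMk (hF.hasLineDerivAt v) (hF'.hasLineDerivAt v))

theorem lineDeriv_fun_add {F G : Jet → ℝ} (hF : SmoothJetAt F z) (hG : SmoothJetAt G z) (v : Jet) :
    lineDeriv ℝ (fun y => F y + G y) z v = lineDeriv ℝ F z v + lineDeriv ℝ G z v :=
  HasLineDerivAt.lineDeriv (HasDerivAt.add (hF.hasLineDerivAt v) (hG.hasLineDerivAt v))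

theorem lineDeriv_fun_sub {F G : Jet → ℝ} (hF : SmoothJetAt F z) (hG : SmoothJetAt G z) (v : Jet) :
    lineDeriv ℝ (fun y => F y - G y) z v = lineDeriv ℝ F z v - lineDeriv ℝ G z v :=
  HasLineDerivAt.lineDeriv (HasDerivAt.sub (hF.hasLineDerivAt v) (hG.hasLineDerivAt v))

theorem lineDeriv_fun_neg {F : Jet → ℝ} (hF : SmoothJetAt F z) (v : Jet) :
    lineDeriv ℝ (fun y => -F y) z v = -lineDeriv ℝ F z v :=
  HasLineDerivAt.lineDeriv (HasDerivAt.neg (hF.hasLineDerivAt v))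

theorem lineDeriv_fun_mul {F G : Jet → ℝ} (hF : SmoothJetAt F z) (hG : SmoothJetAt G z) (v : Jet) :
    lineDeriv ℝ (fun y => F y * G y) z v = lineDeriv ℝ F z v * G z + F z * lineDeriv ℝ G z v := by
  have h := HasDerivAt.mul (hF.hasLineDerivAt v) (hG.hasLineDerivAt v)
  simp only [zero_smul, add_zero] at h
  exact HasLineDerivAt.lineDeriv h

/-- A differential function is differentiated along a vector field with smooth components. -/
theorem lineDeriv (hF : SmoothJetAt F z) {V : Jet → Jet}
    (hV : ∀ K, SmoothJetAt (fun y => RadialFlow.trunc K (V y)) z) :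
    SmoothJetAt (fun y => lineDeriv ℝ F y (V y)) z := by
  obtain ⟨K, g, hg, hFg⟩ := hF
  have h1 : SmoothJetAt (fun y => (RadialFlow.trunc K y, RadialFlow.trunc K (V y))) z :=
    (trunc K z).prodMk (hV K)
  refine (h1.comp (h := fun q => fderiv ℝ g q.1 q.2) ?_).congr ?_
  · exact ((hg.fderiv_right (m := ∞) (by simp)).comp
      (RadialFlow.trunc K z, RadialFlow.trunc K (V z)) contDiffAt_fst).clm_apply contDiffAt_snd
  · filter_upwards [eventually_hasLineDerivAt hg hFg] with y hy using (hy _).lineDeriv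

/-- The derivative of the derivative along a vector field: the mixed second derivative, which is
symmetric, and the derivative of the field. -/
theorem lineDeriv_lineDeriv (hF : SmoothJetAt F z) {V : Jet → Jet} {v w : Jet}
    (hV : ∀ K, HasLineDerivAt ℝ (fun y => RadialFlow.trunc K (V y)) (RadialFlow.trunc K w) z v) :
    _root_.lineDeriv ℝ (fun y => _root_.lineDeriv ℝ F y (V y)) z v =
      _root_.lineDeriv ℝ (fun y => _root_.lineDeriv ℝ F y v) z (V z) +
        _root_.lineDeriv ℝ F z w := by
  obtain ⟨K, g, hg, hFg⟩ := hF
  have hev := eventually_hasLineDerivAt hg hFg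
  have hd : HasFDerivAt (fderiv ℝ g) (fderiv ℝ (fderiv ℝ g) (RadialFlow.trunc K z))
    (RadialFlow.trunc K z) :=
    ((hg.fderiv_right (m := ∞) (by simp)).differentiableAt (by simp)).hasFDerivAt
  have hline : ∀ v : Jet, Tendsto (fun s : ℝ => z + s • v) (𝓝 0) (𝓝 z) := by
    intro v
    have : Continuous fun s : ℝ => z + s • v := by fun_prop
    simpa using this.tendsto 0
  have hτ : ∀ v : Jet, HasDerivAt (fun s : ℝ => RadialFlow.trunc K (z + s • v))
    (RadialFlow.trunc K v) 0 := by
    intro v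
    have : (fun s : ℝ => RadialFlow.trunc K (z + s • v)) = fun s =>
      truncL K z + s • truncL K v := by
      funext s; rw [← truncL_apply]; simp
    rw [this, ← truncL_apply]
    simpa using ((hasDerivAt_id (0 : ℝ)).smul_const (truncL K v)).const_add (truncL K z)
  have hd' : ∀ v : Jet, HasDerivAt (fun s : ℝ => fderiv ℝ g (RadialFlow.trunc K (z + s • v)))
      (fderiv ℝ (fderiv ℝ g) (RadialFlow.trunc K z) (RadialFlow.trunc K v)) 0 := by
    intro v
    have h0 : HasFDerivAt (fderiv ℝ g) (fderiv ℝ (fderiv ℝ g) (RadialFlow.trunc K z))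
        (RadialFlow.trunc K (z + (0 : ℝ) • v)) := by simpa using hd
    exact h0.comp_hasDerivAt (0 : ℝ) (hτ v)
  have key : ∀ {V : Jet → Jet} {v w : Jet}
      (_ : ∀ K, HasLineDerivAt ℝ (fun y => RadialFlow.trunc K (V y)) (RadialFlow.trunc K w) z v),
      _root_.lineDeriv ℝ (fun y => _root_.lineDeriv ℝ F y (V y)) z v =
        fderiv ℝ (fderiv ℝ g) (RadialFlow.trunc K z) (RadialFlow.trunc K v) (RadialFlow.trunc K
          (V z))
        + fderiv ℝ g (RadialFlow.trunc K z) (RadialFlow.trunc K w) := by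
    intro V v w hV
    refine HasLineDerivAt.lineDeriv ?_
    have h1 := (hd' v).clm_apply (hV K)
    simp only [zero_smul, add_zero] at h1
    refine HasDerivAt.congr_of_eventuallyEq h1 ?_
    filter_upwards [(hline v).eventually hev] with s hs using (hs _).lineDeriv
  have h0 : RadialFlow.trunc K (0 : Jet) = 0 := map_zero (truncL K)
  have key2 := key (V := fun _ => v) (v := V z) (w := 0) fun K => by
    have : RadialFlow.trunc K (0 : Jet) = 0 := map_zero (truncL K)
    rw [this]; exact hasDerivAt_const _ _
  rw [key hV, key2, h0, map_zero, add_zero, hev.self_of_nhds w |>.lineDeriv]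
  congr 1
  exact (hg.isSymmSndFDerivAt (by
    rw [minSmoothness_of_isRCLikeNormedField]; exact WithTop.coe_le_coe.2 le_top)) _ _

end SmoothJetAt

end LocalFunctions

end

end RadialFlow

/-! ### Total derivatives, the material derivative and the mass coordinate -/

namespace RadialFlow

noncomputable section

/-- The jet is one of a fluid of non-zero density away from the origin, in a state near which the
equation of state is smooth. -/
structure IsRegular (p : ℝ × ℝ → ℝ) (z : Jet) : Prop where
  rad_ne : rad z ≠ 0
  rho_ne : rhoD 0 z ≠ 0
  smooth : ContDiffAt ℝ ∞ p (state z)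

/-- The direction of the total radial derivative. -/
def radDir (z : Jet) : Jet := (0, 1, fun i => z.2.2 (i + 1))

/-- The direction of the total time derivative on solutions. -/
def eulerDir (n : ℕ) (p : ℝ × ℝ → ℝ) (z : Jet) : Jet :=
  (1, 0, fun i j => (Dr^[i] (eulerRHS n p j)) z)

/-- The direction of the material derivative `D_t + U D_r`. -/
def matDir (n : ℕ) (p : ℝ × ℝ → ℝ) (z : Jet) : Jet := eulerDir n p z + velD 0 z • radDir z

theorem Dr_eq (F : Jet → ℝ) (z : Jet) : Dr F z = lineDeriv ℝ F z (radDir z) := rfl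

theorem Dt_eq (n : ℕ) (p : ℝ × ℝ → ℝ) (F : Jet → ℝ) (z : Jet) :
    Dt n p F z = lineDeriv ℝ F z (eulerDir n p z) := rfl

theorem hasLineDerivAt_time (z v : Jet) : HasLineDerivAt ℝ (fun y : Jet => y.1) v.1 z v := by
  have : HasDerivAt (fun s : ℝ => z.1 + s * v.1) v.1 0 := by
    simpa using ((hasDerivAt_id (0 : ℝ)).mul_const v.1).const_add z.1
  exact this

theorem hasLineDerivAt_rad (z v : Jet) : HasLineDerivAt ℝ rad v.2.1 z v := by
  have : HasDerivAt (fun s : ℝ => z.2.1 + s * v.2.1) v.2.1 0 := by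
    simpa using ((hasDerivAt_id (0 : ℝ)).mul_const v.2.1).const_add z.2.1
  exact this

theorem hasLineDerivAt_coord (i : ℕ) (j : Fin 3) (z v : Jet) :
    HasLineDerivAt ℝ (fun y : Jet => y.2.2 i j) (v.2.2 i j) z v := by
  have : HasDerivAt (fun s : ℝ => z.2.2 i j + s * v.2.2 i j) (v.2.2 i j) 0 := by
    simpa using ((hasDerivAt_id (0 : ℝ)).mul_const (v.2.2 i j)).const_add (z.2.2 i j)
  exact this

theorem smoothJetAt_radDir (K : ℕ) (z : Jet) : SmoothJetAt (fun y => trunc K (radDir y)) z :=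
  (SmoothJetAt.const 0 z).prodMk ((SmoothJetAt.const 1 z).prodMk
    (SmoothJetAt.pi fun i => SmoothJetAt.pi fun j => SmoothJetAt.coord (i + 1) j z))

theorem SmoothJetAt.Dr {F : Jet → ℝ} {z : Jet} (hF : SmoothJetAt F z) : SmoothJetAt (Dr F) z :=
  hF.lineDeriv fun K => smoothJetAt_radDir K z

theorem pRho_eq {p : ℝ × ℝ → ℝ} {x : ℝ × ℝ} (h : DifferentiableAt ℝ p x) :
    pRho p x = fderiv ℝ p x (1, 0) := by
  have h1 : HasDerivAt (fun a : ℝ => (a, x.2)) ((1 : ℝ), (0 : ℝ)) x.1 :=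
    (hasDerivAt_id x.1).prodMk (hasDerivAt_const x.1 x.2)
  exact (h.hasFDerivAt.comp_hasDerivAt x.1 h1).deriv

theorem pEnt_eq {p : ℝ × ℝ → ℝ} {x : ℝ × ℝ} (h : DifferentiableAt ℝ p x) :
    pEnt p x = fderiv ℝ p x (0, 1) := by
  have h1 : HasDerivAt (fun b : ℝ => (x.1, b)) ((0 : ℝ), (1 : ℝ)) x.2 :=
    (hasDerivAt_const x.2 x.1).prodMk (hasDerivAt_id x.2)
  exact (h.hasFDerivAt.comp_hasDerivAt x.2 h1).deriv

theorem contDiffAt_pRho {p : ℝ × ℝ → ℝ} {x : ℝ × ℝ} (h : ContDiffAt ℝ ∞ p x) :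
    ContDiffAt ℝ ∞ (pRho p) x := by
  refine ((h.fderiv_right (m := ∞) (by simp)).clm_apply
    (contDiffAt_const (c := ((1 : ℝ), (0 : ℝ))))).congr_of_eventuallyEq ?_
  filter_upwards [(h.of_le (m := 1) (by simp)).eventually (by simp)] with y hy
    using pRho_eq (hy.differentiableAt (by simp))

theorem contDiffAt_pEnt {p : ℝ × ℝ → ℝ} {x : ℝ × ℝ} (h : ContDiffAt ℝ ∞ p x) :
    ContDiffAt ℝ ∞ (pEnt p) x := by
  refine ((h.fderiv_right (m := ∞) (by simp)).clm_apply
    (contDiffAt_const (c := ((0 : ℝ), (1 : ℝ))))).congr_of_eventuallyEq ?_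
  filter_upwards [(h.of_le (m := 1) (by simp)).eventually (by simp)] with y hy
    using pEnt_eq (hy.differentiableAt (by simp))

namespace IsRegular

variable {n : ℕ} {p : ℝ × ℝ → ℝ} {z : Jet}

theorem smoothJetAt_eulerRHS (hz : IsRegular p z) (n : ℕ) (j : Fin 3) :
    SmoothJetAt (eulerRHS n p j) z := by
  have hU := SmoothJetAt.velD 0 z
  have hU1 := SmoothJetAt.velD 1 z
  have hρ := SmoothJetAt.rhoD 0 z
  have hρ1 := SmoothJetAt.rhoD 1 z
  have hS1 := SmoothJetAt.entD 1 z
  have hpρ := (SmoothJetAt.state z).comp (h := pRho p) (contDiffAt_pRho hz.smooth)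
  have hpS := (SmoothJetAt.state z).comp (h := pEnt p) (contDiffAt_pEnt hz.smooth)
  fin_cases j
  · exact ((hU.mul hU1).add (((hpS.mul hS1).add (hpρ.mul hρ1)).div hρ hz.rho_ne)).neg
  · exact (((hU1.mul hρ).add (hU.mul hρ1)).add
      (((SmoothJetAt.const ((n : ℝ) - 1) z).div (SmoothJetAt.rad z) hz.rad_ne).mul
        (hU.mul hρ))).neg
  · exact (hU.mul hS1).neg

theorem smoothJetAt_iterate (hz : IsRegular p z) (n : ℕ) (i : ℕ) (j : Fin 3) :
    SmoothJetAt (RadialFlow.Dr^[i] (eulerRHS n p j)) z := by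
  induction i with
  | zero => exact hz.smoothJetAt_eulerRHS n j
  | succ i ih =>
    rw [Function.iterate_succ_apply']
    exact ih.Dr

theorem smoothJetAt_eulerDir (hz : IsRegular p z) (n K : ℕ) :
    SmoothJetAt (fun y => trunc K (eulerDir n p y)) z :=
  (SmoothJetAt.const 1 z).prodMk ((SmoothJetAt.const 0 z).prodMk
    (SmoothJetAt.pi fun i => SmoothJetAt.pi fun j => hz.smoothJetAt_iterate n i j))

theorem Dt (hz : IsRegular p z) (n : ℕ) {F : Jet → ℝ} (hF : SmoothJetAt F z) :
    SmoothJetAt (Dt n p F) z :=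
  hF.lineDeriv fun K => hz.smoothJetAt_eulerDir n K

/-- The total derivatives commute on solutions: `D_t` was prolonged by `∂_r^i u_t = D_r^i u_t`. -/
theorem Dt_Dr (hz : IsRegular p z) (n : ℕ) {F : Jet → ℝ} (hF : SmoothJetAt F z) :
    RadialFlow.Dt n p (Dr F) z = Dr (RadialFlow.Dt n p F) z := by
  let w : Jet := (0, 0, fun i j => (RadialFlow.Dr^[i + 1] (eulerRHS n p j)) z)
  have h1 := hF.lineDeriv_lineDeriv (V := radDir) (v := eulerDir n p z) (w := w) fun K =>
    (hasDerivAt_const _ _).prodMk ((hasDerivAt_const _ _).prodMk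
      (hasDerivAt_pi.2 fun i => hasDerivAt_pi.2 fun j => hasLineDerivAt_coord (i + 1) j z _))
  have h2 := hF.lineDeriv_lineDeriv (V := eulerDir n p) (v := radDir z) (w := w) fun K =>
    (hasDerivAt_const _ _).prodMk ((hasDerivAt_const _ _).prodMk
      (hasDerivAt_pi.2 fun i => hasDerivAt_pi.2 fun j => by
        have h := (hz.smoothJetAt_iterate n i j).hasLineDerivAt (radDir z)
        rw [← Dr_eq, ← Function.iterate_succ_apply' RadialFlow.Dr] at h
        exact h))
  have h3 := hF.lineDeriv_lineDeriv (V := fun _ => eulerDir n p z) (v := radDir z) (w := 0) fun K =>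
    (by
      have h0 : trunc K (0 : Jet) = 0 := map_zero (truncL K)
      rw [h0]; exact hasDerivAt_const _ _)
  have h4 : lineDeriv ℝ F z 0 = 0 := lineDeriv_zero
  rw [h4, add_zero] at h3
  exact (h1.trans (by rw [h3])).trans h2.symm

end IsRegular

/-- The material derivative `D_t + U D_r` on solutions. -/
def matDeriv {H : Type*} [NormedAddCommGroup H] [NormedSpace ℝ H] (n : ℕ) (p : ℝ × ℝ → ℝ)
    (F : Jet → H) (z : Jet) : H :=
  lineDeriv ℝ F z (matDir n p z)

theorem matDeriv_eq {n : ℕ} {p : ℝ × ℝ → ℝ} {F : Jet → ℝ} {z : Jet} (hF : SmoothJetAt F z) :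
    matDeriv n p F z = Dt n p F z + velD 0 z * Dr F z := by
  rw [matDeriv, matDir, hF.lineDeriv_add, lineDeriv_smul]
  rfl

theorem tendsto_line (z v : Jet) : Tendsto (fun s : ℝ => z + s • v) (𝓝 0) (𝓝 z) := by
  have : Continuous fun s : ℝ => z + s • v := by fun_prop
  simpa using this.tendsto 0

theorem lineDeriv_congr {H : Type*} [NormedAddCommGroup H] [NormedSpace ℝ H] {F G : Jet → H}
    {z : Jet} (h : ∀ᶠ y in 𝓝 z, F y = G y) (v : Jet) : lineDeriv ℝ F z v = lineDeriv ℝ G z v :=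
  Filter.EventuallyEq.deriv_eq ((tendsto_line z v).eventually h)

theorem lineDeriv_const {H : Type*} [NormedAddCommGroup H] [NormedSpace ℝ H] (c : H) (z v : Jet) :
    lineDeriv ℝ (fun _ : Jet => c) z v = 0 := deriv_const _ _

theorem IsRegular.matDeriv {p : ℝ × ℝ → ℝ} {z : Jet} (hz : IsRegular p z) (n : ℕ) {F : Jet → ℝ}
    (hF : SmoothJetAt F z) : SmoothJetAt (matDeriv n p F) z := by
  obtain ⟨K, g, hg, hFg⟩ := id hF
  refine ((hz.Dt n hF).add ((SmoothJetAt.velD 0 z).mul hF.Dr)).congr ?_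
  filter_upwards [SmoothJetAt.eventually_hasLineDerivAt hg hFg] with y hy
  rw [RadialFlow.matDeriv, (hy _).lineDeriv, Dt_eq, Dr_eq, (hy _).lineDeriv, (hy _).lineDeriv]
  simp only [← truncL_apply]
  rw [matDir, map_add, map_smul, map_add, map_smul, smul_eq_mul]

theorem matDeriv_time (n : ℕ) (p : ℝ × ℝ → ℝ) (z : Jet) : matDeriv n p (fun y => y.1) z = 1 := by
  rw [matDeriv, (hasLineDerivAt_time z _).lineDeriv]
  simp [matDir, eulerDir, radDir]

theorem matDeriv_rad (n : ℕ) (p : ℝ × ℝ → ℝ) (z : Jet) : matDeriv n p rad z = velD 0 z := by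
  rw [matDeriv, (hasLineDerivAt_rad z _).lineDeriv]
  simp [matDir, eulerDir, radDir]

theorem matDeriv_entD (n : ℕ) (p : ℝ × ℝ → ℝ) (z : Jet) : matDeriv n p (entD 0) z = 0 := by
  rw [matDeriv]
  refine (hasLineDerivAt_coord 0 2 z _).lineDeriv.trans ?_
  simp [matDir, eulerDir, radDir, eulerRHS, entD]

theorem matDeriv_velD (n : ℕ) (p : ℝ × ℝ → ℝ) (z : Jet) : matDeriv n p (velD 0) z =
    -((pEnt p (state z) * entD 1 z + pRho p (state z) * rhoD 1 z) / rhoD 0 z) := by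
  rw [matDeriv]
  refine (hasLineDerivAt_coord 0 0 z _).lineDeriv.trans ?_
  simp [matDir, eulerDir, radDir, eulerRHS, velD]

/-- The specific volume `1 / (ρ r^N)` with respect to the Lagrangian mass coordinate `m`, so that
`∂_m = v D_r`. -/
def specVol (N : ℕ) (z : Jet) : ℝ := (rhoD 0 z * rad z ^ N)⁻¹

variable {N : ℕ} {p : ℝ × ℝ → ℝ} {z : Jet}

theorem specVol_ne (hr : rad z ≠ 0) (hρ : rhoD 0 z ≠ 0) : specVol N z ≠ 0 :=
  inv_ne_zero (mul_ne_zero hρ (pow_ne_zero _ hr))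

theorem smoothJetAt_specVol (hr : rad z ≠ 0) (hρ : rhoD 0 z ≠ 0) : SmoothJetAt (specVol N) z :=
  ((SmoothJetAt.rhoD 0 z).mul ((SmoothJetAt.rad z).pow N)).inv (mul_ne_zero hρ (pow_ne_zero _ hr))

theorem natCast_mul_pow_pred (N : ℕ) {x : ℝ} (hx : x ≠ 0) :
    (N : ℝ) * x ^ (N - 1) = N * x ^ N / x := by
  rcases N with _ | m
  · simp
  · simp [pow_succ]; field_simp

theorem hasLineDerivAt_specVol (hr : rad z ≠ 0) (hρ : rhoD 0 z ≠ 0) (u : Jet) :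
    HasLineDerivAt ℝ (specVol N)
      (-(specVol N z * (u.2.2 0 1 / rhoD 0 z + N * u.2.1 / rad z))) z u := by
  have h1 : HasDerivAt (fun s : ℝ => rhoD 0 (z + s • u)) (u.2.2 0 1) 0 :=
    hasLineDerivAt_coord 0 1 z u
  have h2 : HasDerivAt (fun s : ℝ => rad (z + s • u)) u.2.1 0 := hasLineDerivAt_rad z u
  have h := (h1.mul (h2.pow N)).inv (by simpa using ⟨hρ, fun h => absurd h hr⟩)
  refine HasDerivAt.congr_deriv h ?_
  simp only [zero_smul, add_zero, Pi.mul_apply, Pi.pow_apply, natCast_mul_pow_pred N hr, specVol]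
  have := pow_ne_zero N hr
  field_simp

theorem matDeriv_specVol (hr : rad z ≠ 0) (hρ : rhoD 0 z ≠ 0) :
    matDeriv (N + 1) p (specVol N) z = specVol N z * velD 1 z := by
  rw [matDeriv, (hasLineDerivAt_specVol hr hρ _).lineDeriv]
  simp only [matDir, eulerDir, radDir, eulerRHS, Prod.snd_add, Prod.fst_add, Pi.add_apply,
    Prod.smul_snd, Prod.smul_fst, Pi.smul_apply, Function.iterate_zero, id, smul_eq_mul,
    Matrix.cons_val_one, Matrix.cons_val_zero]
  simp only [rhoD, velD, rad] at *
  push_cast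
  field_simp
  ring

/-- The derivative `∂_m = v D_r` with respect to the Lagrangian mass coordinate. -/
def Dm (N : ℕ) (F : Jet → ℝ) (z : Jet) : ℝ := specVol N z * Dr F z

theorem SmoothJetAt.Dm {F : Jet → ℝ} (hr : RadialFlow.rad z ≠ 0) (hρ : RadialFlow.rhoD 0 z ≠ 0)
    (hF : SmoothJetAt F z) : SmoothJetAt (Dm N F) z :=
  (smoothJetAt_specVol hr hρ).mul hF.Dr

theorem Dm_congr {F G : Jet → ℝ} (h : ∀ᶠ y in 𝓝 z, F y = G y) : Dm N F z = Dm N G z := by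
  rw [Dm, Dm, Dr_eq, Dr_eq, lineDeriv_congr h]

theorem matDeriv_congr {n : ℕ} {F G : Jet → ℝ} (h : ∀ᶠ y in 𝓝 z, F y = G y) :
    matDeriv n p F z = matDeriv n p G z := lineDeriv_congr h _

/-- The material derivative commutes with `∂_m`. -/
theorem IsRegular.matDeriv_Dm (hz : IsRegular p z) {F : Jet → ℝ} (hF : SmoothJetAt F z) :
    RadialFlow.matDeriv (N + 1) p (Dm N F) z = Dm N (RadialFlow.matDeriv (N + 1) p F) z := by
  have hU := SmoothJetAt.velD 0 z
  have hv := smoothJetAt_specVol (N := N) hz.rad_ne hz.rho_ne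
  have h1 : RadialFlow.matDeriv (N + 1) p (Dm N F) z =
      RadialFlow.matDeriv (N + 1) p (specVol N) z * Dr F z
        + specVol N z * RadialFlow.matDeriv (N + 1) p (Dr F) z := hv.lineDeriv_fun_mul hF.Dr _
  have hUr : Dr (velD 0) z = velD 1 z := (hasLineDerivAt_coord 0 0 z _).lineDeriv
  have h2 : Dr (RadialFlow.matDeriv (N + 1) p F) z =
      Dr (RadialFlow.Dt (N + 1) p F) z + (velD 1 z * Dr F z + velD 0 z * Dr (Dr F) z) := by
    obtain ⟨K, g, hg, hFg⟩ := id hF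
    have : ∀ᶠ y in 𝓝 z, RadialFlow.matDeriv (N + 1) p F y =
        RadialFlow.Dt (N + 1) p F y + velD 0 y * Dr F y := by
      filter_upwards [SmoothJetAt.eventually_hasLineDerivAt hg hFg] with y hy
      rw [RadialFlow.matDeriv, (hy _).lineDeriv, Dt_eq, Dr_eq, (hy _).lineDeriv, (hy _).lineDeriv]
      simp only [← truncL_apply]
      rw [matDir, map_add, map_smul, map_add, map_smul, smul_eq_mul]
    rw [Dr_eq, lineDeriv_congr this, (hz.Dt (N + 1) hF).lineDeriv_fun_add (hU.mul hF.Dr),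
      hU.lineDeriv_fun_mul hF.Dr, ← Dr_eq, ← Dr_eq, ← Dr_eq, hUr]
  rw [h1, matDeriv_specVol hz.rad_ne hz.rho_ne, matDeriv_eq hF.Dr, hz.Dt_Dr (N + 1) hF, Dm, h2]
  ring

/-- Conservation of mass: the Eulerian balance of `ρ F`, advected with the fluid, is `ρ` times the
material derivative of `F`. -/
theorem Dt_add_radDiv {F : Jet → ℝ} (hF : SmoothJetAt F z) :
    RadialFlow.Dt (N + 1) p (fun y => rhoD 0 y * F y) z
      + radDiv (N + 1) (fun y => velD 0 y * (rhoD 0 y * F y)) z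
      = rhoD 0 z * RadialFlow.matDeriv (N + 1) p F z := by
  have hU := SmoothJetAt.velD 0 z
  have hρ := SmoothJetAt.rhoD 0 z
  have hUr : lineDeriv ℝ (velD 0) z (radDir z) = velD 1 z :=
    (hasLineDerivAt_coord 0 0 z _).lineDeriv
  have hρr : lineDeriv ℝ (rhoD 0) z (radDir z) = rhoD 1 z :=
    (hasLineDerivAt_coord 0 1 z _).lineDeriv
  have hρt : lineDeriv ℝ (rhoD 0) z (eulerDir (N + 1) p z) =
      -((velD 1 z * rhoD 0 z + velD 0 z * rhoD 1 z) + N / rad z * (velD 0 z * rhoD 0 z)) := by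
    refine (hasLineDerivAt_coord 0 1 z _).lineDeriv.trans ?_
    simp [eulerDir, eulerRHS]
  rw [Dt_eq, radDiv, Dr_eq, hρ.lineDeriv_fun_mul hF, hU.lineDeriv_fun_mul (hρ.mul hF),
    hρ.lineDeriv_fun_mul hF, hUr, hρr, hρt, matDeriv_eq hF, Dt_eq, Dr_eq]
  push_cast
  ring

/-- A trivial density is `ρ ∂_m Q`. -/
theorem radDiv_inv_pow_mul (hr : rad z ≠ 0) (hρ : rhoD 0 z ≠ 0) {Q : Jet → ℝ}
    (hQ : SmoothJetAt Q z) :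
    radDiv (N + 1) (fun y => (rad y ^ N)⁻¹ * Q y) z = rhoD 0 z * Dm N Q z := by
  have h1 : HasLineDerivAt ℝ (fun y => (rad y ^ N)⁻¹) (-(N / rad z * (rad z ^ N)⁻¹)) z
    (radDir z) := by
    have h2 : HasDerivAt (fun s : ℝ => rad (z + s • radDir z)) 1 0 := hasLineDerivAt_rad z _
    have h := (h2.pow N).inv (by simpa using fun h => absurd h hr)
    refine HasDerivAt.congr_deriv h ?_
    simp only [zero_smul, add_zero, Pi.pow_apply, natCast_mul_pow_pred N hr]
    have := pow_ne_zero N hr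
    field_simp
  have hs : SmoothJetAt (fun y => (rad y ^ N)⁻¹) z :=
    ((SmoothJetAt.rad z).pow N).inv (pow_ne_zero N hr)
  rw [radDiv, Dr_eq, hs.lineDeriv_fun_mul hQ, h1.lineDeriv, Dm, specVol, Dr_eq]
  have := pow_ne_zero N hr
  push_cast
  field_simp
  ring

end

end RadialFlow

/-! ### Lagrangian coordinates of a jet -/

namespace RadialFlow

noncomputable section

/-- The equation of state in the Lagrangian coordinates `(x, S, v, …)`, where `ρ = 1 / (x^N v)`. -/
def lagrPressure (N : ℕ) (p : ℝ × ℝ → ℝ) (ξ : Fin 7 → ℝ) : ℝ := p ((ξ 0 ^ N * ξ 2)⁻¹, ξ 1)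

/-- The Lagrangian coordinates `(x, S, v, U, ∂_m S, ∂_m v, ∂_m U)` of a jet. -/
def lagr (N : ℕ) (z : Jet) : Fin 7 → ℝ :=
  ![rad z, entD 0 z, specVol N z, velD 0 z, specVol N z * entD 1 z,
    -(specVol N z ^ 2 * (rhoD 1 z / rhoD 0 z + N / rad z)), specVol N z * velD 1 z]

/-- The derivatives `∂_m` of the Lagrangian coordinates. -/
def lagrDm (N : ℕ) (z : Jet) : Fin 7 → ℝ :=
  ![lagr N z 2, lagr N z 4, lagr N z 5, lagr N z 6,
    specVol N z ^ 2 * (entD 2 z - (rhoD 1 z / rhoD 0 z + N / rad z) * entD 1 z),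
    specVol N z ^ 3 * (2 * (rhoD 1 z / rhoD 0 z + N / rad z) ^ 2
      - (rhoD 2 z / rhoD 0 z - rhoD 1 z ^ 2 / rhoD 0 z ^ 2 - N / rad z ^ 2)),
    specVol N z ^ 2 * (velD 2 z - (rhoD 1 z / rhoD 0 z + N / rad z) * velD 1 z)]

section Pressure

variable {N : ℕ} {p : ℝ × ℝ → ℝ} {ξ : Fin 7 → ℝ}

theorem contDiffAt_lagrPressure (h0 : ξ 0 ≠ 0) (h2 : ξ 2 ≠ 0)
    (hp : ContDiffAt ℝ ∞ p ((ξ 0 ^ N * ξ 2)⁻¹, ξ 1)) : ContDiffAt ℝ ∞ (lagrPressure N p) ξ :=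
  ContDiffAt.comp (f := fun ξ : Fin 7 → ℝ => ((ξ 0 ^ N * ξ 2)⁻¹, ξ 1)) ξ hp
    (((((contDiffAt_coord 0 ξ).pow N).mul (contDiffAt_coord 2 ξ)).inv
      (mul_ne_zero (pow_ne_zero N h0) h2)).prodMk (contDiffAt_coord 1 ξ))

theorem pderivAt_lagrPressure (h0 : ξ 0 ≠ 0) (h2 : ξ 2 ≠ 0)
    (hp : ContDiffAt ℝ ∞ p ((ξ 0 ^ N * ξ 2)⁻¹, ξ 1)) (i : Fin 7) :
    pderivAt i (lagrPressure N p) ξ =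
      -((ξ 0 ^ N * ξ 2)⁻¹ * (N / ξ 0 * (if i = 0 then 1 else 0) + (if i = 2 then 1 else 0) / ξ 2))
          * pRho p ((ξ 0 ^ N * ξ 2)⁻¹, ξ 1)
        + (if i = 1 then 1 else 0) * pEnt p ((ξ 0 ^ N * ξ 2)⁻¹, ξ 1) := by
  have hx : ∀ j : Fin 7, HasFDerivAt (fun ξ : Fin 7 → ℝ => ξ j)
      (ContinuousLinearMap.proj (R := ℝ) (φ := fun _ : Fin 7 => ℝ) j) ξ :=
    fun j => hasFDerivAt_apply (𝕜 := ℝ) j ξ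
  have hpd := hp.differentiableAt (by simp)
  have hi := (((hx 0).pow N).mul (hx 2))
  have hv := (hasDerivAt_inv (x := ξ 0 ^ N * ξ 2) (mul_ne_zero
    (pow_ne_zero N h0) h2)).comp_hasFDerivAt
    ξ hi
  have h := hpd.hasFDerivAt.comp ξ (hv.prodMk (hx 1))
  have h' : pderivAt i (lagrPressure N p) ξ = _ :=
    congrArg (fun L : (Fin 7 → ℝ) →L[ℝ] ℝ => L (Pi.single i 1)) h.fderiv
  rw [h', pRho_eq hpd, pEnt_eq hpd]
  have hl : ∀ a b : ℝ, fderiv ℝ p ((ξ 0 ^ N * ξ 2)⁻¹, ξ 1) (a, b) =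
      a * fderiv ℝ p ((ξ 0 ^ N * ξ 2)⁻¹, ξ 1) (1, 0)
        + b * fderiv ℝ p ((ξ 0 ^ N * ξ 2)⁻¹, ξ 1) (0, 1) := by
    intro a b
    have h3 : ((a, b) : ℝ × ℝ) = a • (1, 0) + b • (0, 1) := by simp
    rw [h3, map_add, map_smul, map_smul, smul_eq_mul, smul_eq_mul]
  refine (hl _ _).trans ?_
  congr 1
  · congr 1
    simp only [ContinuousLinearMap.coe_coe, FunLike.coe_smul, FunLike.coe_add, Pi.smul_apply,
      Pi.add_apply,
      ContinuousLinearMap.proj_apply, smul_eq_mul, Pi.single_apply, nsmul_eq_mul, Pi.pow_apply]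
    simp only [eq_comm (a := (0 : Fin 7)), eq_comm (a := (2 : Fin 7)), natCast_mul_pow_pred N h0]
    have := pow_ne_zero N h0
    field_simp
    ring
  · simp [Pi.single_apply, eq_comm]

end Pressure

variable {N : ℕ} {p : ℝ × ℝ → ℝ} {z : Jet}

theorem smoothJetAt_lagr_apply (hr : rad z ≠ 0) (hρ : rhoD 0 z ≠ 0) (i : Fin 7) :
    SmoothJetAt (fun y => lagr N y i) z := by
  have hv := smoothJetAt_specVol (N := N) hr hρ
  fin_cases i
  · exact SmoothJetAt.rad z
  · exact SmoothJetAt.entD 0 z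
  · exact hv
  · exact SmoothJetAt.velD 0 z
  · exact hv.mul (SmoothJetAt.entD 1 z)
  · exact ((hv.pow 2).mul (((SmoothJetAt.rhoD 1 z).div (SmoothJetAt.rhoD 0 z) hρ).add
      ((SmoothJetAt.const (N : ℝ) z).div (SmoothJetAt.rad z) hr))).neg
  · exact hv.mul (SmoothJetAt.velD 1 z)

theorem smoothJetAt_lagr (hr : rad z ≠ 0) (hρ : rhoD 0 z ≠ 0) : SmoothJetAt (lagr N) z :=
  SmoothJetAt.pi fun i => smoothJetAt_lagr_apply hr hρ i

theorem Dm_lagr (hr : rad z ≠ 0) (hρ : rhoD 0 z ≠ 0) (i : Fin 7) :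
    Dm N (fun y => lagr N y i) z = lagrDm N z i := by
  have hv := hasLineDerivAt_specVol (N := N) hr hρ (radDir z)
  have hU0 : HasLineDerivAt ℝ (velD 0) (velD 1 z) z (radDir z) := hasLineDerivAt_coord 0 0 z _
  have hU1 : HasLineDerivAt ℝ (velD 1) (velD 2 z) z (radDir z) := hasLineDerivAt_coord 1 0 z _
  have hS0 : HasLineDerivAt ℝ (entD 0) (entD 1 z) z (radDir z) := hasLineDerivAt_coord 0 2 z _
  have hS1 : HasLineDerivAt ℝ (entD 1) (entD 2 z) z (radDir z) := hasLineDerivAt_coord 1 2 z _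
  have hρ0 : HasLineDerivAt ℝ (rhoD 0) (rhoD 1 z) z (radDir z) := hasLineDerivAt_coord 0 1 z _
  have hρ1 : HasLineDerivAt ℝ (rhoD 1) (rhoD 2 z) z (radDir z) := hasLineDerivAt_coord 1 1 z _
  have hr0 : HasLineDerivAt ℝ rad 1 z (radDir z) := hasLineDerivAt_rad z _
  have hv' : (-(specVol N z * ((radDir z).2.2 0 1 / rhoD 0 z + N * (radDir z).2.1 / rad z))) =
      -(specVol N z * (rhoD 1 z / rhoD 0 z + N / rad z)) := by simp [radDir, rhoD]
  rw [hv'] at hv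
  rw [Dm, Dr_eq]
  have hz : z + (0 : ℝ) • radDir z = z := by simp
  fin_cases i
  · refine (congrArg _ hr0.lineDeriv).trans ?_
    simp [lagrDm, lagr]
  · refine (congrArg _ hS0.lineDeriv).trans ?_
    simp [lagrDm, lagr]
  · refine (congrArg _ hv.lineDeriv).trans ?_
    simp [lagrDm, lagr]; ring
  · refine (congrArg _ hU0.lineDeriv).trans ?_
    simp [lagrDm, lagr]
  · have e : lineDeriv ℝ (fun y => lagr N y 4) z (radDir z) = _ := HasDerivAt.deriv
      (HasDerivAt.mul hv hS1)
    simp only [hz] at e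
    change specVol N z * lineDeriv ℝ (fun y => lagr N y 4) z (radDir z) = lagrDm N z 4
    rw [e]
    simp [lagrDm]; ring
  · have e : lineDeriv ℝ (fun y => lagr N y 5) z (radDir z) = _ :=
      HasDerivAt.deriv (((HasDerivAt.pow hv 2).mul ((HasDerivAt.div hρ1 hρ0
        (by simpa using hρ)).add (HasDerivAt.div (hasDerivAt_const 0 (N : ℝ)) hr0
        (by simpa using hr)))).neg)
    simp only [hz, Pi.add_apply, Pi.div_apply, Pi.pow_apply] at e
    change specVol N z * lineDeriv ℝ (fun y => lagr N y 5) z (radDir z) = lagrDm N z 5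
    rw [e]
    simp [lagrDm]; field_simp; ring
  · have e : lineDeriv ℝ (fun y => lagr N y 6) z (radDir z) = _ := HasDerivAt.deriv
      (HasDerivAt.mul hv hU1)
    simp only [hz] at e
    change specVol N z * lineDeriv ℝ (fun y => lagr N y 6) z (radDir z) = lagrDm N z 6
    rw [e]
    simp [lagrDm]; ring

theorem lineDeriv_comp_lagr (hr : rad z ≠ 0) (hρ : rhoD 0 z ≠ 0) {h : (Fin 7 → ℝ) → ℝ}
    (hh : DifferentiableAt ℝ h (lagr N z)) (v : Jet) :
    lineDeriv ℝ (fun y => h (lagr N y)) z v =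
      ∑ i, lineDeriv ℝ (fun y => lagr N y i) z v * pderivAt i h (lagr N z) := by
  rw [(smoothJetAt_lagr hr hρ).lineDeriv_comp hh, fderiv_apply_eq_sum,
    SmoothJetAt.lineDeriv_pi fun i => smoothJetAt_lagr_apply hr hρ i]

theorem Dm_comp_lagr (hr : rad z ≠ 0) (hρ : rhoD 0 z ≠ 0) {h : (Fin 7 → ℝ) → ℝ}
    (hh : DifferentiableAt ℝ h (lagr N z)) :
    Dm N (fun y => h (lagr N y)) z = ∑ i, lagrDm N z i * pderivAt i h (lagr N z) := by
  rw [Dm, Dr_eq, lineDeriv_comp_lagr hr hρ hh, Finset.mul_sum]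
  refine Finset.sum_congr rfl fun i _ => ?_
  rw [← Dm_lagr hr hρ, Dm, Dr_eq, mul_assoc]

/-- The thermodynamic state is recovered from the Lagrangian coordinates. -/
theorem lagr_state (hr : rad z ≠ 0) : ((lagr N z 0 ^ N * lagr N z 2)⁻¹, lagr N z 1) = state z := by
  refine Prod.ext ?_ rfl
  change (rad z ^ N * (rhoD 0 z * rad z ^ N)⁻¹)⁻¹ = rhoD 0 z
  have := pow_ne_zero N hr
  by_cases h : rhoD 0 z = 0
  · simp [h]
  · field_simp

theorem IsRegular.contDiffAt_lagrPressure (hz : IsRegular p z) :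
    ContDiffAt ℝ ∞ (lagrPressure N p) (lagr N z) :=
  RadialFlow.contDiffAt_lagrPressure hz.rad_ne (specVol_ne hz.rad_ne hz.rho_ne)
    (by rw [lagr_state hz.rad_ne]; exact hz.smooth)

theorem IsRegular.matDeriv_velD (hz : IsRegular p z) :
    RadialFlow.matDeriv (N + 1) p (velD 0) z = accel N (lagrPressure N p) (lagr N z) := by
  have hp : ContDiffAt ℝ ∞ p ((lagr N z 0 ^ N * lagr N z 2)⁻¹, lagr N z 1) := by
    rw [lagr_state hz.rad_ne]; exact hz.smooth
  have h2 : lagr N z 2 ≠ 0 := specVol_ne hz.rad_ne hz.rho_ne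
  have h0 : lagr N z 0 ≠ 0 := hz.rad_ne
  rw [RadialFlow.matDeriv_velD, accel, pderivAt_lagrPressure h0 h2 hp,
    pderivAt_lagrPressure h0 h2 hp, pderivAt_lagrPressure h0 h2 hp, lagr_state hz.rad_ne]
  have hv : specVol N z = (rhoD 0 z * rad z ^ N)⁻¹ := rfl
  have hr := hz.rad_ne
  have hρ := hz.rho_ne
  have := pow_ne_zero N hr
  simp [lagr, hv]
  field_simp
  ring

/-- The Euler equations in Lagrangian coordinates. -/
theorem matDeriv_lagr (hz : ∀ᶠ y in 𝓝 z, IsRegular p y) (i : Fin 7) :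
    matDeriv (N + 1) p (fun y => lagr N y i) z =
      ![lagr N z 3, 0, lagr N z 6, accel N (lagrPressure N p) (lagr N z), 0, lagrDm N z 6,
        ∑ i, lagrDm N z i * pderivAt i (accel N (lagrPressure N p)) (lagr N z)] i := by
  have hz0 := hz.self_of_nhds
  have hr := hz0.rad_ne
  have hρ := hz0.rho_ne
  fin_cases i
  · exact matDeriv_rad _ _ _
  · exact matDeriv_entD _ _ _
  · exact matDeriv_specVol hr hρ
  · exact hz0.matDeriv_velD
  · have h1 : ∀ᶠ y in 𝓝 z, lagr N y 4 = Dm N (entD 0) y := by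
      filter_upwards [hz] with y hy using (Dm_lagr (N := N) hy.rad_ne hy.rho_ne 1).symm
    refine (matDeriv_congr h1).trans ?_
    rw [hz0.matDeriv_Dm (SmoothJetAt.entD 0 z),
      Dm_congr (G := fun _ => 0) (Eventually.of_forall fun y => matDeriv_entD _ _ _), Dm, Dr_eq,
      lineDeriv_const]
    simp
  · have h1 : ∀ᶠ y in 𝓝 z, lagr N y 5 = Dm N (specVol N) y := by
      filter_upwards [hz] with y hy using (Dm_lagr (N := N) hy.rad_ne hy.rho_ne 2).symm
    refine (matDeriv_congr h1).trans ?_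
    rw [hz0.matDeriv_Dm (smoothJetAt_specVol hr hρ), Dm_congr (G := fun y => lagr N y 6)
      (by filter_upwards [hz] with y hy using matDeriv_specVol hy.rad_ne hy.rho_ne)]
    exact Dm_lagr hr hρ 6
  · have h1 : ∀ᶠ y in 𝓝 z, lagr N y 6 = Dm N (velD 0) y := by
      filter_upwards [hz] with y hy using (Dm_lagr (N := N) hy.rad_ne hy.rho_ne 3).symm
    refine (matDeriv_congr h1).trans ?_
    rw [hz0.matDeriv_Dm (SmoothJetAt.velD 0 z),
      Dm_congr (G := fun y => accel N (lagrPressure N p) (lagr N y))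
      (by filter_upwards [hz] with y hy using hy.matDeriv_velD)]
    exact Dm_comp_lagr hr hρ
      ((contDiffAt_accel hz0.contDiffAt_lagrPressure).differentiableAt (by simp))

theorem matDeriv_comp_lagr (hz : ∀ᶠ y in 𝓝 z, IsRegular p y) {h : (Fin 7 → ℝ) → ℝ}
    (hh : DifferentiableAt ℝ h (lagr N z)) :
    matDeriv (N + 1) p (fun y => h (lagr N y)) z =
      ∑ i, ![lagr N z 3, 0, lagr N z 6, accel N (lagrPressure N p) (lagr N z), 0, lagrDm N z 6,
        ∑ i, lagrDm N z i * pderivAt i (accel N (lagrPressure N p)) (lagr N z)] i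
          * pderivAt i h (lagr N z) := by
  rw [matDeriv, lineDeriv_comp_lagr hz.self_of_nhds.rad_ne hz.self_of_nhds.rho_ne hh]
  refine Finset.sum_congr rfl fun i _ => ?_
  rw [← matDeriv_lagr hz, matDeriv]

end

end RadialFlow

/-! ### Reduction of the order of the flux -/

namespace RadialFlow

noncomputable section

/-- The coordinate vector of the `i`-th radial derivative of the `j`-th fluid variable. -/
def jetVec (i : ℕ) (j : Fin 3) : Jet := (0, 0, Pi.single i (Pi.single j 1))

/-- Replace the time and the derivatives of order at least two by those of `z₀`. -/
def freezeJet (z₀ z : Jet) : Jet := (z₀.1, z.2.1, fun i => if i ≤ 1 then z.2.2 i else z₀.2.2 i)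

theorem tendsto_freezeJet (z₀ : Jet) : Tendsto (freezeJet z₀) (𝓝 z₀) (𝓝 z₀) := by
  have hc : Continuous (freezeJet z₀) := by
    refine continuous_const.prodMk ((continuous_fst.comp continuous_snd).prodMk
      (continuous_pi fun i => ?_))
    by_cases h : i ≤ 1
    · simp only [h, if_true]; fun_prop
    · simp only [h, if_false]; fun_prop
  have h0 : freezeJet z₀ z₀ = z₀ := by simp [freezeJet]
  simpa [h0] using hc.tendsto z₀

theorem tendsto_freezeTime (z₀ : Jet) :
    Tendsto (fun z : Jet => ((z₀.1, z.2) : Jet)) (𝓝 z₀) (𝓝 z₀) := by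
  have hc : Continuous fun z : Jet => ((z₀.1, z.2) : Jet) := by fun_prop
  exact hc.tendsto z₀

/-- If `D_r Q` is of order two, then `Q` is of order one. -/
theorem eventually_lineDeriv_jetVec_eq_zero {Q : Jet → ℝ} {z₀ : Jet}
    (hQ : ∀ᶠ y in 𝓝 z₀, SmoothJetAt Q y)
    (hE : ∀ᶠ y in 𝓝 z₀, ∀ i, 2 < i → ∀ j, lineDeriv ℝ (Dr Q) y (jetVec i j) = 0) :
    ∀ᶠ y in 𝓝 z₀, ∀ i, 1 < i → ∀ j, lineDeriv ℝ Q y (jetVec i j) = 0 := by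
  obtain ⟨K, g, hg, hQg⟩ := hQ.self_of_nhds
  have hstep : ∀ k, 1 ≤ k →
      (∀ᶠ y in 𝓝 z₀, ∀ i, k + 1 < i → ∀ j, lineDeriv ℝ Q y (jetVec i j) = 0) →
      ∀ᶠ y in 𝓝 z₀, ∀ i, k < i → ∀ j, lineDeriv ℝ Q y (jetVec i j) = 0 := by
    intro k hk h
    filter_upwards [hQ, hE, h, h.eventually_nhds] with y h1 h2 h3 h4 i hi j
    rcases (Nat.succ_le_of_lt hi).eq_or_lt with rfl | hi'
    · have h5 := h1.lineDeriv_lineDeriv (V := radDir) (v := jetVec (k + 2) j)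
        (w := jetVec (k + 1) j) fun K => by
          refine (hasDerivAt_const _ _).prodMk ((hasDerivAt_const _ _).prodMk
            (hasDerivAt_pi.2 fun i => hasDerivAt_pi.2 fun j' => ?_))
          refine HasDerivAt.congr_deriv (hasLineDerivAt_coord (i + 1) j' y _) ?_
          simp [jetVec, Pi.single_apply]
      have h6 : lineDeriv ℝ (fun y => lineDeriv ℝ Q y (jetVec (k + 2) j)) y (radDir y) = 0 := by
        rw [lineDeriv_congr (G := fun _ => 0) (h4.mono fun x hx => hx (k + 2) (by omega) j),
          lineDeriv_const]
      have h7 := h2 (k + 2) (by omega) j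
      rw [h6, zero_add] at h5
      exact h5.symm.trans h7
    · exact h3 i hi' j
  have hind : ∀ m, ∀ᶠ y in 𝓝 z₀, ∀ i, 1 + (K - m) < i → ∀ j, lineDeriv ℝ Q y (jetVec i j) = 0 := by
    intro m
    induction m with
    | zero =>
      filter_upwards [SmoothJetAt.eventually_hasLineDerivAt hg hQg] with y hy i hi j
      rw [(hy _).lineDeriv]
      have h0 : trunc K (jetVec i j) = 0 := by
        refine Prod.ext rfl (Prod.ext rfl (funext fun l => ?_))
        have : (l : ℕ) ≠ i := by omega
        simp [trunc, jetVec, this]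
      rw [h0, map_zero]
    | succ m ih =>
      by_cases hm : m < K
      · refine hstep _ (by omega) (ih.mono fun y hy i hi => hy i (by omega))
      · exact ih.mono fun y hy i hi => hy i (by omega)
  simpa using hind K

/-- The derivative in a direction that changes only the derivatives of order greater than `k`
vanishes for a function of order `k`. -/
theorem SmoothJetAt.lineDeriv_eq_zero {Q : Jet → ℝ} {x v : Jet} (hQ : SmoothJetAt Q x) {k : ℕ}
    (h : ∀ i, k < i → ∀ j, _root_.lineDeriv ℝ Q x (jetVec i j) = 0) (h1 : v.1 = 0) (h2 : v.2.1 = 0)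
    (h3 : ∀ i ≤ k, v.2.2 i = 0) : _root_.lineDeriv ℝ Q x v = 0 := by
  obtain ⟨K, g, hg, hQg⟩ := hQ
  have hL := (SmoothJetAt.eventually_hasLineDerivAt hg hQg).self_of_nhds
  have hv : RadialFlow.trunc K v =
      ∑ i : Fin (K + 1), ∑ j, v.2.2 i j • RadialFlow.trunc K (jetVec i j) := by
    refine Prod.ext ?_ (Prod.ext ?_ (funext fun l => funext fun j => ?_))
    · simp [RadialFlow.trunc, jetVec, h1, Prod.fst_sum]
    · simp [RadialFlow.trunc, jetVec, h2, Prod.fst_sum, Prod.snd_sum]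
    · simp only [RadialFlow.trunc, jetVec, Prod.snd_sum, Finset.sum_apply, Prod.smul_snd,
        Pi.smul_apply, smul_eq_mul]
      rw [Finset.sum_eq_single l, Finset.sum_eq_single j]
      · simp
      · intro j' _ hj'; simp [hj'.symm]
      · simp
      · intro l' _ hl'
        refine Finset.sum_eq_zero fun j' _ => ?_
        have : (l : ℕ) ≠ l' := fun h => hl' (Fin.ext h.symm)
        simp [this]
      · simp
  rw [(hL v).lineDeriv, hv, map_sum]
  refine Finset.sum_eq_zero fun i _ => ?_
  rw [map_sum]
  refine Finset.sum_eq_zero fun j _ => ?_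
  rw [map_smul]
  by_cases hi : (i : ℕ) ≤ k
  · rw [h3 i hi]; simp
  · rw [← (hL _).lineDeriv, h i (not_le.1 hi) j, smul_zero]

/-- If `D_r Q` is of order two, then `Q` does not change, apart from its dependence on the time,
when the derivatives of order at least two are frozen. -/
theorem eventually_freezeJet_eq {Q : Jet → ℝ} {z₀ : Jet}
    (hQ : ∀ᶠ y in 𝓝 z₀, SmoothJetAt Q y)
    (hE : ∀ᶠ y in 𝓝 z₀, ∀ i, 2 < i → ∀ j, lineDeriv ℝ (Dr Q) y (jetVec i j) = 0) :
    ∀ᶠ y in 𝓝 z₀, Q (freezeJet z₀ y) = Q (z₀.1, y.2) := by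
  obtain ⟨C, ⟨hC, hconv⟩, hCsub⟩ := (LocallyConvexSpace.convex_basis (𝕜 := ℝ) z₀).mem_iff.1
    (hQ.and (eventually_lineDeriv_jetVec_eq_zero hQ hE))
  filter_upwards [(tendsto_freezeJet z₀).eventually hC, (tendsto_freezeTime z₀).eventually hC]
    with y ha hb
  set a := freezeJet z₀ y with ha'
  set b : Jet := (z₀.1, y.2) with hb'
  have hseg : ∀ s ∈ Icc (0 : ℝ) 1, a + s • (b - a) ∈ C := fun s hs =>
    hconv.add_smul_sub_mem ha hb hs
  have hd : ∀ s ∈ Icc (0 : ℝ) 1, HasDerivAt (fun s : ℝ => Q (a + s • (b - a))) 0 s := by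
    intro s hs
    obtain ⟨h1, h2⟩ := hCsub (hseg s hs)
    have h3 := h1.hasLineDerivAt (b - a)
    rw [h1.lineDeriv_eq_zero h2 (by simp [a, b, freezeJet]) (by simp [a, b, freezeJet])
      (fun i hi => by simp [a, b, freezeJet, hi])] at h3
    have h4 : HasDerivAt (fun t : ℝ => Q (a + s • (b - a) + t • (b - a))) 0 (s - s) := by
      rw [sub_self]; exact h3
    refine (h4.comp_sub_const s s).congr_of_eventuallyEq (Eventually.of_forall fun t => ?_)
    simp only [add_assoc, ← add_smul, add_sub_cancel]
  have h4 := constant_of_has_deriv_right_zero (f := fun s : ℝ => Q (a + s • (b - a))) (a := 0)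
    (b := 1) (fun s hs => (hd s hs).continuousAt.continuousWithinAt)
    (fun s hs => (hd s (Ico_subset_Icc_self hs)).hasDerivWithinAt) 1 (by simp)
  simpa using h4.symm

/-- The jet with given Lagrangian coordinates, completed by the time and the higher derivatives
of `z₀`. -/
def lagrSection (N : ℕ) (z₀ : Jet) (ξ : Fin 7 → ℝ) : Jet :=
  (z₀.1, ξ 0, fun i => if i = 0 then ![ξ 3, (ξ 0 ^ N * ξ 2)⁻¹, ξ 1] else
    if i = 1 then ![ξ 6 / ξ 2, -((ξ 0 ^ N * ξ 2)⁻¹ * (ξ 5 / ξ 2 ^ 2 + N / ξ 0)), ξ 4 / ξ 2]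
    else z₀.2.2 i)

variable {N : ℕ} {p : ℝ × ℝ → ℝ} {z₀ : Jet} {ξ : Fin 7 → ℝ}

/-- `lagrSection` is a right inverse of `lagr`. -/
theorem lagr_lagrSection (h0 : ξ 0 ≠ 0) (h2 : ξ 2 ≠ 0) : lagr N (lagrSection N z₀ ξ) = ξ := by
  have hx := pow_ne_zero N h0
  funext i
  fin_cases i
  · rfl
  · rfl
  · simp [lagr, specVol, lagrSection, rhoD, rad]; field_simp
  · rfl
  · simp [lagr, specVol, lagrSection, rhoD, rad, entD]; field_simp
  · simp [lagr, specVol, lagrSection, rhoD, rad]; field_simp; ring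
  · simp [lagr, specVol, lagrSection, rhoD, rad, velD]; field_simp

/-- On a jet, `lagrSection` changes only the time and the derivatives of order at least two. -/
theorem lagrSection_lagr {z : Jet} (hr : rad z ≠ 0) (hρ : rhoD 0 z ≠ 0) :
    lagrSection N z₀ (lagr N z) = freezeJet z₀ z := by
  have hx := pow_ne_zero N hr
  refine Prod.ext rfl (Prod.ext rfl (funext fun i => ?_))
  rcases i with _ | _ | i
  · funext j
    fin_cases j
    · rfl
    · simp [lagr, specVol, lagrSection, rhoD, rad, freezeJet] at *; field_simp
    · rfl
  · funext j
    fin_cases j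
    · simp [lagr, specVol, lagrSection, rhoD, rad, freezeJet, velD] at *; field_simp
    · simp [lagr, specVol, lagrSection, rhoD, rad, freezeJet] at *; field_simp; ring
    · simp [lagr, specVol, lagrSection, rhoD, rad, freezeJet, entD] at *; field_simp
  · simp [lagrSection, freezeJet]

theorem contDiffAt_lagrSection_apply (h0 : ξ 0 ≠ 0) (h2 : ξ 2 ≠ 0) (i : ℕ) (j : Fin 3) :
    ContDiffAt ℝ ∞ (fun ξ => (lagrSection N z₀ ξ).2.2 i j) ξ := by
  have hx := fun i : Fin 7 => contDiffAt_coord i ξ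
  have hρ : ContDiffAt ℝ ∞ (fun ξ : Fin 7 → ℝ => (ξ 0 ^ N * ξ 2)⁻¹) ξ :=
    (((hx 0).pow N).mul (hx 2)).inv (mul_ne_zero (pow_ne_zero N h0) h2)
  rcases i with _ | _ | i
  · fin_cases j
    · exact hx 3
    · exact hρ
    · exact hx 1
  · fin_cases j
    · exact (hx 6).div (hx 2) h2
    · exact (hρ.mul (((hx 5).div ((hx 2).pow 2) (pow_ne_zero 2 h2)).add
        (contDiffAt_const.div (hx 0) h0))).neg
    · exact (hx 4).div (hx 2) h2
  · simpa [lagrSection] using contDiffAt_const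

theorem continuousAt_lagrSection (h0 : ξ 0 ≠ 0) (h2 : ξ 2 ≠ 0) :
    ContinuousAt (lagrSection N z₀) ξ :=
  continuousAt_const.prodMk ((continuous_apply (0 : Fin 7)).continuousAt.prodMk
    (continuousAt_pi.2 fun i => continuousAt_pi.2 fun j =>
      (contDiffAt_lagrSection_apply h0 h2 i j).continuousAt))

theorem SmoothJetAt.comp_lagrSection {F : Jet → ℝ} (h0 : ξ 0 ≠ 0) (h2 : ξ 2 ≠ 0)
    (hF : SmoothJetAt F (lagrSection N z₀ ξ)) :
    ContDiffAt ℝ ∞ (fun ξ => F (lagrSection N z₀ ξ)) ξ := by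
  obtain ⟨K, g, hg, hFg⟩ := hF
  have h1 : ContDiffAt ℝ ∞ (fun ξ => RadialFlow.trunc K (lagrSection N z₀ ξ)) ξ :=
    contDiffAt_const.prodMk ((contDiffAt_coord 0 ξ).prodMk
      (contDiffAt_pi.2 fun i => contDiffAt_pi.2 fun j => contDiffAt_lagrSection_apply h0 h2 i j))
  refine (ContDiffAt.comp (g := g) ξ hg h1).congr_of_eventuallyEq ?_
  filter_upwards [(continuousAt_lagrSection h0 h2).eventually hFg] with η hη using hη

end

end RadialFlow

/-! ### The conservation law in Lagrangian coordinates -/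

/-- A partial derivative of a differentiable function, computed along a line. -/
theorem pderivAt_eq_of_hasDerivAt {ι : Type} [Fintype ι] [DecidableEq ι] {F : (ι → ℝ) → ℝ}
    {ξ : ι → ℝ} (hF : DifferentiableAt ℝ F ξ) {i : ι} {c : ℝ}
    (h : HasDerivAt (fun s : ℝ => F (ξ + s • Pi.single i 1)) c 0) : pderivAt i F ξ = c :=
  (hF.hasFDerivAt.hasLineDerivAt (Pi.single i 1)).lineDeriv.symm.trans
    (HasLineDerivAt.lineDeriv h)

/-- The acceleration depends on the derivatives of the flow through `s` and `y` only, linearly. -/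
theorem pderivAt_accel {N : ℕ} {P : (Fin 7 → ℝ) → ℝ} {ξ : Fin 7 → ℝ} (hPs : ContDiffAt ℝ ∞ P ξ)
    (hP : ∀ᶠ η in 𝓝 ξ, ∀ i, 2 < i → pderivAt i P η = 0) {i : Fin 7} (hi : 2 < i) :
    pderivAt i (accel N P) ξ = -(ξ 0 ^ N * ((if i = 4 then pderivAt 1 P ξ else 0)
      + if i = 5 then pderivAt 2 P ξ else 0)) := by
  have hx : ∀ j, DifferentiableAt ℝ (fun ξ : Fin 7 → ℝ => ξ j) ξ :=
    fun j => (contDiffAt_coord j ξ).differentiableAt (by simp)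
  have hPd : ∀ j, DifferentiableAt ℝ (pderivAt j P) ξ :=
    fun j => (hPs.pderivAt j).differentiableAt (by simp)
  have hPi : ∀ j, pderivAt i (pderivAt j P) ξ = 0 := by
    intro j
    rw [pderivAt_comm hPs, Filter.EventuallyEq.pderivAt_eq (G := fun _ => 0)
      (hP.mono fun η hη => hη i hi)]
    simp [pderivAt]
  have hxi : ∀ j, j ≤ 2 → pderivAt i (fun ξ : Fin 7 → ℝ => ξ j) ξ = 0 := by
    intro j hj
    rw [pderivAt_coord, if_neg]
    rintro rfl
    exact absurd hi (not_lt.2 hj)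
  have hpow : pderivAt i (fun ξ : Fin 7 → ℝ => -(ξ 0 ^ N)) ξ = 0 := by
    refine pderivAt_eq_of_hasDerivAt ((hx 0).pow N).neg ?_
    have h0 : (0 : Fin 7) ≠ i := by rintro rfl; simp at hi
    simpa [h0] using hasDerivAt_const (0 : ℝ) (-(ξ 0 ^ N))
  have e : accel N P = fun ξ => -(ξ 0 ^ N) * ((pderivAt 0 P ξ * ξ 2 + pderivAt 1 P ξ * ξ 4)
      + pderivAt 2 P ξ * ξ 5) := by
    funext ξ; simp [accel]
  have hd : ∀ j k, DifferentiableAt ℝ (fun ξ : Fin 7 → ℝ => pderivAt j P ξ * ξ k) ξ :=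
    fun j k => (hPd j).mul (hx k)
  have hd2 : DifferentiableAt ℝ (fun ξ => pderivAt 0 P ξ * ξ 2 + pderivAt 1 P ξ * ξ 4) ξ :=
    (hd 0 2).add (hd 1 4)
  have hd3 : DifferentiableAt ℝ
      (fun ξ => pderivAt 0 P ξ * ξ 2 + pderivAt 1 P ξ * ξ 4 + pderivAt 2 P ξ * ξ 5) ξ :=
    hd2.add (hd 2 5)
  have hd0 : DifferentiableAt ℝ (fun ξ : Fin 7 → ℝ => -(ξ 0 ^ N)) ξ := ((hx 0).pow N).neg
  rw [e, pderivAt_mul hd0 hd3, pderivAt_add hd2 (hd 2 5), pderivAt_add (hd 0 2) (hd 1 4),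
    pderivAt_mul (hPd 0) (hx 2), pderivAt_mul (hPd 1) (hx 4), pderivAt_mul (hPd 2) (hx 5), hpow,
    hPi, hPi, hPi, hxi 2 le_rfl, pderivAt_coord, pderivAt_coord]
  split_ifs <;> ring

namespace RadialFlow

noncomputable section

variable {N : ℕ} {p : ℝ × ℝ → ℝ} {z₀ : Jet} {ξ : Fin 7 → ℝ}

/-- The Lagrangian density of the conserved density `Φ`: its value per unit mass. -/
def lagrDensity (N : ℕ) (z₀ : Jet) (Φ : Jet → ℝ) (ξ : Fin 7 → ℝ) : ℝ :=
  ξ 0 ^ N * ξ 2 * Φ (lagrSection N z₀ ξ)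

/-- The Lagrangian flux `r^N Ψ`, where `Ψ` is the moving flux. -/
def lagrFlux (N : ℕ) (z₀ : Jet) (Φ Φr : Jet → ℝ) (ξ : Fin 7 → ℝ) : ℝ :=
  rad (lagrSection N z₀ ξ) ^ N * movingFlux Φ Φr (lagrSection N z₀ ξ)

theorem eventually_isRegular_lagr (hz : IsRegular p z₀) :
    ∀ᶠ ξ in 𝓝 (lagr N z₀), ξ 0 ≠ 0 ∧ ξ 2 ≠ 0 :=
  ((continuous_apply (0 : Fin 7)).continuousAt.eventually_ne
    (show lagr N z₀ 0 ≠ 0 from hz.rad_ne)).and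
    ((continuous_apply (2 : Fin 7)).continuousAt.eventually_ne
      (show lagr N z₀ 2 ≠ 0 from specVol_ne hz.rad_ne hz.rho_ne))

theorem SmoothJetAt.continuousAt {H : Type*} [NormedAddCommGroup H] [NormedSpace ℝ H]
    {F : Jet → H} {z : Jet} (hF : SmoothJetAt F z) : ContinuousAt F z := by
  obtain ⟨K, g, hg, hFg⟩ := hF
  have h1 : ContinuousAt (fun y => g (truncL K y)) z :=
    ContinuousAt.comp (f := truncL K) (g := g) hg.continuousAt (truncL K).continuous.continuousAt
  exact h1.congr (by filter_upwards [hFg] with y hy using hy.symm)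

theorem tendsto_lagrSection (hz : IsRegular p z₀) :
    Tendsto (lagrSection N z₀) (𝓝 (lagr N z₀)) (𝓝 z₀) := by
  have h := (continuousAt_lagrSection (N := N) (z₀ := z₀) (ξ := lagr N z₀) hz.rad_ne
    (specVol_ne hz.rad_ne hz.rho_ne)).tendsto
  have h0 : lagrSection N z₀ (lagr N z₀) = z₀ := by
    rw [lagrSection_lagr hz.rad_ne hz.rho_ne]; simp [freezeJet]
  rwa [h0] at h

theorem tendsto_lagr (hz : IsRegular p z₀) : Tendsto (lagr N) (𝓝 z₀) (𝓝 (lagr N z₀)) :=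
  (smoothJetAt_lagr hz.rad_ne hz.rho_ne).continuousAt

/-- The material derivative of a function `f` of the Lagrangian coordinates `ξ` whose derivatives
`∂_m` are `ζ`. -/
def lagrMatDeriv (N : ℕ) (P f : (Fin 7 → ℝ) → ℝ) (ξ ζ : Fin 7 → ℝ) : ℝ :=
  ∑ i, ![ξ 3, 0, ξ 6, accel N P ξ, 0, ζ 6, ∑ i, ζ i * pderivAt i (accel N P) ξ] i * pderivAt i f ξ

theorem lagr_add_jetVec {z : Jet} {i : ℕ} (hi : 1 < i) (j : Fin 3) (s : ℝ) :
    lagr N (z + s • jetVec i j) = lagr N z := by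
  have h0 : (0 : ℕ) ≠ i := by omega
  have h1 : (1 : ℕ) ≠ i := by omega
  simp [lagr, specVol, jetVec, rad, rhoD, velD, entD, h0, h1]

theorem lagrDm_add_jetVec {z : Jet} {i : ℕ} (hi : 2 < i) (j : Fin 3) (s : ℝ) :
    lagrDm N (z + s • jetVec i j) = lagrDm N z := by
  have h0 : (0 : ℕ) ≠ i := by omega
  have h1 : (1 : ℕ) ≠ i := by omega
  have h2 : (2 : ℕ) ≠ i := by omega
  simp [lagrDm, lagr, specVol, jetVec, rad, rhoD, velD, entD, h0, h1, h2]

/-- The second derivatives of the fluid variables enter the Lagrangian coordinates `∂_m` by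
`∂_m² S`, `∂_m² v` and `∂_m² U`, linearly and separately. -/
theorem lagrDm_add_jetVec_two {z : Jet} (hr : rad z ≠ 0) (hρ : rhoD 0 z ≠ 0) {i : Fin 7}
    (hi : 3 < i) : ∃ (j : Fin 3) (c : ℝ), c ≠ 0 ∧
      ∀ s : ℝ, lagrDm N (z + s • jetVec 2 j) = lagrDm N z + (s * c) • Pi.single i 1 := by
  have hv := specVol_ne (N := N) hr hρ
  have h3 : ∀ i : Fin 7, 3 < i → i = 4 ∨ i = 5 ∨ i = 6 := by decide
  rcases h3 i hi with rfl | rfl | rfl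
  · refine ⟨2, specVol N z ^ 2, pow_ne_zero 2 hv, fun s => funext fun i => ?_⟩
    fin_cases i <;> simp [lagrDm, lagr, specVol, jetVec, rad, rhoD, velD, entD]
    ring
  · refine ⟨1, -(specVol N z ^ 3 / rhoD 0 z), neg_ne_zero.2 (div_ne_zero (pow_ne_zero 3 hv) hρ),
      fun s => funext fun i => ?_⟩
    fin_cases i <;> simp [lagrDm, lagr, specVol, jetVec, rad, rhoD, velD, entD]
    ring
  · refine ⟨0, specVol N z ^ 2, pow_ne_zero 2 hv, fun s => funext fun i => ?_⟩
    fin_cases i <;> simp [lagrDm, lagr, specVol, jetVec, rad, rhoD, velD, entD]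
    ring

theorem matDeriv_lagr_eq {z : Jet} (hz : ∀ᶠ y in 𝓝 z, IsRegular p y) {h : (Fin 7 → ℝ) → ℝ}
    (hh : DifferentiableAt ℝ h (lagr N z)) :
    matDeriv (N + 1) p (fun y => h (lagr N y)) z =
      lagrMatDeriv N (lagrPressure N p) h (lagr N z) (lagrDm N z) := matDeriv_comp_lagr hz hh

section Conservation

variable {Φ Φr : Jet → ℝ}

theorem eventually_eq_lagrDensity (hz : ∀ᶠ y in 𝓝 z₀, IsRegular p y)
    (hΦ : ∀ᶠ y in 𝓝 z₀, Φ (freezeJet z₀ y) = Φ y) :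
    ∀ᶠ y in 𝓝 z₀, Φ y = rhoD 0 y * lagrDensity N z₀ Φ (lagr N y) := by
  filter_upwards [hz, hΦ] with y h1 h2
  have hr := h1.rad_ne
  have hρ := h1.rho_ne
  have := pow_ne_zero N hr
  rw [lagrDensity, lagrSection_lagr hr hρ, h2]
  simp only [lagr, specVol, Matrix.cons_val_zero, Matrix.cons_val]
  field_simp

theorem eventually_contDiffAt_lagr (hz : IsRegular p z₀) {F : Jet → ℝ}
    (hF : ∀ᶠ y in 𝓝 z₀, SmoothJetAt F y) :
    ∀ᶠ ξ in 𝓝 (lagr N z₀), ContDiffAt ℝ ∞ (fun ξ => F (lagrSection N z₀ ξ)) ξ := by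
  filter_upwards [(tendsto_lagrSection hz).eventually hF, eventually_isRegular_lagr hz]
    with ξ h1 h2 using h1.comp_lagrSection h2.1 h2.2

theorem smoothNear_lagrDensity (hz : IsRegular p z₀) (hF : ∀ᶠ y in 𝓝 z₀, SmoothJetAt Φ y) :
    SmoothNear (lagrDensity N z₀ Φ) (lagr N z₀) := by
  filter_upwards [eventually_contDiffAt_lagr hz hF] with ξ h1
  exact (((contDiffAt_coord 0 ξ).pow N).mul (contDiffAt_coord 2 ξ)).mul h1

theorem smoothJetAt_movingFlux {z : Jet} (hΦ : SmoothJetAt Φ z) (hΦr : SmoothJetAt Φr z) :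
    SmoothJetAt (movingFlux Φ Φr) z := hΦr.sub ((SmoothJetAt.velD 0 z).mul hΦ)

theorem smoothNear_lagrFlux (hz : IsRegular p z₀) (hΦ : ∀ᶠ y in 𝓝 z₀, SmoothJetAt Φ y)
    (hΦr : ∀ᶠ y in 𝓝 z₀, SmoothJetAt Φr y) : SmoothNear (lagrFlux N z₀ Φ Φr) (lagr N z₀) := by
  refine eventually_contDiffAt_lagr hz (F := fun y => rad y ^ N * movingFlux Φ Φr y) ?_
  filter_upwards [hΦ, hΦr] with y h1 h2
  exact ((SmoothJetAt.rad y).pow N).mul (smoothJetAt_movingFlux h1 h2)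

/-- The conservation law in Lagrangian coordinates, with the flux reduced to first order. -/
theorem lagrangian_conservation (hz : ∀ᶠ y in 𝓝 z₀, IsRegular p y)
    (hΦs : ∀ᶠ y in 𝓝 z₀, SmoothJetAt Φ y) (hΦrs : ∀ᶠ y in 𝓝 z₀, SmoothJetAt Φr y)
    (hΦ : ∀ᶠ y in 𝓝 z₀, Φ (freezeJet z₀ y) = Φ y)
    (hcons : ∀ᶠ y in 𝓝 z₀, Dt (N + 1) p Φ y + radDiv (N + 1) Φr y = 0) :
    ∀ᶠ y in 𝓝 z₀, matDeriv (N + 1) p (fun y => lagrDensity N z₀ Φ (lagr N y)) y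
      + Dm N (fun y => lagrFlux N z₀ Φ Φr (lagr N y)) y = 0 := by
  have hz0 := hz.self_of_nhds
  set f := lagrDensity N z₀ Φ with hf
  set Q : Jet → ℝ := fun y => rad y ^ N * movingFlux Φ Φr y with hQ
  have hQs : ∀ᶠ y in 𝓝 z₀, SmoothJetAt Q y := by
    filter_upwards [hΦs, hΦrs] with y h1 h2
    exact ((SmoothJetAt.rad y).pow N).mul (smoothJetAt_movingFlux h1 h2)
  have hfs : ∀ᶠ y in 𝓝 z₀, ContDiffAt ℝ ∞ f (lagr N y) :=
    (tendsto_lagr hz0).eventually (smoothNear_lagrDensity hz0 hΦs)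
  have hfd := eventually_eq_lagrDensity (N := N) hz hΦ
  have h1 : ∀ᶠ y in 𝓝 z₀, Dm N Q y =
      -lagrMatDeriv N (lagrPressure N p) f (lagr N y) (lagrDm N y) := by
    filter_upwards [hcons, hfs, hz, hz.eventually_nhds, hfd.eventually_nhds,
      hQs] with y h2 h3 h4 h5 h6 h7
    have h8 : SmoothJetAt (fun y => f (lagr N y)) y :=
      (smoothJetAt_lagr h4.rad_ne h4.rho_ne).comp h3
    have hρ := SmoothJetAt.rhoD 0 y
    have hU := SmoothJetAt.velD 0 y
    have h9 : ∀ᶠ x in 𝓝 y, Φr x =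
        velD 0 x * (rhoD 0 x * f (lagr N x)) + (rad x ^ N)⁻¹ * Q x := by
      filter_upwards [h5, h6] with x h10 h11
      have := pow_ne_zero N h10.rad_ne
      rw [← h11]
      simp only [hQ, movingFlux]
      field_simp
      ring
    have hr : SmoothJetAt (fun y => (rad y ^ N)⁻¹) y :=
      ((SmoothJetAt.rad y).pow N).inv (pow_ne_zero N h4.rad_ne)
    have h12 : radDiv (N + 1) Φr y =
        radDiv (N + 1) (fun x => velD 0 x * (rhoD 0 x * f (lagr N x))) y
          + radDiv (N + 1) (fun x => (rad x ^ N)⁻¹ * Q x) y := by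
      simp only [radDiv, Dr_eq]
      rw [lineDeriv_congr h9, (hU.mul (hρ.mul h8)).lineDeriv_fun_add (hr.mul h7),
        h9.self_of_nhds]
      ring
    rw [h12, Dt_eq, lineDeriv_congr h6, ← Dt_eq, ← add_assoc, Dt_add_radDiv h8,
      radDiv_inv_pow_mul h4.rad_ne h4.rho_ne h7, ← mul_add] at h2
    rw [← matDeriv_lagr_eq h5 (h3.differentiableAt (by simp))]
    have := (mul_eq_zero.1 h2).resolve_left h4.rho_ne
    linarith
  have h2 : ∀ᶠ y in 𝓝 z₀, ∀ i, 2 < i → ∀ j, lineDeriv ℝ (Dr Q) y (jetVec i j) = 0 := by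
    filter_upwards [h1.eventually_nhds, hz.eventually_nhds] with y h2 h3 i hi j
    have h4 : ∀ᶠ x in 𝓝 y, Dr Q x = (specVol N x)⁻¹ *
        -lagrMatDeriv N (lagrPressure N p) f (lagr N x) (lagrDm N x) := by
      filter_upwards [h2, h3] with x h5 h6
      have := specVol_ne (N := N) h6.rad_ne h6.rho_ne
      rw [← h5, Dm]
      field_simp
    rw [lineDeriv_congr h4]
    have h5 : ∀ s : ℝ, specVol N (y + s • jetVec i j) = specVol N y := fun s =>
      congrFun (lagr_add_jetVec (N := N) (z := y) (i := i) (by omega) j s) 2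
    refine HasLineDerivAt.lineDeriv ?_
    simp only [HasLineDerivAt, h5, lagr_add_jetVec (N := N) (z := y) (i := i) (by omega) j,
      lagrDm_add_jetVec hi]
    exact hasDerivAt_const _ _
  have h3 := eventually_freezeJet_eq hQs h2
  filter_upwards [h3.eventually_nhds, hz, hz.eventually_nhds, (tendsto_freezeTime z₀).eventually h1,
    hfs] with y h4 h5 h6 h7 h8
  have h9 : ∀ᶠ x in 𝓝 y, lagrFlux N z₀ Φ Φr (lagr N x) = Q (z₀.1, x.2) := by
    filter_upwards [h4, h6] with x h10 h11
    rw [← h10, lagrFlux, lagrSection_lagr h11.rad_ne h11.rho_ne]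
  have h10 : Dm N (fun x => Q (z₀.1, x.2)) y = Dm N Q (z₀.1, y.2) := by
    change specVol N y * deriv (fun s : ℝ => Q (z₀.1, (y + s • radDir y).2)) 0 =
      specVol N y * deriv (fun s : ℝ => Q (((z₀.1, y.2) : Jet) + s • radDir (z₀.1, y.2))) 0
    simp [radDir]
  rw [Dm_congr h9, h10, h7, matDeriv_lagr_eq h6 (h8.differentiableAt (by simp))]
  exact add_neg_cancel _

end Conservation

end

end RadialFlow

/-! ### The determining equations of a density quadratic in `U_r` -/

namespace RadialFlow

noncomputable section

variable {N : ℕ} {p : ℝ × ℝ → ℝ} {z₀ : Jet} {f ψ : (Fin 7 → ℝ) → ℝ}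

theorem eventually_isRegular_lagrSection (hz : ∀ᶠ y in 𝓝 z₀, IsRegular p y) :
    ∀ᶠ ξ in 𝓝 (lagr N z₀), (ξ 0 ≠ 0 ∧ ξ 2 ≠ 0) ∧
      ContDiffAt ℝ ∞ p ((ξ 0 ^ N * ξ 2)⁻¹, ξ 1) := by
  filter_upwards [eventually_isRegular_lagr hz.self_of_nhds,
    (tendsto_lagrSection hz.self_of_nhds).eventually hz] with ξ h1 h2
  exact ⟨h1, h2.smooth⟩

theorem eventually_pderivAt_lagrPressure (hz : ∀ᶠ y in 𝓝 z₀, IsRegular p y) :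
    ∀ᶠ ξ in 𝓝 (lagr N z₀), ∀ i, 2 < i → pderivAt i (lagrPressure N p) ξ = 0 := by
  filter_upwards [eventually_isRegular_lagrSection hz] with ξ h i hi
  rw [pderivAt_lagrPressure h.1.1 h.1.2 h.2, if_neg (by rintro rfl; simp at hi),
    if_neg (by rintro rfl; simp at hi), if_neg (by rintro rfl; simp at hi)]
  simp

/-- The conservation law, being linear in the second derivatives, splits into the equations of a
`LagrangianSystem`. -/
theorem exists_lagrangianSystem (hz : ∀ᶠ y in 𝓝 z₀, IsRegular p y)
    (hf : SmoothNear f (lagr N z₀)) (hψ : SmoothNear ψ (lagr N z₀))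
    (hfw : ∀ᶠ ξ in 𝓝 (lagr N z₀), pderivAt 6 (pderivAt 6 (pderivAt 6 f)) ξ = 0)
    (hcons : ∀ᶠ y in 𝓝 z₀, matDeriv (N + 1) p (fun y => f (lagr N y)) y
      + Dm N (fun y => ψ (lagr N y)) y = 0) :
    ∃ W, lagr N z₀ ∈ W ∧ LagrangianSystem N W (lagrPressure N p) f ψ := by
  have hz0 := hz.self_of_nhds
  set P := lagrPressure N p with hPdef
  have hPs : SmoothNear P (lagr N z₀) := by
    filter_upwards [eventually_isRegular_lagrSection hz] with ξ h
    exact contDiffAt_lagrPressure h.1.1 h.1.2 h.2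
  have hPi := eventually_pderivAt_lagrPressure (N := N) hz
  have hPx : ∀ᶠ ξ in 𝓝 (lagr N z₀), ξ 0 * pderivAt 0 P ξ = N * ξ 2 * pderivAt 2 P ξ := by
    filter_upwards [eventually_isRegular_lagrSection hz] with ξ h
    have h0 := h.1.1
    have h2 := h.1.2
    have := pow_ne_zero N h0
    rw [hPdef, pderivAt_lagrPressure h0 h2 h.2, pderivAt_lagrPressure h0 h2 h.2]
    simp
    field_simp
  -- the conservation law as an identity in the coordinates and the second derivatives, which
  -- holds for all nearby values of the second derivatives
  have hlin : ∀ᶠ y in 𝓝 z₀, lagrMatDeriv N P f (lagr N y) (lagrDm N y)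
      + ∑ i, lagrDm N y i * pderivAt i ψ (lagr N y) = 0 := by
    filter_upwards [hcons, hz, hz.eventually_nhds, (tendsto_lagr hz0).eventually hf,
      (tendsto_lagr hz0).eventually hψ] with y h1 h2 h3 h4 h5
    rwa [matDeriv_lagr_eq h3 (h4.differentiableAt (by simp)),
      Dm_comp_lagr h2.rad_ne h2.rho_ne (h5.differentiableAt (by simp))] at h1
  have hcoeff : ∀ᶠ ξ in 𝓝 (lagr N z₀), ∃ ζ : Fin 7 → ℝ,
      (ζ 0 = ξ 2 ∧ ζ 1 = ξ 4 ∧ ζ 2 = ξ 5 ∧ ζ 3 = ξ 6) ∧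
      (lagrMatDeriv N P f ξ ζ + ∑ i, ζ i * pderivAt i ψ ξ = 0) ∧
      ∀ i, 3 < i → ∃ c : ℝ, c ≠ 0 ∧ lagrMatDeriv N P f ξ (ζ + c • Pi.single i 1)
        + ∑ k, (ζ + c • (Pi.single i 1 : Fin 7 → ℝ)) k * pderivAt k ψ ξ = 0 := by
    filter_upwards [(tendsto_lagrSection hz0).eventually hlin.eventually_nhds,
      (tendsto_lagrSection hz0).eventually hz, eventually_isRegular_lagr hz0] with ξ h1 h2 h3
    have hξ : lagr N (lagrSection N z₀ ξ) = ξ := lagr_lagrSection h3.1 h3.2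
    refine ⟨lagrDm N (lagrSection N z₀ ξ), ?_, ?_, fun i hi => ?_⟩
    · exact ⟨congrFun hξ 2, congrFun hξ 4, congrFun hξ 5, congrFun hξ 6⟩
    · have := h1.self_of_nhds
      rwa [hξ] at this
    · obtain ⟨j, c, hc, hj⟩ := lagrDm_add_jetVec_two (N := N) h2.rad_ne h2.rho_ne hi
      obtain ⟨s, hs, hs0⟩ := ((((tendsto_line (lagrSection N z₀ ξ) (jetVec 2 j)).eventually
        h1).filter_mono nhdsWithin_le_nhds).and (self_mem_nhdsWithin (s := {(0 : ℝ)}ᶜ))).exists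
      refine ⟨s * c, mul_ne_zero hs0 hc, ?_⟩
      have := hs
      rwa [lagr_add_jetVec (by norm_num), hj, hξ] at this
  obtain ⟨W, hW, hWo, hmem⟩ := eventually_nhds_iff.1 ((eventually_isRegular_lagr hz0).and
    (hPs.and (hf.and (hψ.and (hPi.eventually_nhds.and (hPx.and (hfw.and hcoeff)))))))
  have key : ∀ ξ ∈ W, pderivAt 5 ψ ξ = ξ 0 ^ N * pderivAt 2 P ξ * pderivAt 6 f ξ ∧
      pderivAt 6 ψ ξ = -pderivAt 5 f ξ ∧
      pderivAt 4 ψ ξ = ξ 0 ^ N * pderivAt 1 P ξ * pderivAt 6 f ξ ∧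
      ξ 3 * pderivAt 0 f ξ + accel N P ξ * pderivAt 3 f ξ + ξ 6 * pderivAt 2 f ξ
        + pderivAt 6 f ξ * (ξ 2 * pderivAt 0 (accel N P) ξ + ξ 5 * pderivAt 2 (accel N P) ξ
          + ξ 4 * pderivAt 1 (accel N P) ξ)
        + ξ 2 * pderivAt 0 ψ ξ + ξ 6 * pderivAt 3 ψ ξ + ξ 5 * pderivAt 2 ψ ξ
        + ξ 4 * pderivAt 1 ψ ξ = 0 := by
    intro ξ hξ
    obtain ⟨-, hP1, -, -, hP2, -, -, ζ, ⟨e0, e1, e2, e3⟩, hζ, hζi⟩ := hW ξ hξ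
    have ha := fun {i : Fin 7} (hi : 2 < i) => pderivAt_accel (N := N) hP1 hP2 hi
    have a3 := ha (i := 3) (by decide)
    have a4 := ha (i := 4) (by decide)
    have a5 := ha (i := 5) (by decide)
    have a6 := ha (i := 6) (by decide)
    simp (decide := true) only [if_true, if_false, add_zero, zero_add, mul_zero, neg_zero]
      at a3 a4 a5 a6
    obtain ⟨c4, hc4, h4⟩ := hζi 4 (by decide)
    obtain ⟨c5, hc5, h5⟩ := hζi 5 (by decide)
    obtain ⟨c6, hc6, h6⟩ := hζi 6 (by decide)
    simp [lagrMatDeriv, Fin.sum_univ_seven, a3, a4, a5, a6, e0, e1, e2, e3,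
      Pi.single_apply] at hζ h4 h5 h6
    have k4 : pderivAt 4 ψ ξ = ξ 0 ^ N * pderivAt 1 P ξ * pderivAt 6 f ξ := by
      refine mul_left_cancel₀ hc4 ?_
      linear_combination h4 - hζ
    have k5 : pderivAt 5 ψ ξ = ξ 0 ^ N * pderivAt 2 P ξ * pderivAt 6 f ξ := by
      refine mul_left_cancel₀ hc5 ?_
      linear_combination h5 - hζ
    have k6 : pderivAt 6 ψ ξ = -pderivAt 5 f ξ := by
      refine mul_left_cancel₀ hc6 ?_
      linear_combination h6 - hζ
    refine ⟨k5, k6, k4, ?_⟩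
    rw [k4, k5, k6] at hζ
    linear_combination hζ
  exact ⟨W, hmem, hWo, fun ξ hξ => (hW ξ hξ).1.1, fun ξ hξ => (hW ξ hξ).2.1,
    fun ξ hξ => (hW ξ hξ).2.2.1, fun ξ hξ => (hW ξ hξ).2.2.2.1,
    fun ξ hξ => (hW ξ hξ).2.2.2.2.1.self_of_nhds, fun ξ hξ => (hW ξ hξ).2.2.2.2.2.1,
    fun ξ hξ => (hW ξ hξ).2.2.2.2.2.2.1, fun ξ hξ => (key ξ hξ).1, fun ξ hξ => (key ξ hξ).2.1,
    fun ξ hξ => (key ξ hξ).2.2.1, fun ξ hξ => (key ξ hξ).2.2.2⟩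

section Quadratic

variable {φ₂ φ₁ φ₀ : ℝ × ℝ × ℝ × ℝ × ℝ × ℝ → ℝ}

theorem quadDensity_freezeJet (z : Jet) :
    quadDensity φ₂ φ₁ φ₀ (freezeJet z₀ z) = quadDensity φ₂ φ₁ φ₀ z := rfl

theorem lagrSection_add_single (ξ : Fin 7 → ℝ) (s : ℝ) :
    coeffArgs (lagrSection N z₀ (ξ + s • Pi.single 6 1)) = coeffArgs (lagrSection N z₀ ξ) := by
  simp [coeffArgs, lagrSection, rad, velD, rhoD, entD]

/-- A density that is quadratic in `U_r` is quadratic in `w`. -/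
theorem lagrDensity_quadDensity_cubic {z₀ : Jet}
    (hf : SmoothNear (lagrDensity N z₀ (quadDensity φ₂ φ₁ φ₀)) (lagr N z₀)) :
    ∀ᶠ ξ in 𝓝 (lagr N z₀), pderivAt 6 (pderivAt 6 (pderivAt 6
      (lagrDensity N z₀ (quadDensity φ₂ φ₁ φ₀)))) ξ = 0 := by
  let c : (Fin 7 → ℝ) → ℝ × ℝ × ℝ × ℝ × ℝ × ℝ := fun ξ => coeffArgs (lagrSection N z₀ ξ)
  have hc : ∀ ξ (s : ℝ), c (ξ + s • Pi.single 6 1) = c ξ := lagrSection_add_single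
  have hl : ∀ (a b : ℝ) (k : ℝ → ℝ), (∀ s, k s = k 0 + s * (a + s * b)) → HasDerivAt k a 0 := by
    intro a b k hk
    have h := (((hasDerivAt_id (0 : ℝ)).mul
      (((hasDerivAt_id (0 : ℝ)).mul_const b).const_add a)).const_add (k 0))
    simp only [id, one_mul, zero_mul, add_zero] at h
    exact h.congr_of_eventuallyEq (Eventually.of_forall hk)
  have h1 : ∀ᶠ ξ in 𝓝 (lagr N z₀), pderivAt 6 (lagrDensity N z₀ (quadDensity φ₂ φ₁ φ₀)) ξ =
      ξ 0 ^ N * ξ 2 * (2 * ξ 6 / ξ 2 ^ 2 * φ₂ (c ξ) + φ₁ (c ξ) / ξ 2) := by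
    filter_upwards [hf] with ξ h
    refine pderivAt_eq_of_hasDerivAt (h.differentiableAt (by simp))
      (hl _ (ξ 0 ^ N * ξ 2 * (φ₂ (c ξ) / ξ 2 ^ 2)) _ fun s => ?_)
    have hv : ∀ ξ, velD 1 (lagrSection N z₀ ξ) = ξ 6 / ξ 2 := fun ξ => rfl
    have h0 := hc ξ 0
    simp only [lagrDensity, quadDensity, hv]
    change _ * (_ * φ₂ (c _) + _ * φ₁ (c _) + φ₀ (c _)) =
      _ * (_ * φ₂ (c _) + _ * φ₁ (c _) + φ₀ (c _)) + _
    rw [hc, h0]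
    simp
    ring
  have h2 : ∀ᶠ ξ in 𝓝 (lagr N z₀), pderivAt 6 (pderivAt 6
      (lagrDensity N z₀ (quadDensity φ₂ φ₁ φ₀))) ξ =
      ξ 0 ^ N * ξ 2 * (2 / ξ 2 ^ 2 * φ₂ (c ξ)) := by
    filter_upwards [hf, h1.eventually_nhds] with ξ h h'
    rw [Filter.EventuallyEq.pderivAt_eq h']
    refine pderivAt_eq_of_hasDerivAt ((((h.pderivAt 6).congr_of_eventuallyEq
      (h'.mono fun η hη => hη.symm)).differentiableAt (by simp))) (hl _ 0 _ fun s => ?_)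
    have h0 := hc ξ 0
    rw [hc, h0]
    simp
    ring
  filter_upwards [hf, h2.eventually_nhds] with ξ h h'
  rw [Filter.EventuallyEq.pderivAt_eq h']
  refine pderivAt_eq_of_hasDerivAt (((((h.pderivAt 6).pderivAt 6).congr_of_eventuallyEq
      (h'.mono fun η hη => hη.symm)).differentiableAt (by simp))) (hl _ 0 _ fun s => ?_)
  have h0 := hc ξ 0
  rw [hc, h0]
  simp

end Quadratic

end

end RadialFlow

/-! ### Integral invariants -/

namespace RadialFlow

noncomputable section

variable {N : ℕ} {p : ℝ × ℝ → ℝ} {z₀ : Jet} {W : Set (Fin 7 → ℝ)} {f ψ : (Fin 7 → ℝ) → ℝ}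
  {Φ : Jet → ℝ} {O : Set Jet}

theorem IsConsLawOn.congr {n : ℕ} {Φt Φt' Φr : Jet → ℝ} (hO : IsOpen O)
    (h : IsConsLawOn n p Φt Φr O) (he : ∀ z ∈ O, Φt' z = Φt z) : IsConsLawOn n p Φt' Φr O := by
  have he' : ∀ z ∈ O, ∀ᶠ y in 𝓝 z, Φt' y = Φt y := fun z hz => by
    filter_upwards [hO.mem_nhds hz] with y hy using he y hy
  refine ⟨fun z hz => SmoothJetAt.congr (h.1 z hz) (he' z hz), h.2.1, fun z hz => ?_⟩
  rw [Dt_eq, lineDeriv_congr (he' z hz), ← Dt_eq]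
  exact h.2.2 z hz

/-- A solution of `d a + ∂_m q = 0` is a conserved density `ρ a` with moving flux `r^{-N} q`. -/
theorem isConsLawOn_of_matDeriv {a q : Jet → ℝ} (hz : ∀ y ∈ O, IsRegular p y)
    (ha : ∀ y ∈ O, SmoothJetAt a y) (hq : ∀ y ∈ O, SmoothJetAt q y)
    (h : ∀ y ∈ O, matDeriv (N + 1) p a y + Dm N q y = 0) :
    IsConsLawOn (N + 1) p (fun y => rhoD 0 y * a y)
      (fun y => velD 0 y * (rhoD 0 y * a y) + (rad y ^ N)⁻¹ * q y) O := by
  have h1 : ∀ y ∈ O, SmoothJetAt (fun y => rhoD 0 y * a y) y := fun y hy =>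
    (SmoothJetAt.rhoD 0 y).mul (ha y hy)
  have h2 : ∀ y ∈ O, SmoothJetAt (fun y => (rad y ^ N)⁻¹ * q y) y := fun y hy =>
    (((SmoothJetAt.rad y).pow N).inv (pow_ne_zero N (hz y hy).rad_ne)).mul (hq y hy)
  refine ⟨h1, fun y hy => ((SmoothJetAt.velD 0 y).mul (h1 y hy)).add (h2 y hy), fun y hy => ?_⟩
  have h3 : radDiv (N + 1) (fun y => velD 0 y * (rhoD 0 y * a y) + (rad y ^ N)⁻¹ * q y) y =
      radDiv (N + 1) (fun y => velD 0 y * (rhoD 0 y * a y)) y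
        + radDiv (N + 1) (fun y => (rad y ^ N)⁻¹ * q y) y := by
    simp only [radDiv, Dr_eq]
    rw [((SmoothJetAt.velD 0 y).mul (h1 y hy)).lineDeriv_fun_add (h2 y hy)]
    ring
  rw [h3, ← add_assoc, Dt_add_radDiv (ha y hy),
    radDiv_inv_pow_mul (hz y hy).rad_ne (hz y hy).rho_ne (hq y hy), ← mul_add, h y hy, mul_zero]

/-- If `a` is advected by the fluid, then `ρ a` is the density of an integral invariant. -/
theorem isIntegralInvariantOn_of_matDeriv (hO : IsOpen O) {a : Jet → ℝ}
    (hz : ∀ y ∈ O, IsRegular p y) (ha : ∀ y ∈ O, SmoothJetAt a y)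
    (h : ∀ y ∈ O, matDeriv (N + 1) p a y = 0) (hΦ : ∀ y ∈ O, Φ y = rhoD 0 y * a y) :
    IsIntegralInvariantOn (N + 1) p Φ O := by
  refine ⟨_, (isConsLawOn_of_matDeriv (N := N) (q := fun _ => 0) hz ha
    (fun y _ => SmoothJetAt.const 0 y) fun y hy => ?_).congr hO hΦ, fun y hy => ?_⟩
  · rw [h y hy, Dm, Dr_eq, lineDeriv_const, mul_zero, add_zero]
  · rw [movingFlux, hΦ y hy]
    simp

/-- The density `Φ` is equivalent to the density of an integral invariant as soon as the flux is
a material derivative. -/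
theorem equivIntegralInvariantAt_of_matDeriv {a θ : Jet → ℝ} (hz : ∀ᶠ y in 𝓝 z₀, IsRegular p y)
    (ha : ∀ᶠ y in 𝓝 z₀, SmoothJetAt a y) (hθ : ∀ᶠ y in 𝓝 z₀, SmoothJetAt θ y)
    (hΦ : ∀ᶠ y in 𝓝 z₀, Φ y = rhoD 0 y * a y)
    (h : ∀ᶠ y in 𝓝 z₀, matDeriv (N + 1) p a y = Dm N (matDeriv (N + 1) p θ) y)
    (ht : velD 0 z₀ ≠ 0 → ∀ (s : ℝ) (y : Jet), θ (s, y.2) = θ y) :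
    EquivIntegralInvariantAt (N + 1) p Φ z₀ := by
  obtain ⟨O, hO, hOo, hmem⟩ := eventually_nhds_iff.1 (hz.and (ha.and (hθ.and (hΦ.and h))))
  refine ⟨O, hOo, hmem, fun y => (rad y ^ N)⁻¹ * θ y, fun y hy => ?_, fun hU y hy s hs => ?_, ?_⟩
  · exact (((SmoothJetAt.rad y).pow N).inv (pow_ne_zero N (hO y hy).1.rad_ne)).mul
      (hO y hy).2.2.1
  · simp only [ht hU]; rfl
  · refine isIntegralInvariantOn_of_matDeriv (N := N) hOo (a := fun y => a y - Dm N θ y)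
      (fun y hy => (hO y hy).1) (fun y hy => ?_) (fun y hy => ?_) fun y hy => ?_
    all_goals obtain ⟨h1, h2, h3, h4, h5⟩ := hO y hy
    · exact h2.sub (h3.Dm h1.rad_ne h1.rho_ne)
    · rw [matDeriv, h2.lineDeriv_fun_sub (h3.Dm h1.rad_ne h1.rho_ne)]
      exact sub_eq_zero.2 (h5.trans (h1.matDeriv_Dm h3).symm)
    · rw [radDiv_inv_pow_mul h1.rad_ne h1.rho_ne h3, h4]
      ring

theorem eventually_smoothJetAt_comp_lagr (hz : ∀ᶠ y in 𝓝 z₀, IsRegular p y)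
    {h : (Fin 7 → ℝ) → ℝ} (hh : SmoothNear h (lagr N z₀)) :
    ∀ᶠ y in 𝓝 z₀, SmoothJetAt (fun y => h (lagr N y)) y := by
  filter_upwards [hz, (tendsto_lagr hz.self_of_nhds).eventually hh] with y h1 h2
  exact (smoothJetAt_lagr h1.rad_ne h1.rho_ne).comp h2

/-! ### Jets with `p_ρ ≠ 0` -/

section NonconstantPressure

/-- The normal form of a conserved density near a jet with `p_ρ ≠ 0`. -/
theorem exists_eventually_eq (hN : N ≠ 0) (hz : ∀ᶠ y in 𝓝 z₀, IsRegular p y)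
    (H : LagrangianSystem N W (lagrPressure N p) f ψ) (hW : lagr N z₀ ∈ W)
    (hp : pRho p (state z₀) ≠ 0) :
    ∃ θ A k : (Fin 7 → ℝ) → ℝ, SmoothNear θ (lagr N z₀) ∧ SmoothNear A (lagr N z₀) ∧
      SmoothNear k (lagr N z₀) ∧
      (∀ᶠ ξ in 𝓝 (lagr N z₀), ∀ i, i ≠ 1 → i ≠ 4 → pderivAt i A ξ = 0) ∧
      (∀ᶠ ξ in 𝓝 (lagr N z₀), ∀ i, 3 < i → pderivAt i k ξ = 0) ∧
      (∀ᶠ y in 𝓝 z₀, matDeriv (N + 1) p (fun y => A (lagr N y)) y = 0) ∧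
      ∀ᶠ y in 𝓝 z₀, f (lagr N y) =
        Dm N (fun y => θ (lagr N y)) y + A (lagr N y) + k (lagr N y) := by
  have hz0 := hz.self_of_nhds
  have h0 : lagr N z₀ 0 ≠ 0 := hz0.rad_ne
  have h2 : lagr N z₀ 2 ≠ 0 := specVol_ne hz0.rad_ne hz0.rho_ne
  have hP : pderivAt 2 (lagrPressure N p) (lagr N z₀) ≠ 0 := by
    rw [pderivAt_lagrPressure h0 h2 (by rw [lagr_state hz0.rad_ne]; exact hz0.smooth),
      lagr_state hz0.rad_ne]
    have := pow_ne_zero N h0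
    simp [hp, h0, h2]
  obtain ⟨θ, A, k, hθ, hA, hk, hθi, hAi, hki, hf⟩ := H.normal_form hN hW hP
  have ht := tendsto_lagr (N := N) hz0
  refine ⟨θ, A, k, hθ, hA, hk, hAi, hki, ?_, ?_⟩
  · filter_upwards [hz.eventually_nhds, ht.eventually hA, ht.eventually hAi] with y h1 h2 h3
    rw [matDeriv_lagr_eq h1 (h2.differentiableAt (by simp)), lagrMatDeriv, Fin.sum_univ_seven]
    simp [h3 0, h3 2, h3 3, h3 5, h3 6]
  · filter_upwards [hz, ht.eventually hθ, ht.eventually hθi, ht.eventually hf] with y h1 h2 h3 h4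
    rw [Dm_comp_lagr h1.rad_ne h1.rho_ne (h2.differentiableAt (by simp)), h4, massDeriv,
      Fin.sum_univ_seven, h3 4 (by decide), h3 5 (by decide), h3 6 (by decide)]
    simp [lagrDm]

/-- Near a jet with `p_ρ ≠ 0`, the normal form `f = ∂_m θ + A + k` exhibits a trivial density, an
advected function of `(S, ∂_m S)` and a kinematic density, which is conserved because the other
two parts are. -/
theorem equivIntegralInvariantModKinematicAt (hN : N ≠ 0) (hz : ∀ᶠ y in 𝓝 z₀, IsRegular p y)
    (H : LagrangianSystem N W (lagrPressure N p) f ψ) (hW : lagr N z₀ ∈ W)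
    (hcons : ∀ᶠ y in 𝓝 z₀, matDeriv (N + 1) p (fun y => f (lagr N y)) y
      + Dm N (fun y => ψ (lagr N y)) y = 0)
    (hΦ : ∀ᶠ y in 𝓝 z₀, Φ y = rhoD 0 y * f (lagr N y)) (hp : pRho p (state z₀) ≠ 0) :
    EquivIntegralInvariantModKinematicAt (N + 1) p Φ z₀ := by
  obtain ⟨θ, A, k, hθ, hA, hk, -, hki, hAd, hf⟩ := exists_eventually_eq hN hz H hW hp
  have hz0 := hz.self_of_nhds
  have ht := tendsto_lagr (N := N) hz0
  have hks := eventually_smoothJetAt_comp_lagr hz hk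
  have hθs := eventually_smoothJetAt_comp_lagr hz hθ
  have hAs := eventually_smoothJetAt_comp_lagr hz hA
  have hψs := eventually_smoothJetAt_comp_lagr hz
    (show SmoothNear ψ (lagr N z₀) by
      filter_upwards [H.isOpen.mem_nhds hW] with ξ h using H.smoothψ ξ h)
  let kin : ℝ × ℝ × ℝ × ℝ → ℝ := fun x => x.2.2.1 * k ![x.1, x.2.2.2,
    (x.2.2.1 * x.1 ^ N)⁻¹, x.2.1, lagr N z₀ 4, lagr N z₀ 5, lagr N z₀ 6]
  have hkin : ∀ᶠ y in 𝓝 z₀, kinematic kin y = rhoD 0 y * k (lagr N y) := by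
    have h1 := eventually_comp_freezeCoords_eq hk (I := {4, 5, 6})
      (hki.mono fun ξ h i hi => h i (by revert i; decide))
    filter_upwards [ht.eventually h1] with y h2
    rw [← h2]
    refine congrArg (fun ξ => rhoD 0 y * k ξ) (funext fun i => ?_)
    fin_cases i <;> rfl
  obtain ⟨O, hO, hOo, hmem⟩ := eventually_nhds_iff.1 (hz.and (hks.and (hθs.and (hAs.and
    (hψs.and (hAd.and (hkin.and (hcons.and hf.eventually_nhds))))))))
  refine ⟨kin, O, hOo, hmem, ⟨_, (isConsLawOn_of_matDeriv (N := N) (O := O) (p := p)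
    (a := fun y => k (lagr N y))
    (q := fun y => ψ (lagr N y) + matDeriv (N + 1) p (fun y => θ (lagr N y)) y) (fun y hy => ?_)
    (fun y hy => ?_) (fun y hy => ?_) fun y hy => ?_).congr hOo
      fun y hy => (hO y hy).2.2.2.2.2.2.1⟩, ?_⟩
  · exact (hO y hy).1
  · exact (hO y hy).2.1
  · obtain ⟨h1, -, h3, -, h5, -⟩ := hO y hy
    exact h5.add (h1.matDeriv (N + 1) h3)
  · obtain ⟨h1, h2, h3, h4, h5, h6, -, h8, h9⟩ := hO y hy
    have h10 := h3.Dm (N := N) h1.rad_ne h1.rho_ne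
    rw [matDeriv_congr h9, matDeriv, ((h10.add h4).lineDeriv_fun_add h2),
      h10.lineDeriv_fun_add h4] at h8
    have h11 := h1.matDeriv_Dm (N := N) h3
    have h12 : Dm N (fun y => ψ (lagr N y) + matDeriv (N + 1) p (fun y => θ (lagr N y)) y) y =
        Dm N (fun y => ψ (lagr N y)) y + Dm N (matDeriv (N + 1) p fun y => θ (lagr N y)) y := by
      rw [Dm, Dr_eq, h5.lineDeriv_fun_add (h1.matDeriv (N + 1) h3), mul_add]
      rfl
    rw [h12]
    simp only [matDeriv] at h6 h8 h11 ⊢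
    linear_combination h8 - h6 - h11
  · refine equivIntegralInvariantAt_of_matDeriv (N := N) (θ := fun y => θ (lagr N y))
      (a := fun y => Dm N (fun y => θ (lagr N y)) y + A (lagr N y)) hz ?_ hθs ?_ ?_ fun _ _ _ => rfl
    · filter_upwards [hz, hθs, hAs] with y h1 h2 h3 using (h2.Dm h1.rad_ne h1.rho_ne).add h3
    · filter_upwards [hΦ, hkin, hf] with y h1 h2 h3
      rw [h1, h2, h3]; ring
    · filter_upwards [hz, hθs, hAs, hAd] with y h1 h2 h3 h4
      rw [matDeriv, (h2.Dm h1.rad_ne h1.rho_ne).lineDeriv_fun_add h3]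
      simp only [matDeriv] at h4
      rw [h4, add_zero]
      exact h1.matDeriv_Dm h2

/-- Near a jet with `p_ρ ≠ 0`, the normal form shows that the dependence on `U_r` is not
essential. -/
theorem exists_isReducibleOn (hN : N ≠ 0) (hz : ∀ᶠ y in 𝓝 z₀, IsRegular p y)
    (H : LagrangianSystem N W (lagrPressure N p) f ψ) (hW : lagr N z₀ ∈ W)
    (hΦ : ∀ᶠ y in 𝓝 z₀, Φ y = rhoD 0 y * f (lagr N y)) (hp : pRho p (state z₀) ≠ 0)
    {V : Set Jet} (hV : V ∈ 𝓝 z₀) :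
    ∃ O, IsOpen O ∧ O.Nonempty ∧ O ⊆ V ∧ IsReducibleOn (N + 1) Φ O := by
  obtain ⟨θ, A, k, hθ, hA, hk, hAi, hki, -, hf⟩ := exists_eventually_eq hN hz H hW hp
  have ht := tendsto_lagr (N := N) hz.self_of_nhds
  have hθs := eventually_smoothJetAt_comp_lagr hz hθ
  let χ : ℝ × ℝ × ℝ × ℝ × ℝ × ℝ → ℝ := fun x => x.2.2.1 * (fun ξ => A ξ + k ξ) ![x.1, x.2.2.2.1,
    (x.2.2.1 * x.1 ^ N)⁻¹, x.2.1, (x.2.2.1 * x.1 ^ N)⁻¹ * x.2.2.2.2.2,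
    -((x.2.2.1 * x.1 ^ N)⁻¹ ^ 2 * (x.2.2.2.2.1 / x.2.2.1 + N / x.1)), lagr N z₀ 6]
  have hχ : ∀ᶠ y in 𝓝 z₀, χ (coeffArgs y) = rhoD 0 y * (A (lagr N y) + k (lagr N y)) := by
    have h1 := eventually_comp_freezeCoords_eq (hA.add hk) (I := {6}) (by
      filter_upwards [hA.eventually_pderivAt_add hk, hAi, hki] with ξ h1 h2 h3 i hi
      obtain rfl := Finset.mem_singleton.1 hi
      rw [h1, h2 6 (by decide) (by decide), h3 6 (by decide), add_zero])
    filter_upwards [ht.eventually h1] with y h2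
    rw [← h2]
    refine congrArg (fun ξ => rhoD 0 y * (A ξ + k ξ)) (funext fun i => ?_)
    fin_cases i <;> rfl
  obtain ⟨O, hO, hOo, hmem⟩ := eventually_nhds_iff.1
    (hz.and (hθs.and (hχ.and (hf.and (hΦ.and hV)))))
  refine ⟨O, hOo, ⟨z₀, hmem⟩, fun y hy => (hO y hy).2.2.2.2.2,
    fun y => (rad y ^ N)⁻¹ * θ (lagr N y), χ, fun y hy => ?_, fun y hy => ?_⟩
  · exact (((SmoothJetAt.rad y).pow N).inv (pow_ne_zero N (hO y hy).1.rad_ne)).mul (hO y hy).2.1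
  · obtain ⟨h1, h2, h3, h4, h5, -⟩ := hO y hy
    rw [radDiv_inv_pow_mul h1.rad_ne h1.rho_ne h2, quadDensity, h3, h5, h4]
    simp only [Pi.zero_apply]
    ring

end NonconstantPressure

/-! ### Jets around which `p_ρ` vanishes -/

section ConstantPressure

/-- Where `p_ρ` vanishes, the pressure is a function of the entropy alone. -/
theorem lagrPressure_of_pRho_eq_zero (hz : ∀ᶠ y in 𝓝 z₀, IsRegular p y)
    (hp : ∀ᶠ x in 𝓝 (state z₀), pRho p x = 0) :
    ∀ᶠ ξ in 𝓝 (lagr N z₀), ∀ i, i ≠ 1 → pderivAt i (lagrPressure N p) ξ = 0 := by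
  have ht : Tendsto (fun ξ => state (lagrSection N z₀ ξ)) (𝓝 (lagr N z₀)) (𝓝 (state z₀)) :=
    (SmoothJetAt.state z₀).continuousAt.tendsto.comp (tendsto_lagrSection hz.self_of_nhds)
  filter_upwards [eventually_isRegular_lagrSection hz, ht.eventually hp] with ξ h1 h2 i hi
  have h3 : pRho p ((ξ 0 ^ N * ξ 2)⁻¹, ξ 1) = 0 := h2
  rw [pderivAt_lagrPressure h1.1.1 h1.1.2 h1.2, h3, if_neg hi]
  simp

/-- For a pressure depending on the entropy alone, the acceleration is `-x^N p'(S) ∂_m S`. -/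
theorem pderivAt_accel_of_pderivAt_eq_zero {P : (Fin 7 → ℝ) → ℝ} {ξ : Fin 7 → ℝ}
    (hPs : ∀ᶠ η in 𝓝 ξ, ContDiffAt ℝ ∞ P η)
    (hP : ∀ᶠ η in 𝓝 ξ, ∀ i, i ≠ 1 → pderivAt i P η = 0) :
    ∀ i ∈ ({2, 3, 5, 6} : Finset (Fin 7)), pderivAt i (accel N P) ξ = 0 := by
  intro i hi
  have h2 : ∀ i : Fin 7, 2 < i → i ≠ 1 := by decide
  have hP' := hP.mono fun η hη i hi => hη i (h2 i hi)
  have hacc := fun {i : Fin 7} (hi : 2 < i) => pderivAt_accel (N := N) hPs.self_of_nhds hP' hi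
  have hi' : i = 2 ∨ i = 3 ∨ i = 5 ∨ i = 6 := by revert i; decide
  rcases hi' with rfl | rfl | rfl | rfl
  · have e : ∀ᶠ η in 𝓝 ξ, accel N P η = -(η 0 ^ N * (pderivAt 1 P η * η 4)) := by
      filter_upwards [hP] with η hη
      rw [accel, hη 0 (by decide), hη 2 (by decide)]
      ring
    have hx : ∀ j, ContDiffAt ℝ ∞ (fun ξ : Fin 7 → ℝ => ξ j) ξ := fun j => contDiffAt_coord j ξ
    have hP1 : ContDiffAt ℝ ∞ (pderivAt 1 P) ξ := hPs.self_of_nhds.pderivAt 1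
    have h21 : pderivAt 2 (pderivAt 1 P) ξ = 0 := by
      rw [pderivAt_comm hPs.self_of_nhds, Filter.EventuallyEq.pderivAt_eq (G := fun _ => 0)
        (hP.mono fun η hη => hη 2 (by decide))]
      simp [pderivAt]
    have h3 : DifferentiableAt ℝ (fun ξ : Fin 7 → ℝ => -(ξ 0 ^ N) * ξ 4) ξ :=
      (((hx 0).pow N).neg.mul (hx 4)).differentiableAt (by simp)
    have e' : (fun η : Fin 7 → ℝ => -(η 0 ^ N * (pderivAt 1 P η * η 4))) =
        fun η => (-(η 0 ^ N) * η 4) * pderivAt 1 P η := by funext η; ring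
    rw [Filter.EventuallyEq.pderivAt_eq e, e', pderivAt_mul h3 (hP1.differentiableAt (by simp)),
      h21, pderivAt_eq_of_hasDerivAt h3 (c := 0)
        (by simpa using hasDerivAt_const (0 : ℝ) (-(ξ 0 ^ N * ξ 4)))]
    simp
  · rw [hacc (by decide)]; simp (decide := true)
  · rw [hacc (by decide), hP.self_of_nhds 2 (by decide)]; simp (decide := true)
  · rw [hacc (by decide)]; simp (decide := true)

/-- Where `p_ρ` vanishes, the coordinates other than `∂_m v`, together with `∂_m² S`, are closed
under the material derivative, so that the flux, which does not depend on `∂_m v`, is a material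
derivative. -/
theorem exists_matDeriv_eq (hz : ∀ᶠ y in 𝓝 z₀, IsRegular p y)
    (hp : ∀ᶠ x in 𝓝 (state z₀), pRho p x = 0) (hψ : SmoothNear ψ (lagr N z₀))
    (hψ5 : ∀ᶠ ξ in 𝓝 (lagr N z₀), pderivAt 5 ψ ξ = 0) :
    ∃ θ : Jet → ℝ, (∀ᶠ y in 𝓝 z₀, SmoothJetAt θ y) ∧
      (∀ᶠ y in 𝓝 z₀, matDeriv (N + 1) p θ y = -ψ (lagr N y)) ∧
      (velD 0 z₀ ≠ 0 → ∀ (s : ℝ) (y : Jet), θ (s, y.2) = θ y) := by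
  have hz0 := hz.self_of_nhds
  set ξ₀ := lagr N z₀ with hξ₀
  set G := accel N (lagrPressure N p) with hG
  have hPs : SmoothNear (lagrPressure N p) ξ₀ := by
    filter_upwards [eventually_isRegular_lagrSection hz] with ξ h
    exact contDiffAt_lagrPressure h.1.1 h.1.2 h.2
  have hGs : SmoothNear G ξ₀ := by
    filter_upwards [hPs] with ξ h using contDiffAt_accel h
  have hGi : ∀ᶠ ξ in 𝓝 ξ₀, ∀ i ∈ ({2, 3, 5, 6} : Finset (Fin 7)), pderivAt i G ξ = 0 := by
    filter_upwards [hPs.eventually_nhds,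
      (lagrPressure_of_pRho_eq_zero (N := N) hz hp).eventually_nhds] with ξ h1 h2
    exact pderivAt_accel_of_pderivAt_eq_zero h1 h2
  let J : Finset (Fin 7) := {5}
  have hfr : ∀ {F : (Fin 7 → ℝ) → ℝ}, SmoothNear F ξ₀ → (∀ᶠ ξ in 𝓝 ξ₀, pderivAt 5 F ξ = 0) →
      ∀ᶠ ξ in 𝓝 ξ₀, F (freezeCoords J ξ₀ ξ) = F ξ := fun hF h =>
    eventually_comp_freezeCoords_eq hF (h.mono fun ξ hξ i hi => by
      obtain rfl := Finset.mem_singleton.1 hi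
      exact hξ)
  have hG5 : ∀ᶠ ξ in 𝓝 ξ₀, pderivAt 5 G ξ = 0 := hGi.mono fun ξ h => h 5 (by decide)
  have hfrG := hfr hGs hG5
  have hfrGi : ∀ i, ∀ᶠ ξ in 𝓝 ξ₀, pderivAt i G (freezeCoords J ξ₀ ξ) = pderivAt i G ξ := by
    intro i
    refine hfr (hGs.pderivAt i) ?_
    filter_upwards [hGs, hG5.eventually_nhds] with ξ h1 h2
    rw [pderivAt_comm h1, Filter.EventuallyEq.pderivAt_eq (G := fun _ => 0) h2]
    simp [pderivAt]
  have hfrψ := hfr hψ hψ5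
  have hvec : ∀ (a₀ a₁ a₂ a₃ a₄ a₅ b₅ a₆ : ℝ) (i : Fin 7), i ≠ 5 →
      ![a₀, a₁, a₂, a₃, a₄, a₅, a₆] i = ![a₀, a₁, a₂, a₃, a₄, b₅, a₆] i := by
    intro a₀ a₁ a₂ a₃ a₄ a₅ b₅ a₆ i hi
    fin_cases i <;> simp at hi ⊢
  have hF : ∀ (ξ : Fin 7 → ℝ) (i : Fin 7), i ≠ 5 → freezeCoords J ξ₀ ξ i = ξ i := by
    intro ξ i hi
    simp [freezeCoords, J, hi]
  -- The field `X` represents the material derivative on the coordinates `t`, `lagr` without `y`,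
  -- and `∂_m s`; `U = X x`, so where `U ≠ 0` it is non-zero without its time component `τ`, and
  -- `θ` can be chosen independent of the time.
  let τ : ℝ := if velD 0 z₀ = 0 then 1 else 0
  let X : ℝ × (Fin 7 → ℝ) × ℝ → ℝ × (Fin 7 → ℝ) × ℝ := fun η =>
    (τ, ![η.2.1 3, 0, η.2.1 6, G η.2.1, 0, 0, η.2.1 2 * pderivAt 0 G η.2.1
      + η.2.1 4 * pderivAt 1 G η.2.1 + η.2.2 * pderivAt 4 G η.2.1], 0)
  let Y : Jet → ℝ × (Fin 7 → ℝ) × ℝ := fun y =>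
    (τ * y.1, freezeCoords J ξ₀ (lagr N y), lagrDm N y 4)
  have hYc : Tendsto (fun η : ℝ × (Fin 7 → ℝ) × ℝ => η.2.1) (𝓝 (Y z₀)) (𝓝 ξ₀) := by
    have : Continuous fun η : ℝ × (Fin 7 → ℝ) × ℝ => η.2.1 := by fun_prop
    have h := this.tendsto (Y z₀)
    rwa [show (Y z₀).2.1 = ξ₀ from freezeCoords_self J ξ₀] at h
  have hX : SmoothNear X (Y z₀) := by
    filter_upwards [hYc.eventually hGs] with η h
    have hx : ∀ i, ContDiffAt ℝ ∞ (fun η : ℝ × (Fin 7 → ℝ) × ℝ => η.2.1 i) η := fun i =>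
      ((contDiff_apply ℝ ℝ i).comp (contDiff_fst.comp contDiff_snd)).contDiffAt
    have hg : ∀ {F : (Fin 7 → ℝ) → ℝ}, ContDiffAt ℝ ∞ F η.2.1 →
        ContDiffAt ℝ ∞ (fun η : ℝ × (Fin 7 → ℝ) × ℝ => F η.2.1) η := fun hF =>
      ContDiffAt.comp (f := fun η : ℝ × (Fin 7 → ℝ) × ℝ => η.2.1) η hF
        (contDiff_fst.comp contDiff_snd).contDiffAt
    have hσ : ContDiffAt ℝ ∞ (fun η : ℝ × (Fin 7 → ℝ) × ℝ => η.2.2) η :=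
      (contDiff_snd.comp contDiff_snd).contDiffAt
    refine contDiffAt_const.prodMk (ContDiffAt.prodMk (contDiffAt_pi.2 fun i => ?_)
      contDiffAt_const)
    fin_cases i
    · exact hx 3
    · exact contDiffAt_const
    · exact hx 6
    · exact hg h
    · exact contDiffAt_const
    · exact contDiffAt_const
    · exact (((hx 2).mul (hg (h.pderivAt 0))).add ((hx 4).mul (hg (h.pderivAt 1)))).add
        (hσ.mul (hg (h.pderivAt 4)))
  have hψ' : SmoothNear (fun η : ℝ × (Fin 7 → ℝ) × ℝ => -ψ η.2.1) (Y z₀) := by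
    filter_upwards [hYc.eventually hψ] with η h
    exact (ContDiffAt.comp (f := fun η : ℝ × (Fin 7 → ℝ) × ℝ => η.2.1) η h
      (contDiff_fst.comp contDiff_snd).contDiffAt).neg
  have hX0 : X (Y z₀) ≠ 0 := by
    intro h
    have h1 : τ = 0 := congrArg Prod.fst h
    have h2 : freezeCoords J ξ₀ (lagr N z₀) 3 = 0 := congrFun (congrArg (fun η => η.2.1) h) 0
    rw [hF _ 3 (by decide)] at h2
    replace h2 : velD 0 z₀ = 0 := h2
    simp [τ, h2] at h1
  obtain ⟨θ, hθ, hθX⟩ := exists_transport hX hψ' hX0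
  have hs : ∀ᶠ y in 𝓝 z₀, SmoothJetAt (fun y => lagrDm N y 4) y ∧
      matDeriv (N + 1) p (fun y => lagrDm N y 4) y = 0 := by
    filter_upwards [hz.eventually_nhds] with y hy
    have h0 := hy.self_of_nhds
    have h4 := smoothJetAt_lagr_apply (N := N) h0.rad_ne h0.rho_ne 4
    have he : ∀ᶠ x in 𝓝 y, lagrDm N x 4 = Dm N (fun x => lagr N x 4) x := by
      filter_upwards [hy] with x hx using (Dm_lagr hx.rad_ne hx.rho_ne 4).symm
    refine ⟨(h4.Dm h0.rad_ne h0.rho_ne).congr he, ?_⟩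
    rw [matDeriv_congr he, h0.matDeriv_Dm h4, Dm_congr (G := fun _ => 0)
      (by filter_upwards [hy.eventually_nhds] with x hx using matDeriv_lagr hx 4), Dm, Dr_eq,
      lineDeriv_const, mul_zero]
  have hfrs : ∀ {y : Jet}, IsRegular p y → ∀ i,
      SmoothJetAt (fun y => freezeCoords J ξ₀ (lagr N y) i) y := by
    intro y hy i
    by_cases hi : i ∈ J
    · simpa only [freezeCoords, hi, if_true] using SmoothJetAt.const (ξ₀ i) y
    · simpa only [freezeCoords, hi, if_false] using smoothJetAt_lagr_apply hy.rad_ne hy.rho_ne i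
  have htime : ∀ y : Jet, SmoothJetAt (fun y : Jet => τ * y.1) y := fun y =>
    (SmoothJetAt.const τ y).mul (SmoothJetAt.time y)
  have hYs : ∀ᶠ y in 𝓝 z₀, SmoothJetAt Y y := by
    filter_upwards [hz, hs] with y h1 h2
    exact (htime y).prodMk ((SmoothJetAt.pi (hfrs h1)).prodMk h2.1)
  have hYt : Tendsto Y (𝓝 z₀) (𝓝 (Y z₀)) := hYs.self_of_nhds.continuousAt
  have hlt := tendsto_lagr (N := N) hz0
  refine ⟨fun y => θ (Y y), ?_, ?_, ?_⟩
  · filter_upwards [hYs, hYt.eventually hθ] with y h1 h2 using h1.comp h2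
  · filter_upwards [hYs, hYt.eventually hθ, hYt.eventually hθX, hz.eventually_nhds, hs,
      hlt.eventually hfrψ, hlt.eventually hfrG, hlt.eventually (hfrGi 0), hlt.eventually (hfrGi 1),
      hlt.eventually (hfrGi 4), hlt.eventually hGi] with y h1 h2 h3 h4 h5 h6 h7 h8 h9 h10 h11
    have hy := h4.self_of_nhds
    have hYX : lineDeriv ℝ Y y (matDir (N + 1) p y) = X (Y y) := by
      have e1 : lineDeriv ℝ (fun y : Jet => τ * y.1) y (matDir (N + 1) p y) = τ := by
        rw [(SmoothJetAt.const τ y).lineDeriv_fun_mul (SmoothJetAt.time y), lineDeriv_const]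
        have : lineDeriv ℝ (fun y : Jet => y.1) y (matDir (N + 1) p y) = 1 :=
          matDeriv_time (N + 1) p y
        rw [this]; ring
      have e3 : lineDeriv ℝ (fun y => lagrDm N y 4) y (matDir (N + 1) p y) = 0 := h5.2
      have e2 : ∀ i, lineDeriv ℝ (fun y => freezeCoords J ξ₀ (lagr N y) i) y
          (matDir (N + 1) p y) = (X (Y y)).2.1 i := by
        have hXv : (X (Y y)).2.1 = ![lagr N y 3, 0, lagr N y 6, G (lagr N y), 0, 0,
            ∑ i, lagrDm N y i * pderivAt i G (lagr N y)] := by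
          have d0 : lagrDm N y 0 = lagr N y 2 := by simp [lagrDm]
          have d1 : lagrDm N y 1 = lagr N y 4 := by simp [lagrDm]
          rw [Fin.sum_univ_seven, h11 2 (by decide), h11 3 (by decide), h11 5 (by decide),
            h11 6 (by decide), d0, d1]
          simp only [X, Y, h7, h8, h9, h10, hF _ 3 (by decide), hF _ 6 (by decide),
            hF _ 2 (by decide), hF _ 4 (by decide), mul_zero, add_zero]
        intro i
        rw [hXv]
        by_cases hi : i = 5
        · subst hi
          have : (fun y => freezeCoords J ξ₀ (lagr N y) 5) = fun _ => ξ₀ 5 := by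
            funext y; simp [freezeCoords, J]
          rw [this]
          exact lineDeriv_const _ _ _
        · rw [show (fun y => freezeCoords J ξ₀ (lagr N y) i) = fun y => lagr N y i from
            funext fun y => hF _ i hi]
          exact (matDeriv_lagr h4 i).trans (hvec _ _ _ _ _ _ _ _ i hi)
      rw [(htime y).lineDeriv_prodMk ((SmoothJetAt.pi (hfrs hy)).prodMk h5.1),
        (SmoothJetAt.pi (hfrs hy)).lineDeriv_prodMk h5.1, SmoothJetAt.lineDeriv_pi (hfrs hy),
        e1, e3, funext e2]
    rw [matDeriv, h1.lineDeriv_comp (h2.differentiableAt (by simp)), hYX, h3]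
    exact congrArg Neg.neg h6
  · intro hU s y
    have hτ : τ = 0 := if_neg hU
    have : Y (s, y.2) = Y y := by
      simp only [Y, hτ, zero_mul]
      rfl
    exact congrArg θ this

/-- Near a jet around which `p_ρ` vanishes, the flux is a material derivative, so the law is that
of an integral invariant modulo a trivial density. -/
theorem equivIntegralInvariantAt_of_pRho_eq_zero (hz : ∀ᶠ y in 𝓝 z₀, IsRegular p y)
    (H : LagrangianSystem N W (lagrPressure N p) f ψ) (hW : lagr N z₀ ∈ W)
    (hcons : ∀ᶠ y in 𝓝 z₀, matDeriv (N + 1) p (fun y => f (lagr N y)) y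
      + Dm N (fun y => ψ (lagr N y)) y = 0)
    (hΦ : ∀ᶠ y in 𝓝 z₀, Φ y = rhoD 0 y * f (lagr N y))
    (hp : ∀ᶠ x in 𝓝 (state z₀), pRho p x = 0) : EquivIntegralInvariantAt (N + 1) p Φ z₀ := by
  have hev := H.isOpen.eventually_mem hW
  obtain ⟨θ, hθ, hθd, ht⟩ := exists_matDeriv_eq (N := N) (ψ := ψ) hz hp
    (hev.mono fun ξ hξ => H.smoothψ ξ hξ) (by
      filter_upwards [hev, lagrPressure_of_pRho_eq_zero (N := N) hz hp] with ξ h1 h2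
      rw [H.ey ξ h1, h2 2 (by decide)]
      simp)
  refine equivIntegralInvariantAt_of_matDeriv (N := N) (a := fun y => f (lagr N y)) hz
    (eventually_smoothJetAt_comp_lagr hz (hev.mono fun ξ hξ => H.smoothf ξ hξ)) hθ hΦ ?_ ht
  filter_upwards [hcons, hθd.eventually_nhds, eventually_smoothJetAt_comp_lagr hz
    (hev.mono fun ξ hξ => H.smoothψ ξ hξ)] with y h1 h2 h3
  have h4 : Dm N (fun y => -ψ (lagr N y)) y = -Dm N (fun y => ψ (lagr N y)) y := by
    rw [Dm, Dr_eq, h3.lineDeriv_fun_neg, mul_neg]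
    rfl
  rw [Dm_congr h2, h4]
  linarith

end ConstantPressure

end

end RadialFlow

/-! ### Classification of the conserved densities -/

open RadialFlow in
theorem corollary1 (n : ℕ) (hn : 2 ≤ n)
    (Ω : Set (ℝ × ℝ)) (hΩ : IsOpen Ω) (p : ℝ × ℝ → ℝ) (hp : ContDiffOn ℝ ∞ p Ω)
    (D : Set (ℝ × ℝ × ℝ × ℝ × ℝ × ℝ)) (hD : IsOpen D)
    (hDpos : ∀ x ∈ D, 0 < x.1 ∧ 0 < x.2.2.1 ∧ (x.2.2.1, x.2.2.2.1) ∈ Ω)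
    (φ₂ φ₁ φ₀ : ℝ × ℝ × ℝ × ℝ × ℝ × ℝ → ℝ)
    (hφ₂ : ContDiffOn ℝ ∞ φ₂ D) (hφ₁ : ContDiffOn ℝ ∞ φ₁ D) (hφ₀ : ContDiffOn ℝ ∞ φ₀ D)
    (hcons : RadialFlow.IsConservedOn n p (RadialFlow.quadDensity φ₂ φ₁ φ₀)
      (RadialFlow.coeffArgs ⁻¹' D)) :
    (RadialFlow.IsEssentialOn n (RadialFlow.quadDensity φ₂ φ₁ φ₀)
        (RadialFlow.coeffArgs ⁻¹' D) →
      ∀ z : RadialFlow.Jet, RadialFlow.coeffArgs z ∈ D →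
        RadialFlow.EquivIntegralInvariantAt n p (RadialFlow.quadDensity φ₂ φ₁ φ₀) z) ∧
    (∀ z : RadialFlow.Jet, RadialFlow.coeffArgs z ∈ D →
      (∀ᶠ x in 𝓝 (RadialFlow.state z), RadialFlow.pRho p x = 0) →
        RadialFlow.EquivIntegralInvariantAt n p (RadialFlow.quadDensity φ₂ φ₁ φ₀) z) ∧
    (∀ z : RadialFlow.Jet, RadialFlow.coeffArgs z ∈ D →
      RadialFlow.pRho p (RadialFlow.state z) ≠ 0 →
        RadialFlow.EquivIntegralInvariantModKinematicAt n p
          (RadialFlow.quadDensity φ₂ φ₁ φ₀) z) := by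
  obtain ⟨N, rfl⟩ : ∃ N, n = N + 1 := ⟨n - 1, by omega⟩
  have hN : N ≠ 0 := by omega
  set Φ := quadDensity φ₂ φ₁ φ₀ with hΦdef
  obtain ⟨Φr, hΦs, hΦrs, hlaw⟩ := hcons
  have hcoeff : Continuous coeffArgs := by
    have hr : ∀ i j, Continuous fun z : Jet => z.2.2 i j := by intro i j; fun_prop
    exact (continuous_fst.comp continuous_snd).prodMk ((hr 0 0).prodMk ((hr 0 1).prodMk
      ((hr 0 2).prodMk ((hr 1 1).prodMk (hr 1 2)))))
  have hopen : IsOpen (coeffArgs ⁻¹' D) := hD.preimage hcoeff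
  have key : ∀ z, coeffArgs z ∈ D → (∀ᶠ y in 𝓝 z, IsRegular p y) ∧
      ∃ f ψ W, lagr N z ∈ W ∧ LagrangianSystem N W (lagrPressure N p) f ψ ∧
        (∀ᶠ y in 𝓝 z, matDeriv (N + 1) p (fun y => f (lagr N y)) y
          + Dm N (fun y => ψ (lagr N y)) y = 0) ∧
        ∀ᶠ y in 𝓝 z, Φ y = rhoD 0 y * f (lagr N y) := by
    intro z hz
    have hmem : ∀ᶠ y in 𝓝 z, y ∈ coeffArgs ⁻¹' D := hopen.mem_nhds hz
    have hreg : ∀ᶠ y in 𝓝 z, IsRegular p y := by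
      filter_upwards [hmem] with y hy
      obtain ⟨h1, h2, h3⟩ := hDpos _ hy
      exact ⟨h1.ne', h2.ne', hp.contDiffAt (hΩ.mem_nhds h3)⟩
    have h1 : ∀ᶠ y in 𝓝 z, SmoothJetAt Φ y := hmem.mono hΦs
    have h2 : ∀ᶠ y in 𝓝 z, SmoothJetAt Φr y := hmem.mono hΦrs
    have h3 : ∀ᶠ y in 𝓝 z, Φ (freezeJet z y) = Φ y :=
      Eventually.of_forall fun y => quadDensity_freezeJet y
    have h4 := lagrangian_conservation (N := N) hreg h1 h2 h3 (hmem.mono hlaw)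
    have h5 := smoothNear_lagrDensity (N := N) hreg.self_of_nhds h1
    obtain ⟨W, hW, H⟩ := exists_lagrangianSystem hreg h5
      (smoothNear_lagrFlux hreg.self_of_nhds h1 h2) (lagrDensity_quadDensity_cubic h5) h4
    exact ⟨hreg, _, _, W, hW, H, h4, eventually_eq_lagrDensity hreg h3⟩
  have part2 : ∀ z : Jet, coeffArgs z ∈ D → (∀ᶠ x in 𝓝 (state z), pRho p x = 0) →
      EquivIntegralInvariantAt (N + 1) p Φ z := by
    intro z hz hpz
    obtain ⟨hreg, f, ψ, W, hW, H, hc, hΦ⟩ := key z hz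
    exact equivIntegralInvariantAt_of_pRho_eq_zero hreg H hW hc hΦ hpz
  refine ⟨fun hess z hz => part2 z hz ?_, part2, fun z hz hpz => ?_⟩
  -- where `p_ρ ≠ 0` the dependence on `U_r` could be removed, so essential dependence forces
  -- `p_ρ = 0` throughout
  · have h0 : ∀ y, coeffArgs y ∈ D → pRho p (state y) = 0 := by
      intro y hy
      by_contra hne
      obtain ⟨hreg, f, ψ, W, hW, H, -, hΦ⟩ := key y hy
      obtain ⟨O, hO, hne', hsub, hred⟩ := exists_isReducibleOn hN hreg H hW hΦ hne
        (hopen.mem_nhds hy)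
      exact hess O hO hne' hsub hred
    have hc : Continuous fun x : ℝ × ℝ =>
        (rad z, velD 0 z, x.1, x.2, rhoD 1 z, entD 1 z) := by fun_prop
    filter_upwards [hc.continuousAt.eventually (hD.mem_nhds (show _ ∈ D from hz))] with x hx
    exact h0 (z.1, z.2.1, fun i => if i = 0 then ![velD 0 z, x.1, x.2] else z.2.2 i) hx
  · obtain ⟨hreg, f, ψ, W, hW, H, hc, hΦ⟩ := key z hz
    exact equivIntegralInvariantModKinematicAt hN hreg H hW hc hΦ hpz
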